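/- **Setting.** Let $p$ be a prime, $\mathcal O_K$ a complete discrete valuation ring of characteristic $0$ with perfect residue field of characteristic $p$, $K$ its fraction field, $\overline K$ an algebraic closure of $K$, $\mathcal O_{\overline K}$ the integral closure of $\mathcal O_K$ in $\overline K$, $\mathcal O_C$ its $p$-adic completion. Fix a uniformizer $\pi$ of $\mathcal O_K$ and elements $p^{1/n}\in\mathcal O_{\overline K}$ $(n\ge 1)$ with $p^{1/1}=p$ and $(p^{1/mn})^m=p^{1/n}$; put $p^{\varepsilon}=(p^{1/n})^{\varepsilon n}$ for $\varepsilon\in\frac1n\mathbb Z_{\ge0}$. Let $P$ be a toric monoid (commutative, finitely generated, saturated, with $P^{\rm gp}$ free), $\vartheta:\mathbb N\to P$ a homomorphism, $\lambda=\vartheta(1)$, $R$ an $\mathcal O_K$-algebra and $\gamma:P\to(R,\times)$ a homomorphism of monoids with $\gamma(\lambda)=\pi$, such that: $\operatorname{Spec}R$ is connected; $R/\pi R\neq0$; $\vartheta$ is saturated (every amalgamated sum $M\oplus_{\mathbb N}P$ is integral when $M$ is an integral monoid, and saturated when $M$ is a saturated monoid); $\vartheta^{\rm gp}:\mathbb Z\to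 P^{\rm gp}$ is injective and the torsion subgroup of $P^{\rm gp}/\mathbb Z\lambda$ has order prime to $p$; the homomorphism $\mathcal O_K[P]/(\pi-e^\lambda)\to R$, $e^t\mapsto\gamma(t)$, is étale; there are $h_1,\dots,h_r\in\operatorname{Hom}(P,\mathbb N)$, linearly independent over $\mathbb Z$ in $\operatorname{Hom}(P^{\rm gp},\mathbb Z)$, such that $\{h\in\operatorname{Hom}(P,\mathbb N): h(\lambda)=0\}=\{\sum a_ih_i: a_i\in\mathbb N\}$. Let $F^a$ be a separably closed field containing $R$ and $\overline K$ compatibly over $\mathcal O_K$, and let $\gamma_n:P\to(F^a,\times)$ $(n\ge1)$ be homomorphisms of monoids with $\gamma_1=\gamma$ and $\gamma_{mn}(t)^m=\gamma_n(t)$. Let $R_1\subset F^a$ be the image of $R\otimes_{\mathcal O_K}\mathcal O_{\overline K}$, $\widehat{R_1}$ its $p$-adic completion, $F_1=\operatorname{Frac}R_1$, $F_\infty=F_1(\gamma_n(t):n\ge1,\ t\in P)$, and $\Delta_\infty=\operatorname{Gal}(F_\infty/F_1)$ with its Krull topology. Let $\widetilde\Omega$ be the $R$-module of logarithmic differentials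 of $(R,P)$ over $(\mathcal O_K,\mathbb N)$, i.e. the quotient of $\Omega^1_{R/\mathcal O_K}\oplus(R\otimes_{\mathbb Z}P^{\rm gp})$ by the submodule generated by the elements $(d\gamma(t),-\gamma(t)\otimes t)$ $(t\in P)$ and $(0,1\otimes\lambda)$; $d\log t$ is the class of $(0,1\otimes t)$. For $t\in P$ let $\chi_t:\Delta_\infty\to\mathbb Z_p(1)=\varprojlim_n\mu_{p^n}(\mathcal O_{\overline K})$ be defined by $g(\gamma_{p^n}(t))=\chi_t(g)_n\,\gamma_{p^n}(t)$. Let $\theta_0:W(\varprojlim_{x\mapsto x^p}\mathcal O_C/p)\to\mathcal O_C$ be Fontaine's homomorphism, $\xi\mathcal O_C=\ker\theta_0/(\ker\theta_0)^2$, $\xi^{-1}\mathcal O_C$ its $\mathcal O_C$-dual, and, for $\zeta\in\mathbb Z_p(1)$, $\log[\zeta]\in\xi\mathcal O_C$ the class of $[\zeta]-1$. Put $E=\xi^{-1}\widetilde\Omega\otimes_R\widehat{R_1}:=(\widehat{R_1}\otimes_R\widetilde\Omega)\otimes_{\mathcal O_C}\xi^{-1}\mathcal O_C$. **Categories.** Let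 $\alpha,\beta>0$ be rational. A representation is an $\widehat{R_1}$-module $M$ with an $\widehat{R_1}$-linear action $\varphi$ of $\Delta_\infty$ that is continuous for the $p$-adic topology of $M$. It is *$\alpha$-quasi-small* if $M$ is $p$-adically complete and separated and generated by finitely many elements that are $\Delta_\infty$-invariant modulo $p^\alpha M$; it is *$\alpha$-small* if $M$ is free of finite rank with a basis of elements that are $\Delta_\infty$-invariant modulo $p^\alpha M$. A Higgs module is an $\widehat{R_1}$-module $N$ with an $\widehat{R_1}$-linear map $\theta:N\to N\otimes_{\widehat{R_1}}E$ such that $\theta\wedge\theta=0$ in $\operatorname{Hom}(N,N\otimes\wedge^2E)$; a morphism of Higgs modules is an $\widehat{R_1}$-linear map $u$ with $(u\otimes\mathrm{id}_E)\circ\theta=\theta'\circ u$. It is *$\beta$-quasi-small* if $N$ is finitely generated and $\theta$ is a multiple of $p^\beta$ in $\operatorname{Hom}_{\widehat{R_1}}(N,N\otimes E)$, and *$\beta$-small* if moreover $N$ is free. Let $\mathbf{Rep}^{\alpha\text{-qpp}}$ (resp. $\mathbf{MH}^{\beta\text{-qpp}}$) be the category of $\alpha$-quasi-small representations (resp. $\beta$-quasi-small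 Higgs modules) whose underlying $\mathcal O_C$-module is flat, and $\mathbf{Rep}^{\alpha\text{-p}}$ (resp. $\mathbf{MH}^{\beta\text{-p}}$) the category of $\alpha$-small representations (resp. $\beta$-small Higgs modules). **Proposition 11.7 (Faltings).** Let $\alpha>\frac1{p-1}$ be rational and $\beta=\alpha-\frac1{p-1}$. (a) For every finitely generated $\mathcal O_C$-flat $\widehat{R_1}$-module $M$, contraction with the $\widehat{R_1}$-linear map $E\to\operatorname{Hom}(\Delta_\infty,\widehat{R_1})$, $(1\otimes d\log t)\otimes\mu\mapsto(g\mapsto\mu(\log[\chi_t(g)]))$, induces a bijection $$p^\beta\operatorname{Hom}_{\widehat{R_1}}(M,M\otimes E)\xrightarrow{\ \sim\ }\operatorname{Hom}_{\mathbb Z}(\Delta_\infty,p^\alpha\operatorname{End}_{\widehat{R_1}}(M)).$$ Let $\Psi_M$ denote its inverse. (b) The rules $(M,\varphi)\mapsto(M,\Psi_M(\log\varphi))$, where $\log(\varphi(g))=\sum_{n\ge0}\frac{(-1)^n}{n+1}(\varphi(g)-\mathrm{id})^{n+1}$, and $(M,\theta)\mapsto(M,\exp\Psi_M^{-1}(\theta))$,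 where $\exp(v)=\sum_{n\ge0}\frac1{n!}v^n$ (pointwise $p$-adically convergent series), are well-defined functors, identical on the underlying linear maps, between $\mathbf{Rep}^{\alpha\text{-qpp}}$ and $\mathbf{MH}^{\beta\text{-qpp}}$, and they are equivalences of categories quasi-inverse to each other. (c) These functors induce equivalences of categories, quasi-inverse to each other, between $\mathbf{Rep}^{\alpha\text{-p}}$ and $\mathbf{MH}^{\beta\text{-p}}$. -/

import Mathlib

open CategoryTheory
open scoped TensorProduct

universe u

namespace FaltingsHiggs

noncomputable section

/-! ### Monoids -/

/-- A commutative monoid `M` is integral when `M → M^gp` is injective. -/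
def IsIntegralMonoid (M : Type u) [AddCommMonoid M] : Prop :=
  Function.Injective (Algebra.GrothendieckAddGroup.of : M →+ Algebra.GrothendieckAddGroup M)

/-- A commutative monoid is saturated when it is integral and every `x ∈ M^gp` having a positive
multiple in `M` lies in `M`. -/
def IsSaturatedMonoid (M : Type u) [AddCommMonoid M] : Prop :=
  IsIntegralMonoid M ∧
    ∀ (x : Algebra.GrothendieckAddGroup M) (n : ℕ), 0 < n →
      n • x ∈ Set.range (Algebra.GrothendieckAddGroup.of : M →+ Algebra.GrothendieckAddGroup M) →
      x ∈ Set.range (Algebra.GrothendieckAddGroup.of : M →+ Algebra.GrothendieckAddGroup M)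

/-- A toric monoid: finitely generated, saturated, with free associated group. -/
structure IsToricMonoid (P : Type u) [AddCommMonoid P] : Prop where
  fg : AddMonoid.FG P
  saturated : IsSaturatedMonoid P
  free : Module.Free ℤ (Algebra.GrothendieckAddGroup P)

/-- The amalgamated sum `M' ⊕_ℕ P` of two commutative monoids along the homomorphisms
`ℕ → M', 1 ↦ m` and `ℕ → P, 1 ↦ l`: the quotient of `M' × P` by the congruence generated by
`(m, 0) ~ (0, l)`. -/
abbrev Amalgam {M P : Type u} [AddCommMonoid M] [AddCommMonoid P] (m : M) (l : P) : Type u :=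
  (addConGen fun x y : M × P => x = (m, 0) ∧ y = (0, l)).Quotient

/-- The homomorphism `ℕ → P, 1 ↦ l` is saturated: it is integral (every amalgamated sum
`M ⊕_ℕ P` with `M` integral is integral) and every amalgamated sum `M ⊕_ℕ P` with `M` saturated
is saturated. A homomorphism `ℕ → M` is the choice of `m ∈ M`. -/
def IsSaturatedHom {P : Type u} [AddCommMonoid P] (l : P) : Prop :=
  (∀ (M : Type u) [AddCommMonoid M] (m : M), IsIntegralMonoid M → IsIntegralMonoid (Amalgam m l)) ∧
  (∀ (M : Type u) [AddCommMonoid M] (m : M), IsSaturatedMonoid M → IsSaturatedMonoid (Amalgam m l))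

/-- The ring `A[P]/(π - e^l)`. -/
abbrev ChartRing (A P : Type u) [CommRing A] [AddCommMonoid P] (ϖ : A) (l : P) : Type u :=
  AddMonoidAlgebra A P ⧸
    (Ideal.span {algebraMap A (AddMonoidAlgebra A P) ϖ - AddMonoidAlgebra.of A P (.ofAdd l)})

/-- The homomorphism `A[P]/(π - e^l) → R` induced by a homomorphism of monoids `γ : P → (R, ×)`
such that `γ l = π`. -/
def chartHom {A P R : Type u} [CommRing A] [AddCommMonoid P] [CommRing R] [Algebra A R]
    {ϖ : A} {l : P} (γ : Multiplicative P →* R) (h : γ (.ofAdd l) = algebraMap A R ϖ) :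
    ChartRing A P ϖ l →ₐ[A] R :=
  Ideal.Quotient.liftₐ _ (AddMonoidAlgebra.lift A R P γ) (by
    intro a ha
    have : Ideal.span {algebraMap A (AddMonoidAlgebra A P) ϖ -
        AddMonoidAlgebra.of A P (.ofAdd l)} ≤ RingHom.ker (AddMonoidAlgebra.lift A R P γ) := by
      rw [Ideal.span_singleton_le_iff_mem, RingHom.mem_ker, map_sub, AlgHom.commutes]
      simp [h]
    exact this ha)

theorem chartHom_monomial {A P R : Type u} [CommRing A] [AddCommMonoid P] [CommRing R]
    [Algebra A R] {ϖ : A} {l : P} (γ : Multiplicative P →* R)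
    (h : γ (.ofAdd l) = algebraMap A R ϖ) (t : P) :
    chartHom γ h (Ideal.Quotient.mk _ (AddMonoidAlgebra.of' A P t)) = γ (.ofAdd t) := by
  change AddMonoidAlgebra.lift A R P γ (AddMonoidAlgebra.of' A P t) = _
  simp

/-- The setting: a toric chart of an affine logarithmic scheme `X = Spec R` over a complete discrete
valuation ring `O_K` of mixed characteristic `(0, p)`, with a geometric generic point of
`X ⊗ O_K̄` and a compatible system of points of the coverings of `X` defined by the roots of the
elements of the monoid `P`. The logarithmic structures of `X` and `Spec O_K` are those defined by
the chart `P → R` and by the uniformizer; they are determined by the data below. -/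
structure Setting (p : ℕ) [Fact p.Prime] where
  /-- the base `O_K`: a complete discrete valuation ring of characteristic `0` with perfect
  residue field of characteristic `p` -/
  𝒪K : Type u
  [commRing𝒪K : CommRing 𝒪K]
  [isDomain𝒪K : IsDomain 𝒪K]
  [dvr𝒪K : IsDiscreteValuationRing 𝒪K]
  [complete𝒪K : IsAdicComplete (IsLocalRing.maximalIdeal 𝒪K) 𝒪K]
  [charZero𝒪K : CharZero 𝒪K]
  [charPResidue : CharP (IsLocalRing.ResidueField 𝒪K) p]
  [perfectResidue : PerfectField (IsLocalRing.ResidueField 𝒪K)]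
  /-- the fraction field `K` of `O_K` -/
  K : Type u
  [fieldK : Field K]
  [algebra𝒪KK : Algebra 𝒪K K]
  [isFractionRingK : IsFractionRing 𝒪K K]
  /-- an algebraic closure of `K` -/
  Kbar : Type u
  [fieldKbar : Field Kbar]
  [algebraKKbar : Algebra K Kbar]
  [isAlgClosureKbar : IsAlgClosure K Kbar]
  [algebra𝒪KKbar : Algebra 𝒪K Kbar]
  [tower𝒪KKKbar : IsScalarTower 𝒪K K Kbar]
  /-- a compatible system of `n`-th roots of `p`, `rootP n` being an `n`-th root for `n ≥ 1` -/
  rootP : ℕ → integralClosure 𝒪K Kbar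
  rootP_one : rootP 1 = p
  rootP_mul : ∀ m n : ℕ, 0 < m → 0 < n → rootP (m * n) ^ m = rootP n
  /-- a uniformizer of `O_K` -/
  ϖ : 𝒪K
  irreducible_ϖ : Irreducible ϖ
  /-- the toric monoid `P` of the chart, and `l = ϑ 1` for `ϑ : ℕ → P` -/
  P : Type u
  [addCommMonoidP : AddCommMonoid P]
  isToricMonoidP : IsToricMonoid P
  l : P
  /-- the coordinate ring `R` of the connected affine scheme `X` over `O_K` -/
  R : Type u
  [commRingR : CommRing R]
  [algebra𝒪KR : Algebra 𝒪K R]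
  [connected : ConnectedSpace (PrimeSpectrum R)]
  /-- the special fibre of `X` is non-empty -/
  specialFibre_nonempty : ¬ IsUnit (algebraMap 𝒪K R ϖ)
  /-- the chart `P → R` -/
  γ : Multiplicative P →* R
  γ_l : γ (.ofAdd l) = algebraMap 𝒪K R ϖ
  /-- `ϑ` is saturated -/
  saturated : IsSaturatedHom l
  /-- `ϑ^gp` is injective -/
  injective_gp : ∀ n : ℤ, n • Algebra.GrothendieckAddGroup.of l = 0 → n = 0
  /-- the torsion of `P^gp / ℤλ` has order prime to `p` -/
  coprime_torsion : (Nat.card (AddCommGroup.torsion (Algebra.GrothendieckAddGroup P ⧸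
    AddSubgroup.zmultiples (Algebra.GrothendieckAddGroup.of l)))).Coprime p
  /-- `X → Spec (O_K[P]/(π - e^λ))` is étale -/
  etale : (chartHom γ γ_l).toRingHom.Etale
  /-- there are homomorphisms `h_1, …, h_r : P → ℕ`, linearly independent in
  `Hom_ℤ(P^gp, ℤ) = Hom(P, ℤ)`, such that the homomorphisms `P → ℕ` vanishing at `λ` are
  the linear combinations of the `h_i` with coefficients in `ℕ` -/
  exists_basis : ∃ (r : ℕ) (h : Fin r → (P →+ ℕ)),
    LinearIndependent ℤ (fun i => (Nat.castAddMonoidHom ℤ).comp (h i)) ∧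
    ∀ f : P →+ ℕ, f l = 0 ↔ ∃ a : Fin r → ℕ, f = ∑ i, a i • h i
  /-- a separably closed field `F^a` containing `K̄` and the fraction field of `R`: the geometric
  point of `X ⊗ O_K̄` -/
  Fa : Type u
  [fieldFa : Field Fa]
  [isSepClosedFa : IsSepClosed Fa]
  [algebra𝒪KFa : Algebra 𝒪K Fa]
  [algebraKbarFa : Algebra Kbar Fa]
  [algebraRFa : Algebra R Fa]
  [towerKbar : IsScalarTower 𝒪K Kbar Fa]
  [towerR : IsScalarTower 𝒪K R Fa]
  injective_R : Function.Injective (algebraMap R Fa)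
  /-- the compatible system of points of the coverings `X_n = Spec (R ⊗_{ℤ[P], n} ℤ[P])`: the
  homomorphism `P → F^a` attached to the point of `X_n` is `root n`, `n ≥ 1` -/
  root : ℕ → (Multiplicative P →* Fa)
  root_one : ∀ t, root 1 t = algebraMap R Fa (γ t)
  root_mul : ∀ m n : ℕ, 0 < m → 0 < n → ∀ t, root (m * n) t ^ m = root n t

namespace Setting

attribute [instance] commRing𝒪K isDomain𝒪K dvr𝒪K complete𝒪K charZero𝒪K charPResidue
  perfectResidue fieldK algebra𝒪KK isFractionRingK fieldKbar algebraKKbar isAlgClosureKbar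
  algebra𝒪KKbar tower𝒪KKKbar addCommMonoidP commRingR algebra𝒪KR connected fieldFa isSepClosedFa
  algebra𝒪KFa algebraKbarFa algebraRFa towerKbar towerR

variable {p : ℕ} [Fact p.Prime] (S : Setting.{u} p)

/-- `O_K̄`, the integral closure of `O_K` in `K̄`. -/
abbrev OKbar : Type u := integralClosure S.𝒪K S.Kbar

/-- `O_C`, the `p`-adic completion of `O_K̄`. -/
def OC : Type u := AdicCompletion (Ideal.span {(p : S.OKbar)}) S.OKbar

instance : CommRing S.OC :=
  inferInstanceAs (CommRing (AdicCompletion (Ideal.span {(p : S.OKbar)}) S.OKbar))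

instance : Algebra S.OKbar S.OC :=
  inferInstanceAs (Algebra S.OKbar (AdicCompletion (Ideal.span {(p : S.OKbar)}) S.OKbar))

/-- `R_1`, the image of `R ⊗ O_K̄` in `F^a`. -/
def R1 : Subalgebra S.OKbar S.Fa := Algebra.adjoin S.OKbar (Set.range (algebraMap S.R S.Fa))

/-- the structure of `R`-algebra on `R_1` -/
instance : Algebra S.R S.R1 :=
  ((algebraMap S.R S.Fa).codRestrict S.R1 fun r => Algebra.subset_adjoin ⟨r, rfl⟩).toAlgebra

/-- the `p`-adic completion of `R_1` -/
def R1hat : Type u := AdicCompletion (Ideal.span {(p : S.R1)}) S.R1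

instance : CommRing S.R1hat :=
  inferInstanceAs (CommRing (AdicCompletion (Ideal.span {(p : S.R1)}) S.R1))

instance : Algebra S.R1 S.R1hat :=
  inferInstanceAs (Algebra S.R1 (AdicCompletion (Ideal.span {(p : S.R1)}) S.R1))

/-- the structure of `R`-algebra on `R̂_1` -/
instance : Algebra S.R S.R1hat := ((algebraMap S.R1 S.R1hat).comp (algebraMap S.R S.R1)).toAlgebra

end Setting

/-- The homomorphism between `p`-adic completions induced by a homomorphism of rings `A → B`. -/
def completionMap (p : ℕ) (A B : Type u) [CommRing A] [CommRing B] [Algebra A B] :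
    AdicCompletion (Ideal.span {(p : A)}) A →+* AdicCompletion (Ideal.span {(p : B)}) B :=
  have h (n : ℕ) : Ideal.span {(p : A)} ^ n ≤
      (Ideal.span {(p : B)} ^ n).comap (algebraMap A B) := by
    rw [← Ideal.map_le_iff_le_comap, Ideal.map_pow, Ideal.map_span]
    simp
  AdicCompletion.liftRingHom (Ideal.span {(p : B)})
    (fun n => (Ideal.quotientMap (Ideal.span {(p : B)} ^ n) (algebraMap A B) (h n)).comp
      (AdicCompletion.evalₐ (Ideal.span {(p : A)}) n).toRingHom)
    (by
      intro m n hle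
      ext x
      obtain ⟨y, rfl⟩ := AdicCompletion.mk_surjective _ _ x
      simp only [RingHom.comp_apply, AlgHom.toRingHom_eq_coe, RingHom.coe_coe,
        AdicCompletion.evalₐ_mk, Ideal.quotientMap_mk]
      erw [Ideal.Quotient.factor_mk]
      rw [Ideal.Quotient.eq, ← map_sub]
      apply h m
      rw [← Ideal.Quotient.eq]
      have := AdicCompletion.Ideal.mk_eq_mk (I := Ideal.span {(p : A)}) hle y
      exact this)

theorem isAdicComplete_completion (p : ℕ) (A : Type u) [CommRing A] :
    IsAdicComplete (Ideal.span {(p : AdicCompletion (Ideal.span {(p : A)}) A)})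
      (AdicCompletion (Ideal.span {(p : A)}) A) := by
  have h := AdicCompletion.isAdicComplete (M := A) (I := Ideal.span {(p : A)})
    (Submodule.fg_span (Set.finite_singleton _))
  have e : Ideal.span {(p : AdicCompletion (Ideal.span {(p : A)}) A)} =
      (Ideal.span {(p : A)}).map (algebraMap A (AdicCompletion (Ideal.span {(p : A)}) A)) := by
    simp [Ideal.map_span]
  rw [e, IsAdicComplete.map_algebraMap_iff]
  exact h

namespace Setting
variable {p : ℕ} [Fact p.Prime] (S : Setting.{u} p)

instance : Algebra S.OC S.R1hat := (completionMap p S.OKbar S.R1).toAlgebra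

instance : IsAdicComplete (Ideal.span {(p : S.OC)}) S.OC :=
  isAdicComplete_completion p S.OKbar

theorem not_isUnit_p : ¬ IsUnit (p : S.𝒪K) := by
  intro h
  have := h.map (IsLocalRing.residue S.𝒪K)
  rw [map_natCast, CharP.cast_eq_zero] at this
  exact not_isUnit_zero this

theorem injective_OKbar : Function.Injective (algebraMap S.𝒪K S.OKbar) := by
  have h : Function.Injective (algebraMap S.𝒪K S.Kbar) := by
    rw [IsScalarTower.algebraMap_eq S.𝒪K S.K S.Kbar]
    exact (algebraMap S.K S.Kbar).injective.comp (IsFractionRing.injective S.𝒪K S.K)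
  intro x y hxy
  exact h (congrArg (algebraMap S.OKbar S.Kbar) hxy)

theorem not_isUnit_p_OKbar : ¬ IsUnit (p : S.OKbar) := by
  intro h
  have : FaithfulSMul S.𝒪K S.OKbar :=
    (faithfulSMul_iff_algebraMap_injective _ _).2 S.injective_OKbar
  have : IsLocalHom (algebraMap S.𝒪K S.OKbar) := inferInstance
  apply S.not_isUnit_p
  apply isUnit_of_map_unit (algebraMap S.𝒪K S.OKbar)
  simpa using h

instance : Fact (¬ IsUnit (p : S.OC)) := ⟨by
  intro h
  replace h : IsUnit (p : AdicCompletion (Ideal.span {(p : S.OKbar)}) S.OKbar) := h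
  have := h.map (AdicCompletion.evalₐ (Ideal.span {(p : S.OKbar)}) 1)
  rw [map_natCast, pow_one] at this
  apply S.not_isUnit_p_OKbar
  have h0 : (p : S.OKbar ⧸ Ideal.span {(p : S.OKbar)}) = 0 := by
    rw [← map_natCast (Ideal.Quotient.mk (Ideal.span {(p : S.OKbar)}))]
    exact Ideal.Quotient.eq_zero_iff_mem.2 (Ideal.mem_span_singleton_self _)
  rw [h0, isUnit_zero_iff] at this
  rw [← Ideal.span_singleton_eq_top, ← Ideal.Quotient.subsingleton_iff]
  exact subsingleton_of_zero_eq_one this⟩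

/-- Fontaine's homomorphism `θ : W(lim O_C/p) → O_C`. -/
def theta : WittVector p (PreTilt S.OC p) →+* S.OC := WittVector.fontaineTheta S.OC p

/-- `ξO_C = ker θ / (ker θ)²`. -/
abbrev Xi : Type u := (RingHom.ker S.theta).Cotangent

/-- `ξ⁻¹O_C`, the `O_C`-dual of `ξO_C`. -/
abbrev XiInv : Type u := S.Xi →ₛₗ[S.theta] S.OC

/-- `ℤ_p(1) = lim μ_{p^n}(O_K̄)`, written multiplicatively. -/
def Zp1 : Subgroup (ℕ → S.OKbarˣ) where
  carrier := {ζ | ζ 0 = 1 ∧ ∀ n, ζ (n + 1) ^ p = ζ n}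
  mul_mem' := by
    rintro a b ⟨ha, ha'⟩ ⟨hb, hb'⟩
    exact ⟨by simp [ha, hb], fun n => by simp [mul_pow, ha', hb']⟩
  one_mem' := ⟨rfl, fun n => one_pow _⟩
  inv_mem' := by
    rintro a ⟨ha, ha'⟩
    exact ⟨by simp [ha], fun n => by simp [ha']⟩

theorem Zp1_pow (ζ : S.Zp1) (n : ℕ) : (ζ : ℕ → S.OKbarˣ) n ^ p ^ n = 1 := by
  induction n with
  | zero => simpa using ζ.2.1
  | succ n ih => rw [pow_succ', pow_mul, ζ.2.2 n, ih]

/-- The element of `lim O_C/p` defined by an element of `ℤ_p(1)`. -/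
def tiltHom : S.Zp1 →* PreTilt S.OC p where
  toFun ζ := ⟨fun n => Ideal.Quotient.mk _ (algebraMap S.OKbar S.OC ((ζ : ℕ → S.OKbarˣ) n)),
    fun n => by rw [← map_pow, ← map_pow, ← Units.val_pow_eq_pow_val, ζ.2.2 n]⟩
  map_one' := by
    apply Subtype.ext
    funext n
    change Ideal.Quotient.mk _ (algebraMap S.OKbar S.OC 1) = 1
    simp
  map_mul' ζ ζ' := by
    apply Subtype.ext
    funext n
    change Ideal.Quotient.mk _ (algebraMap S.OKbar S.OC _) =
      Ideal.Quotient.mk _ (algebraMap S.OKbar S.OC _) *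
      Ideal.Quotient.mk _ (algebraMap S.OKbar S.OC _)
    rw [← map_mul, ← map_mul]
    rfl

theorem untilt_tiltHom (ζ : S.Zp1) : (S.tiltHom ζ).untilt = 1 := by
  have key (n : ℕ) : (p : S.OC) ^ (n + 1) ∣ (S.tiltHom ζ).untilt - 1 := by
    rw [← PreTilt.untilt_iterate_frobeniusEquiv_symm_pow (S.tiltHom ζ) n]
    have h1 : (algebraMap S.OKbar S.OC ((ζ : ℕ → S.OKbarˣ) n)) ^ p ^ n = 1 := by
      rw [← map_pow, ← Units.val_pow_eq_pow_val, S.Zp1_pow]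
      simp
    rw [← h1]
    apply dvd_sub_pow_of_dvd_sub
    rw [← Ideal.mem_span_singleton, ← Ideal.Quotient.eq]
    refine (PreTilt.mk_untilt_eq_coeff_zero _).trans ?_
    rw [PreTilt.coeff_iterate_frobeniusEquiv_symm, zero_add]
    rfl
  rw [← sub_eq_zero]
  apply IsHausdorff.haus (I := Ideal.span {(p : S.OC)}) inferInstance
  intro n
  rw [smul_eq_mul, Ideal.mul_top, SModEq.zero, Ideal.span_singleton_pow,
    Ideal.mem_span_singleton]
  exact (pow_dvd_pow _ n.le_succ).trans (key n)

theorem tiltHom_sub_one_mem (ζ : S.Zp1) :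
    WittVector.teichmuller p (S.tiltHom ζ) - 1 ∈ RingHom.ker S.theta := by
  rw [RingHom.mem_ker, map_sub, map_one, theta, WittVector.fontaineTheta_teichmuller,
    untilt_tiltHom, sub_self]

/-- The homomorphism `ℤ_p(1) → ξO_C`, `ζ ↦ log [ζ] = [ζ] - 1`. -/
def tateLog : Additive S.Zp1 →+ S.Xi where
  toFun ζ := (RingHom.ker S.theta).toCotangent ⟨_, S.tiltHom_sub_one_mem ζ.toMul⟩
  map_zero' := by
    rw [Ideal.toCotangent_eq_zero]
    simp
  map_add' ζ ζ' := by
    rw [← map_add, Ideal.toCotangent_eq, pow_two]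
    have := Ideal.mul_mem_mul (S.tiltHom_sub_one_mem ζ.toMul) (S.tiltHom_sub_one_mem ζ'.toMul)
    convert this using 1
    simp only [toMul_add, map_mul, Submodule.coe_add]
    ring

end Setting

/-- Multiplication by `e^t` is injective on `A[P]/(π - e^l)`. -/
theorem isSMulRegular_monomial {A P : Type u} [CommRing A] [IsDomain A] [AddCommMonoid P]
    (hP : IsIntegralMonoid P) {ϖ : A} (hϖ : ϖ ≠ 0) {l : P}
    (hl : ∀ n : ℤ, n • Algebra.GrothendieckAddGroup.of l = 0 → n = 0) (t : P) :
    IsSMulRegular (ChartRing A P ϖ l)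
      (Ideal.Quotient.mk (Ideal.span {algebraMap A (AddMonoidAlgebra A P) ϖ -
        AddMonoidAlgebra.of A P (.ofAdd l)}) (AddMonoidAlgebra.of' A P t)) := by
  have cancel : IsCancelAdd P := by
    have : IsLeftCancelAdd P := ⟨fun a b c h => hP (by
      have := congrArg (Algebra.GrothendieckAddGroup.of : P →+ _) h
      simpa using this)⟩
    exact AddCommMagma.IsLeftCancelAdd.toIsCancelAdd P
  have hl' (n m : ℕ) (h : n • l = m • l) : n = m := by
    have := congrArg (Algebra.GrothendieckAddGroup.of : P →+ _) h
    rw [map_nsmul, map_nsmul] at this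
    have := hl ((n : ℤ) - m) (by rw [sub_smul]; simpa [sub_eq_zero] using this)
    omega
  have hπ (g : AddMonoidAlgebra A P) (y : P) :
      ((algebraMap A (AddMonoidAlgebra A P) ϖ) * g).coeff y = ϖ * g.coeff y := by
    rw [← Algebra.smul_def]; rfl
  -- the key descent
  have key (f g : AddMonoidAlgebra A P)
      (hfg : AddMonoidAlgebra.of' A P t * f =
        (algebraMap A (AddMonoidAlgebra A P) ϖ - AddMonoidAlgebra.of' A P l) * g) :
      AddMonoidAlgebra.of' A P t ∣ g := by
    rw [AddMonoidAlgebra.of'_dvd_iff_modOf_eq_zero]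
    have step (y : P) (hy : ¬ ∃ d, y = t + d) (hgy : g.coeff y ≠ 0) :
        ∃ z, y = l + z ∧ (¬ ∃ d, z = t + d) ∧ g.coeff z ≠ 0 := by
      by_contra! hcon
      have h0 : (AddMonoidAlgebra.of' A P t * f).coeff y = 0 := by
        rw [AddMonoidAlgebra.of'_apply]
        exact AddMonoidAlgebra.coeff_single_mul_of_forall_add_ne _ _
          fun d h => hy ⟨d, h.symm⟩
      have h1 : (AddMonoidAlgebra.of' A P l * g).coeff y = 0 := by
        rw [AddMonoidAlgebra.of'_apply]
        by_cases hz : ∃ z, y = l + z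
        · obtain ⟨z, rfl⟩ := hz
          rw [AddMonoidAlgebra.coeff_single_mul_add, one_mul]
          refine hcon z rfl fun d hd => hy ⟨l + d, ?_⟩
          rw [hd, add_left_comm]
        · exact AddMonoidAlgebra.coeff_single_mul_of_forall_add_ne _ _
            fun d h => hz ⟨d, h.symm⟩
      rw [hfg, sub_mul, AddMonoidAlgebra.coeff_sub, Finsupp.sub_apply, h1, sub_zero, hπ] at h0
      exact mul_ne_zero hϖ hgy h0
    ext y
    by_cases hy : ∃ d, y = t + d
    · rw [AddMonoidAlgebra.coeff_modOf_of_exists_add _ _ _ hy]; rfl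
    rw [AddMonoidAlgebra.coeff_modOf_of_not_exists_add _ _ _ hy]
    change g.coeff y = 0
    by_contra hgy
    have all (n : ℕ) : ∃ z, y = n • l + z ∧ (¬ ∃ d, z = t + d) ∧ g.coeff z ≠ 0 := by
      induction n with
      | zero => exact ⟨y, by simp, hy, hgy⟩
      | succ n ih =>
        obtain ⟨z, h1, h2, h3⟩ := ih
        obtain ⟨z', h1', h2', h3'⟩ := step z h2 h3
        exact ⟨z', by rw [h1, h1', succ_nsmul, add_assoc], h2', h3'⟩
    choose z hz1 hz2 hz3 using all
    have inj : Function.Injective z := fun n m h => hl' n m (by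
      have := (hz1 n).symm.trans (hz1 m)
      rw [h] at this
      exact add_right_cancel this)
    refine Set.infinite_range_of_injective inj (g.coeff.support.finite_toSet.subset ?_)
    rintro _ ⟨n, rfl⟩
    exact Finsupp.mem_support_iff.2 (hz3 n)
  have reg (f g : AddMonoidAlgebra A P)
      (h : AddMonoidAlgebra.of' A P t * f = AddMonoidAlgebra.of' A P t * g) : f = g := by
    rw [← AddMonoidAlgebra.of'_mul_divOf t f, h, AddMonoidAlgebra.of'_mul_divOf]
  intro a b hab
  obtain ⟨a, rfl⟩ := Ideal.Quotient.mk_surjective a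
  obtain ⟨b, rfl⟩ := Ideal.Quotient.mk_surjective b
  change Ideal.Quotient.mk _ (_ * _) = Ideal.Quotient.mk _ (_ * _) at hab
  have hab := Ideal.Quotient.eq.1 hab
  rw [← mul_sub, Ideal.mem_span_singleton] at hab
  obtain ⟨g, hg⟩ := hab
  obtain ⟨g', rfl⟩ := key (a - b) g hg
  rw [Ideal.Quotient.eq, Ideal.mem_span_singleton]
  refine ⟨g', reg _ _ ?_⟩
  rw [hg]
  ring

namespace Setting
variable {p : ℕ} [Fact p.Prime] (S : Setting.{u} p)

theorem γ_ne_zero (t : Multiplicative S.P) : S.γ t ≠ 0 := by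
  intro h0
  let _ := (chartHom S.γ S.γ_l).toRingHom.toAlgebra
  have : Algebra.Etale (ChartRing S.𝒪K S.P S.ϖ S.l) S.R := S.etale
  have hf : Module.Flat (ChartRing S.𝒪K S.P S.ϖ S.l) S.R := inferInstance
  have h := (isSMulRegular_monomial S.isToricMonoidP.saturated.1 S.irreducible_ϖ.ne_zero
    S.injective_gp t.toAdd).of_flat (S := S.R)
  have hnt : Nontrivial S.R := by
    have : Nonempty (PrimeSpectrum S.R) := inferInstance
    exact PrimeSpectrum.nonempty_iff_nontrivial.1 this
  have : (1 : S.R) = 0 := by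
    apply h
    change algebraMap _ S.R _ * 1 = algebraMap _ S.R _ * 0
    rw [mul_one, mul_zero]
    exact (chartHom_monomial S.γ S.γ_l t.toAdd).trans h0
  exact one_ne_zero this

theorem root_ne_zero (n : ℕ) (hn : 0 < n) (t : Multiplicative S.P) : S.root n t ≠ 0 := by
  intro h
  have := S.root_mul n 1 hn one_pos t
  rw [mul_one, h, zero_pow hn.ne', S.root_one] at this
  exact S.γ_ne_zero t (S.injective_R (by rw [← this, map_zero]))
/-- `P^gp` -/
abbrev Pgp : Type u := Algebra.GrothendieckAddGroup S.P

/-- The relations defining the logarithmic differentials: `dγ(t) = γ(t) dlog t` for `t ∈ P` and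
`dlog λ = 0`. -/
def logRel : Submodule S.R (Ω[S.R⁄S.𝒪K] × (S.R ⊗[ℤ] S.Pgp)) :=
  Submodule.span S.R
    ({x | ∃ t : S.P, x = (KaehlerDifferential.D S.𝒪K S.R (S.γ (.ofAdd t)),
        -(S.γ (.ofAdd t) ⊗ₜ Algebra.GrothendieckAddGroup.of t))} ∪
      {(0, 1 ⊗ₜ Algebra.GrothendieckAddGroup.of S.l)})

/-- The module of logarithmic differentials of `(R, P)` over `(O_K, ℕ)`. -/
abbrev Omega : Type u := (Ω[S.R⁄S.𝒪K] × (S.R ⊗[ℤ] S.Pgp)) ⧸ S.logRel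

/-- `dlog : P^gp → Ω̃` -/
def dlog : S.Pgp →+ S.Omega where
  toFun t := S.logRel.mkQ (0, 1 ⊗ₜ t)
  map_zero' := by rw [TensorProduct.tmul_zero]; exact map_zero _
  map_add' x y := by rw [TensorProduct.tmul_add, ← map_add]; simp

theorem exists_derivation (N : Type u) [AddCommGroup N] [Module S.R N] [Module S.𝒪K N]
    [IsScalarTower S.𝒪K S.R N] (κ : S.P →+ N) (hκ : κ S.l = 0) :
    ∃ d : Derivation S.𝒪K S.R N, ∀ t : S.P, d (S.γ (.ofAdd t)) = S.γ (.ofAdd t) • κ t := by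
  let _ : Module S.Rᵐᵒᵖ N := Module.compHom N ((RingHom.id S.R).fromOpposite mul_comm)
  have : IsCentralScalar S.R N := ⟨fun _ _ => rfl⟩
  let _ : Module S.𝒪Kᵐᵒᵖ N := Module.compHom N ((RingHom.id S.𝒪K).fromOpposite mul_comm)
  have : IsCentralScalar S.𝒪K N := ⟨fun _ _ => rfl⟩
  let γ' : Multiplicative S.P →* TrivSqZeroExt S.R N :=
    { toFun := fun t => TrivSqZeroExt.inl (S.γ t) + TrivSqZeroExt.inr (S.γ t • κ t.toAdd)
      map_one' := by simp
      map_mul' := by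
        intro x y
        ext
        · simp
        · simp only [map_mul, toAdd_mul, map_add, TrivSqZeroExt.snd_add, TrivSqZeroExt.snd_inl,
            TrivSqZeroExt.snd_inr, zero_add, TrivSqZeroExt.snd_mul, TrivSqZeroExt.fst_add,
            TrivSqZeroExt.fst_inl, TrivSqZeroExt.fst_inr, add_zero, op_smul_eq_smul, smul_add,
            mul_smul]
          rw [add_comm, smul_comm (S.γ x) (S.γ y) (κ x.toAdd)] }
  have h' : γ' (.ofAdd S.l) = algebraMap S.𝒪K (TrivSqZeroExt S.R N) S.ϖ := by
    ext
    · simp [γ', S.γ_l, TrivSqZeroExt.algebraMap_eq_inl']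
    · simp [γ', hκ, TrivSqZeroExt.algebraMap_eq_inl']
  let _ := (chartHom S.γ S.γ_l).toRingHom.toAlgebra
  have : Algebra.Etale (ChartRing S.𝒪K S.P S.ϖ S.l) S.R := S.etale
  let _ : Algebra (ChartRing S.𝒪K S.P S.ϖ S.l) (TrivSqZeroExt S.R N) :=
    (chartHom γ' h').toRingHom.toAlgebra
  have hfst : (TrivSqZeroExt.fstHom S.𝒪K S.R N).comp (chartHom γ' h') = chartHom S.γ S.γ_l := by
    apply Ideal.Quotient.algHom_ext
    refine AddMonoidAlgebra.algHom_ext (fun t => ?_) (by ext)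
    have h1 := chartHom_monomial γ' h' t
    have h2 := chartHom_monomial S.γ S.γ_l t
    refine (congrArg TrivSqZeroExt.fst h1).trans (Eq.trans ?_ h2.symm)
    simp [γ']
  let g : TrivSqZeroExt S.R N →ₐ[ChartRing S.𝒪K S.P S.ϖ S.l] S.R :=
    { TrivSqZeroExt.fstHom S.𝒪K S.R N with
      commutes' := fun b => DFunLike.congr_fun hfst b }
  have hg : Function.Surjective g := fun r => ⟨TrivSqZeroExt.inl r, rfl⟩
  have hker : IsNilpotent (RingHom.ker (g : TrivSqZeroExt S.R N →+* S.R)) := by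
    refine ⟨2, ?_⟩
    rw [pow_two, Ideal.zero_eq_bot, eq_bot_iff, Ideal.mul_le]
    intro a ha b hb
    replace ha : a.fst = 0 := ha
    replace hb : b.fst = 0 := hb
    rw [Ideal.mem_bot]
    ext <;> simp [ha, hb]
  let ψ := Algebra.FormallySmooth.liftOfSurjective
    (AlgHom.id (ChartRing S.𝒪K S.P S.ϖ S.l) S.R) g hg hker
  have hψ1 (r : S.R) : (ψ r).fst = r :=
    Algebra.FormallySmooth.liftOfSurjective_apply _ _ hg hker r
  have hψ2 (b : ChartRing S.𝒪K S.P S.ϖ S.l) :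
      ψ (chartHom S.γ S.γ_l b) = chartHom γ' h' b := ψ.commutes b
  refine ⟨Derivation.mk' ⟨⟨fun r => (ψ r).snd, fun a b => by simp⟩, fun c r => ?_⟩ fun a b => ?_,
    fun t => ?_⟩
  · have := hψ2 (algebraMap S.𝒪K _ c)
    rw [AlgHom.commutes, AlgHom.commutes] at this
    simp [Algebra.smul_def, this, hψ1, TrivSqZeroExt.algebraMap_eq_inl']
  · simp [hψ1]
  · have := hψ2 (Ideal.Quotient.mk _ (AddMonoidAlgebra.of' _ _ t))
    rw [chartHom_monomial, chartHom_monomial] at this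
    simp [this, γ']

/-- The universal property of the logarithmic differentials. -/
theorem exists_logLift (N : Type u) [AddCommGroup N] [Module S.R N] (κ : S.P →+ N)
    (hκ : κ S.l = 0) :
    ∃ f : S.Omega →ₗ[S.R] N, ∀ t : S.P, f (S.dlog (Algebra.GrothendieckAddGroup.of t)) = κ t := by
  let _ : Module S.𝒪K N := Module.compHom N (algebraMap S.𝒪K S.R)
  have : IsScalarTower S.𝒪K S.R N := ⟨fun a b c => by
    rw [Algebra.smul_def, mul_smul]; rfl⟩
  obtain ⟨d, hd⟩ := S.exists_derivation N κ hκ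
  let κ' : S.Pgp →+ N := Algebra.GrothendieckAddGroup.lift κ
  have hκ' (t : S.P) : κ' (AddLocalization.addMonoidOf ⊤ t) = κ t :=
    DFunLike.congr_fun (Algebra.GrothendieckAddGroup.lift.symm_apply_apply κ) t
  clear_value κ'
  let f₂ : S.R ⊗[ℤ] S.Pgp →ₗ[S.R] N := TensorProduct.AlgebraTensorModule.lift
    ((LinearMap.toSpanSingleton S.R (S.Pgp →ₗ[ℤ] N) κ'.toIntLinearMap))
  refine ⟨S.logRel.liftQ (d.liftKaehlerDifferential.coprod f₂) ?_, fun t => ?_⟩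
  · rw [logRel, Submodule.span_le]
    rintro _ (⟨t, rfl⟩ | rfl)
    · simp [f₂, hκ', hd]
    · simp [f₂, hκ', hκ]
  · simp [dlog, f₂, hκ']
/-- `F_1 = Frac R_1 = K̄(R)`, a subfield of `F^a`. -/
def F1 : IntermediateField S.Kbar S.Fa :=
  IntermediateField.adjoin S.Kbar (Set.range (algebraMap S.R S.Fa))

/-- `F_∞`, the fraction field of `R_∞ = ⋃ R_n`, where `R_n` is the image of
`(R ⊗_{ℤ[P], n} ℤ[P]) ⊗ O_K̄` in `F^a`; it is generated over `F_1` by the roots of the elements of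
`P`. -/
def Finf : IntermediateField S.F1 S.Fa :=
  IntermediateField.adjoin S.F1 {x | ∃ n : ℕ, 0 < n ∧ ∃ t, x = S.root n t}

/-- `Δ_∞ = Gal(F_∞/F_1)` -/
abbrev Delta : Type u := Gal(S.Finf/S.F1)

/-- The `n`-th root of `t ∈ P` in `F_∞`. -/
def rootFinf (n : ℕ) (hn : 0 < n) (t : Multiplicative S.P) : S.Finf :=
  ⟨S.root n t, IntermediateField.subset_adjoin _ _ ⟨n, hn, t, rfl⟩⟩

theorem mem_range_of_pow_eq_one {n : ℕ} (hn : 0 < n) {w : S.Fa} (hw : w ^ n = 1) :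
    ∃ ζ : S.OKbarˣ, ζ ^ n = 1 ∧ w = algebraMap S.Kbar S.Fa (ζ : S.OKbar) := by
  have : IsAlgClosed S.Kbar := IsAlgClosure.isAlgClosed S.K
  have hint : IsIntegral S.Kbar w := IsIntegral.of_pow hn (by rw [hw]; exact isIntegral_one)
  obtain ⟨z, rfl⟩ := minpoly.mem_range_of_degree_eq_one S.Kbar w
    (IsAlgClosed.degree_eq_one_of_irreducible _ (minpoly.irreducible hint))
  rw [← map_pow] at hw
  have hz : z ^ n = 1 := (algebraMap S.Kbar S.Fa).injective (by rw [hw, map_one])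
  have hz' : IsIntegral S.𝒪K z := IsIntegral.of_pow hn (by rw [hz]; exact isIntegral_one)
  have hu : (⟨z, hz'⟩ : S.OKbar) ^ n = 1 := Subtype.ext hz
  exact ⟨Units.ofPowEqOne _ n hu hn.ne', Units.pow_ofPowEqOne hu hn.ne', rfl⟩

theorem exists_pairing (g : S.Delta) (n : ℕ) (hn : 0 < n) (t : Multiplicative S.P) :
    ∃ ζ : S.OKbarˣ, ζ ^ n = 1 ∧
      ((g (S.rootFinf n hn t) : S.Finf) : S.Fa) =
        algebraMap S.Kbar S.Fa (ζ : S.OKbar) * S.root n t := by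
  have h0 := S.root_ne_zero n hn t
  have hfix : ((g (S.rootFinf n hn t) : S.Finf) : S.Fa) ^ n = S.root n t ^ n := by
    have hpow : S.root n t ^ n = algebraMap S.R S.Fa (S.γ t) := by
      rw [← S.root_one, ← S.root_mul n 1 hn one_pos, mul_one]
    have hmem : algebraMap S.R S.Fa (S.γ t) ∈ S.F1 :=
      IntermediateField.subset_adjoin _ _ ⟨_, rfl⟩
    have h1 : S.rootFinf n hn t ^ n = algebraMap S.F1 S.Finf ⟨_, hmem⟩ := Subtype.ext hpow
    have h2 := congrArg g h1
    rw [AlgEquiv.commutes, ← h1, map_pow] at h2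
    exact congrArg (fun x : S.Finf => (x : S.Fa)) h2
  obtain ⟨ζ, h1, h2⟩ := S.mem_range_of_pow_eq_one hn
    (w := ((g (S.rootFinf n hn t) : S.Finf) : S.Fa) / S.root n t)
    (by rw [div_pow, hfix, div_self (pow_ne_zero _ h0)])
  exact ⟨ζ, h1, by rw [← h2, div_mul_cancel₀ _ h0]⟩

/-- The pairing `⟨g, t⟩_n ∈ μ_n(O_K̄)`: the action of `g ∈ Δ_∞` on the `n`-th root of `t ∈ P` is
multiplication by `⟨g, t⟩_n`. -/
def pairing (g : S.Delta) (n : ℕ) (hn : 0 < n) (t : Multiplicative S.P) : S.OKbarˣ :=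
  (S.exists_pairing g n hn t).choose

theorem pairing_pow_self (g : S.Delta) (n : ℕ) (hn : 0 < n) (t : Multiplicative S.P) :
    S.pairing g n hn t ^ n = 1 :=
  (S.exists_pairing g n hn t).choose_spec.1

theorem pairing_spec (g : S.Delta) (n : ℕ) (hn : 0 < n) (t : Multiplicative S.P) :
    ((g (S.rootFinf n hn t) : S.Finf) : S.Fa) =
        algebraMap S.Kbar S.Fa (S.pairing g n hn t : S.OKbar) * S.root n t :=
  (S.exists_pairing g n hn t).choose_spec.2

theorem pairing_unique (g : S.Delta) (n : ℕ) (hn : 0 < n) (t : Multiplicative S.P) (ζ : S.OKbarˣ)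
    (h : ((g (S.rootFinf n hn t) : S.Finf) : S.Fa) =
      algebraMap S.Kbar S.Fa (ζ : S.OKbar) * S.root n t) : S.pairing g n hn t = ζ := by
  rw [S.pairing_spec] at h
  exact Units.ext (Subtype.ext ((algebraMap S.Kbar S.Fa).injective
    (mul_right_cancel₀ (S.root_ne_zero n hn t) h)))

theorem coe_fix (g : S.Delta) (x : S.Kbar) (y : S.Finf) :
    ((g (algebraMap S.Kbar S.Finf x * y) : S.Finf) : S.Fa) =
      algebraMap S.Kbar S.Fa x * (g y : S.Finf) := by
  have : algebraMap S.Kbar S.Finf x = algebraMap S.F1 S.Finf (algebraMap S.Kbar S.F1 x) := rfl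
  rw [map_mul, this, AlgEquiv.commutes]
  rfl

theorem coe_units_mul (a b : S.OKbarˣ) :
    algebraMap S.Kbar S.Fa ((a * b : S.OKbarˣ) : S.OKbar) =
      algebraMap S.Kbar S.Fa (a : S.OKbar) * algebraMap S.Kbar S.Fa (b : S.OKbar) := by
  rw [← map_mul]; rfl

theorem coe_units_pow (a : S.OKbarˣ) (m : ℕ) :
    algebraMap S.Kbar S.Fa ((a ^ m : S.OKbarˣ) : S.OKbar) =
      algebraMap S.Kbar S.Fa (a : S.OKbar) ^ m := by
  rw [← map_pow, Units.val_pow_eq_pow_val]; rfl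

theorem pairing_mul_left (g g' : S.Delta) (n : ℕ) (hn : 0 < n) (t : Multiplicative S.P) :
    S.pairing (g * g') n hn t = S.pairing g n hn t * S.pairing g' n hn t := by
  apply S.pairing_unique
  have h : g' (S.rootFinf n hn t) =
      algebraMap S.Kbar S.Finf (S.pairing g' n hn t : S.OKbar) * S.rootFinf n hn t :=
    Subtype.ext (S.pairing_spec g' n hn t)
  rw [AlgEquiv.mul_apply, h, coe_fix, pairing_spec, coe_units_mul]
  ring

theorem pairing_mul_right (g : S.Delta) (n : ℕ) (hn : 0 < n) (t t' : Multiplicative S.P) :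
    S.pairing g n hn (t * t') = S.pairing g n hn t * S.pairing g n hn t' := by
  apply S.pairing_unique
  have h : S.rootFinf n hn (t * t') = S.rootFinf n hn t * S.rootFinf n hn t' :=
    Subtype.ext (map_mul _ _ _)
  rw [h, map_mul, map_mul, coe_units_mul]
  change ((g _ : S.Finf) : S.Fa) * ((g _ : S.Finf) : S.Fa) = _
  rw [pairing_spec, pairing_spec]
  ring

theorem pairing_pow (g : S.Delta) (m n : ℕ) (hm : 0 < m) (hn : 0 < n) (t : Multiplicative S.P) :
    S.pairing g (m * n) (Nat.mul_pos hm hn) t ^ m = S.pairing g n hn t := by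
  symm
  apply S.pairing_unique
  have h : S.rootFinf n hn t = S.rootFinf (m * n) (Nat.mul_pos hm hn) t ^ m :=
    Subtype.ext (S.root_mul m n hm hn t).symm
  rw [h, map_pow, ← S.root_mul m n hm hn, coe_units_pow,
    ← mul_pow, ← pairing_spec]
  rfl

theorem pairing_l (g : S.Delta) (n : ℕ) (hn : 0 < n) :
    S.pairing g n hn (.ofAdd S.l) = 1 := by
  apply S.pairing_unique
  have : IsAlgClosed S.Kbar := IsAlgClosure.isAlgClosed S.K
  have hpow : S.root n (.ofAdd S.l) ^ n =
      algebraMap S.Kbar S.Fa (algebraMap S.𝒪K S.Kbar S.ϖ) := by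
    rw [← IsScalarTower.algebraMap_apply, IsScalarTower.algebraMap_apply S.𝒪K S.R S.Fa, ← S.γ_l,
      ← S.root_one, ← S.root_mul n 1 hn one_pos, mul_one]
  have hint : IsIntegral S.Kbar (S.root n (.ofAdd S.l)) :=
    IsIntegral.of_pow hn (by rw [hpow]; exact isIntegral_algebraMap)
  obtain ⟨z, hz⟩ := minpoly.mem_range_of_degree_eq_one S.Kbar _
    (IsAlgClosed.degree_eq_one_of_irreducible _ (minpoly.irreducible hint))
  have h : S.rootFinf n hn (.ofAdd S.l) = algebraMap S.Kbar S.Finf z * 1 := by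
    rw [mul_one]
    exact Subtype.ext hz.symm
  rw [h, coe_fix, map_one, hz]
  simp

/-- The homomorphism `P → Hom(Δ_∞, ℤ_p(1))`, `t ↦ χ_t = (⟨·, t⟩_{p^n})_n`. -/
def chi : Multiplicative S.P →* (S.Delta →* S.Zp1) where
  toFun t :=
    { toFun := fun g => ⟨fun n => S.pairing g (p ^ n) (pow_pos (Fact.out : p.Prime).pos n) t, by
        refine ⟨?_, fun n => ?_⟩
        · have h := S.pairing_pow_self g (p ^ 0) (pow_pos (Fact.out : p.Prime).pos 0) t
          exact (pow_one _).symm.trans h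
        · have hp : 0 < p := (Fact.out : p.Prime).pos
          simpa only [pow_succ'] using S.pairing_pow g p (p ^ n) hp (pow_pos hp n) t⟩
      map_one' := by
        apply Subtype.ext
        funext n
        apply S.pairing_unique
        simp [rootFinf]
      map_mul' := fun g g' => by
        apply Subtype.ext
        funext n
        exact S.pairing_mul_left g g' _ _ t }
  map_one' := by
    ext1 g
    apply Subtype.ext
    funext n
    apply S.pairing_unique
    have : S.rootFinf (p ^ n) (pow_pos (Fact.out : p.Prime).pos n) 1 = 1 :=
      Subtype.ext (map_one _)
    rw [this]
    simp
  map_mul' t t' := by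
    ext1 g
    apply Subtype.ext
    funext n
    exact S.pairing_mul_right g _ _ t t'

theorem chi_l : S.chi (.ofAdd S.l) = 1 := by
  ext1 g
  apply Subtype.ext
  funext n
  exact S.pairing_l g _ _

instance : SMulCommClass S.OC S.R S.R1hat := ⟨fun a b c => by
  rw [Algebra.smul_def, Algebra.smul_def, Algebra.smul_def, Algebra.smul_def, mul_left_comm]⟩

/-- The homomorphism `ℤ_p(1) → Hom_{O_C}(ξ⁻¹O_C, R̂_1) = ξR̂_1`, `ζ ↦ log [ζ]`. -/
def tateLogEval : Additive S.Zp1 →+ (S.XiInv →ₗ[S.OC] S.R1hat) where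
  toFun ζ :=
    { toFun := fun μ => algebraMap S.OC S.R1hat (μ (S.tateLog ζ))
      map_add' := fun μ ν => by simp
      map_smul' := fun c μ => by simp [Algebra.smul_def] }
  map_zero' := by ext; simp
  map_add' ζ ζ' := by ext; simp

/-- `t ↦ (g ↦ log [χ_t(g)])`, as a homomorphism `P → Hom(Δ_∞, ξR̂_1)`. -/
def logChi : S.P →+ (Additive S.Delta →+ (S.XiInv →ₗ[S.OC] S.R1hat)) where
  toFun t := S.tateLogEval.comp (MonoidHom.toAdditive (S.chi (.ofAdd t)))
  map_zero' := by
    rw [ofAdd_zero, map_one]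
    refine AddMonoidHom.ext fun g => ?_
    exact map_zero S.tateLogEval
  map_add' t t' := by
    rw [ofAdd_add, map_mul]
    refine AddMonoidHom.ext fun g => ?_
    exact map_add S.tateLogEval _ _

theorem logChi_l : S.logChi S.l = 0 := by
  refine AddMonoidHom.ext fun g => ?_
  change S.tateLogEval (Additive.ofMul (S.chi (.ofAdd S.l) g.toMul)) = 0
  rw [chi_l]
  exact map_zero S.tateLogEval


/-- The homomorphism `Ω̃ ⊗ R̂_1 → Hom(Δ_∞, ξR̂_1)` sending `dlog t` to `g ↦ log [χ_t(g)]`: the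
composite of `δ̃ : Ω̃ ⊗ R̂_1 → Hom(Δ_∞, R̂_1(1))`, `dlog t ↦ χ_t`, with `ζ ↦ log [ζ]`. Here `ξR̂_1` is
written as `Hom_{O_C}(ξ⁻¹O_C, R̂_1)`. -/
def delta : S.R1hat ⊗[S.R] S.Omega →ₗ[S.R1hat]
    (Additive S.Delta →+ (S.XiInv →ₗ[S.OC] S.R1hat)) :=
  LinearMap.liftBaseChange S.R1hat
    (S.exists_logLift (Additive S.Delta →+ (S.XiInv →ₗ[S.OC] S.R1hat)) S.logChi
      S.logChi_l).choose

/-- The module of coefficients `ξ⁻¹Ω̃ ⊗_R R̂_1` of Higgs modules. -/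
abbrev E : Type u := (S.R1hat ⊗[S.R] S.Omega) ⊗[S.OC] S.XiInv


/-- The homomorphism `ξ⁻¹Ω̃ ⊗_R R̂_1 → Hom(Δ_∞, R̂_1)`, `x ⊗ μ ↦ (g ↦ μ (δ̃(x)(g)))`. -/
def evalDelta : S.E →ₗ[S.R1hat] (Additive S.Delta →+ S.R1hat) :=
  TensorProduct.AlgebraTensorModule.lift
    { toFun := fun x =>
        { toFun := fun μ =>
            { toFun := fun g => S.delta x g μ
              map_zero' := by simp
              map_add' := fun g h => by simp }
          map_add' := fun μ ν => by ext g; simp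
          map_smul' := fun c μ => by ext g; simp }
      map_add' := fun x y => by ext μ g; simp
      map_smul' := fun c x => by ext μ g; simp }

/-- Evaluation at `g ∈ Δ_∞`. -/
def contract (g : Additive S.Delta) : S.E →ₗ[S.R1hat] S.R1hat where
  toFun x := S.evalDelta x g
  map_add' x y := by simp
  map_smul' c x := by simp

section Psi
variable (M : Type u) [AddCommGroup M] [Module S.R1hat M]

/-- The map inducing the inverse of `Ψ_M`: it sends `θ : M → M ⊗ ξ⁻¹Ω̃` to the homomorphism `Δ_∞ → End M` obtained
by applying `id ⊗ (ξ⁻¹Ω̃ ⊗_R R̂_1 → Hom(Δ_∞, R̂_1))`. -/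
def psiInv (θ : M →ₗ[S.R1hat] M ⊗[S.R1hat] S.E) : Additive S.Delta →+ Module.End S.R1hat M where
  toFun g := (TensorProduct.rid S.R1hat M).toLinearMap ∘ₗ (S.contract g).lTensor M ∘ₗ θ
  map_zero' := by
    have : S.contract 0 = 0 := LinearMap.ext fun x => by simp [contract]
    rw [this]; simp
  map_add' g h := by
    have : S.contract (g + h) = S.contract g + S.contract h := LinearMap.ext fun x => by
      simp [contract]
    rw [this, LinearMap.lTensor_add, LinearMap.add_comp, LinearMap.comp_add]

/-- `p^ε ∈ R̂_1`, for a rational number `ε ≥ 0`. -/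
def pPow (ε : ℚ) : S.R1hat :=
  algebraMap S.OC S.R1hat (algebraMap S.OKbar S.OC (S.rootP ε.den ^ ε.num.toNat))

/-- The `O_C`-module underlying an `R̂_1`-module is flat. -/
def IsOCFlat : Prop := @Module.Flat S.OC M _ _ (Module.compHom M (algebraMap S.OC S.R1hat))

/-- `Ψ_M : Hom(Δ_∞, p^α End M) → p^β ξ⁻¹ End M ⊗ Ω̃`, for `β = α - 1/(p-1)`: the inverse of `psiInv`
on the multiples of `p^β` in `Hom(M, M ⊗ ξ⁻¹Ω̃) = ξ⁻¹ End M ⊗ Ω̃`. -/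
def psi (β : ℚ) (ℓ : Additive S.Delta →+ Module.End S.R1hat M) :
    M →ₗ[S.R1hat] M ⊗[S.R1hat] S.E :=
  Function.invFunOn (S.psiInv M) {θ | ∃ θ', θ = S.pPow β • θ'} ℓ

end Psi

end Setting

/-! ### Higgs modules -/

theorem update_pair_zero {X : Type u} (x y z : X) : Function.update ![x, y] 0 z = ![z, y] := by
  ext i; fin_cases i <;> rfl

theorem update_pair_one {X : Type u} (x y z : X) : Function.update ![x, y] 1 z = ![x, z] := by
  ext i; fin_cases i <;> rfl

section Higgs
variable (A : Type u) [CommRing A] (E : Type u) [AddCommGroup E] [Module A E]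

/-- The canonical map `E ⊗ E → Λ²E`, `x ⊗ y ↦ x ∧ y`. -/
def wedgeMap : E ⊗[A] E →ₗ[A] ⋀[A]^2 E :=
  TensorProduct.lift <| LinearMap.mk₂ A (fun x y => exteriorPower.ιMulti A 2 ![x, y])
    (fun x x' y => by
      have h := (exteriorPower.ιMulti A 2).map_update_add ![x, y] 0 x x'
      simp only [update_pair_zero] at h
      exact h)
    (fun c x y => by
      have h := (exteriorPower.ιMulti A 2).map_update_smul ![x, y] 0 c x
      simp only [update_pair_zero] at h
      exact h)
    (fun x y y' => by
      have h := (exteriorPower.ιMulti A 2).map_update_add ![x, y] 1 y y'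
      simp only [update_pair_one] at h
      exact h)
    (fun c x y => by
      have h := (exteriorPower.ιMulti A 2).map_update_smul ![x, y] 1 c y
      simp only [update_pair_one] at h
      exact h)

variable {A E} in
/-- `θ ∧ θ : M → M ⊗ Λ²E` -/
def wedgeSq {M : Type u} [AddCommGroup M] [Module A M] (θ : M →ₗ[A] M ⊗[A] E) :
    M →ₗ[A] M ⊗[A] ⋀[A]^2 E :=
  (wedgeMap A E).lTensor M ∘ₗ (TensorProduct.assoc A M E E).toLinearMap ∘ₗ θ.rTensor E ∘ₗ θ

/-- A Higgs module with coefficients in `E`: an `A`-module `M` with an `A`-linear map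
`θ : M → M ⊗ E` such that `θ ∧ θ = 0`. -/
structure HiggsMod where
  carrier : Type u
  [addCommGroup : AddCommGroup carrier]
  [module : Module A carrier]
  θ : carrier →ₗ[A] carrier ⊗[A] E
  wedge : wedgeSq θ = 0

attribute [instance] HiggsMod.addCommGroup HiggsMod.module

/-- A morphism of Higgs modules: an `A`-linear map compatible with the Higgs fields. -/
@[ext]
structure HiggsMod.Hom (M N : HiggsMod A E) where
  lin : M.carrier →ₗ[A] N.carrier
  comm : lin.rTensor E ∘ₗ M.θ = N.θ ∘ₗ lin

instance : Category (HiggsMod A E) where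
  Hom M N := HiggsMod.Hom A E M N
  id M := ⟨LinearMap.id, by simp⟩
  comp f g := ⟨g.lin ∘ₗ f.lin, by
    rw [LinearMap.rTensor_comp, LinearMap.comp_assoc, f.comm, ← LinearMap.comp_assoc, g.comm,
      LinearMap.comp_assoc]⟩

end Higgs

/-! ### Exponential and logarithm -/

section ExpLog
variable {A : Type u} [CommRing A] {M : Type u} [AddCommGroup M] [Module A M]

/-- The series `∑ y n` converges to `s` for the `p`-adic topology of the `A`-module `M`. -/
def IsPadicSum (p : ℕ) (y : ℕ → M) (s : M) : Prop :=
  ∀ k : ℕ, ∃ N : ℕ, ∀ n ≥ N, ∃ z : M, ∑ i ∈ Finset.range n, y i - s = p ^ k • z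

/-- `w(x) = ∑ (1 / n!) v^n(x)` for every `x`. -/
def IsExp (p : ℕ) (v w : Module.End A M) : Prop :=
  ∀ x : M, ∃ y : ℕ → M, (∀ n, n.factorial • y n = (v ^ n) x) ∧ IsPadicSum p y (w x)

/-- `w(x) = ∑ ((-1)^n / (n + 1)) (u - id)^(n+1)(x)` for every `x`. -/
def IsLog (p : ℕ) (u w : Module.End A M) : Prop :=
  ∀ x : M, ∃ y : ℕ → M,
    (∀ n, (n + 1) • y n = (-1 : ℤ) ^ n • ((u - 1) ^ (n + 1)) x) ∧ IsPadicSum p y (w x)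

open Classical in
/-- `exp v`, and `0` when the series does not converge. -/
def expEnd (p : ℕ) (v : Module.End A M) : Module.End A M :=
  if h : ∃ w, IsExp p v w then h.choose else 0

open Classical in
/-- `log u`, and `0` when the series does not converge. -/
def logEnd (p : ℕ) (u : Module.End A M) : Module.End A M :=
  if h : ∃ w, IsLog p u w then h.choose else 0

end ExpLog

namespace Setting
variable {p : ℕ} [Fact p.Prime] (S : Setting.{u} p)

/-! ### Representations -/

/-- The action of `Δ_∞` on `M` is continuous, for the Krull topology of `Δ_∞` and the `p`-adic
topology of `M`. -/
def IsCont (M : Rep.{u} S.R1hat S.Delta) : Prop :=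
  letI : TopologicalSpace M.V := (Ideal.span {(p : S.R1hat)}).adicModuleTopology M.V
  Continuous fun x : S.Delta × M.V => M.ρ x.1 x.2

/-- `x` is invariant modulo `p^α M`. -/
def IsInvariantMod (α : ℚ) (M : Rep.{u} S.R1hat S.Delta) (x : M.V) : Prop :=
  ∀ g : S.Delta, ∃ y : M.V, M.ρ g x - x = S.pPow α • y

/-- The continuous `α`-quasi-small `R̂_1`-representations of `Δ_∞` whose underlying `O_C`-module is
flat: `M` is complete and separated for the `p`-adic topology and generated by finitely many
elements which are `Δ_∞`-invariant modulo `p^α M`. -/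
def RepQuasiSmall (α : ℚ) : ObjectProperty (Rep.{u} S.R1hat S.Delta) := fun M =>
  S.IsCont M ∧ IsAdicComplete (Ideal.span {(p : S.R1hat)}) M.V ∧
  (∃ s : Finset M.V, Submodule.span S.R1hat (s : Set M.V) = ⊤ ∧ ∀ x ∈ s, S.IsInvariantMod α M x) ∧
  S.IsOCFlat M.V

/-- The continuous `α`-small `R̂_1`-representations of `Δ_∞`: `M` is free of finite rank with a
basis of elements which are `Δ_∞`-invariant modulo `p^α M`. -/
def RepSmall (α : ℚ) : ObjectProperty (Rep.{u} S.R1hat S.Delta) := fun M =>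
  S.IsCont M ∧ ∃ (n : ℕ) (b : Module.Basis (Fin n) S.R1hat M.V), ∀ i, S.IsInvariantMod α M (b i)

/-- The category of Higgs `R̂_1`-modules with coefficients in `ξ⁻¹Ω̃`. -/
abbrev MH : Type (u + 1) := HiggsMod S.R1hat S.E

/-- The `β`-quasi-small Higgs modules whose underlying `O_C`-module is flat: the module is of
finite type and `θ` is a multiple of `p^β`. -/
def HiggsQuasiSmall (β : ℚ) : ObjectProperty S.MH := fun N =>
  Module.Finite S.R1hat N.carrier ∧ (∃ θ', N.θ = S.pPow β • θ') ∧ S.IsOCFlat N.carrier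

/-- The `β`-small Higgs modules: `β`-quasi-small with a free module of finite rank. -/
def HiggsSmall (β : ℚ) : ObjectProperty S.MH := fun N =>
  Module.Finite S.R1hat N.carrier ∧ (∃ θ', N.θ = S.pPow β • θ') ∧
    Module.Free S.R1hat N.carrier

/-- The homomorphism `g ↦ log ρ(g)`. -/
def logHom (M : Rep.{u} S.R1hat S.Delta)
    (h : ∀ g g' : S.Delta, logEnd p (M.ρ (g * g')) = logEnd p (M.ρ g) + logEnd p (M.ρ g')) :
    Additive S.Delta →+ Module.End S.R1hat M.V :=
  AddMonoidHom.mk' (fun g => logEnd p (M.ρ g.toMul)) fun g g' => h g.toMul g'.toMul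

/-- The functor `(M, φ) ↦ (M, Ψ_M(log φ))` is well defined. -/
structure LogWellDefined (α β : ℚ) : Prop where
  isLog : ∀ M, S.RepQuasiSmall α M → ∀ g, IsLog p (M.ρ g) (logEnd p (M.ρ g))
  mul : ∀ M, S.RepQuasiSmall α M → ∀ g g' : S.Delta,
    logEnd p (M.ρ (g * g')) = logEnd p (M.ρ g) + logEnd p (M.ρ g')
  mem : ∀ M, S.RepQuasiSmall α M → ∀ g, ∃ w, logEnd p (M.ρ g) = S.pPow α • w
  wedge : ∀ M (hM : S.RepQuasiSmall α M), wedgeSq (A := S.R1hat) (E := S.E) (S.psi M.V β (S.logHom M (mul M hM))) = 0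
  quasiSmall : ∀ M (hM : S.RepQuasiSmall α M),
    S.HiggsQuasiSmall β ⟨M.V, S.psi M.V β (S.logHom M (mul M hM)), wedge M hM⟩
  comm : ∀ M (hM : S.RepQuasiSmall α M) N (hN : S.RepQuasiSmall α N) (f : M ⟶ N),
    f.hom.toLinearMap.rTensor S.E ∘ₗ S.psi M.V β (S.logHom M (mul M hM)) =
      S.psi N.V β (S.logHom N (mul N hN)) ∘ₗ f.hom.toLinearMap

variable {S} in
/-- The functor `(M, φ) ↦ (M, Ψ_M(log φ))`, the identity on the underlying linear maps. -/
def logFunctor {α β : ℚ} (h : S.LogWellDefined α β) :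
    (S.RepQuasiSmall α).FullSubcategory ⥤ (S.HiggsQuasiSmall β).FullSubcategory where
  obj M := ⟨⟨M.obj.V, S.psi M.obj.V β (S.logHom M.obj (h.mul M.obj M.property)),
    h.wedge M.obj M.property⟩, h.quasiSmall M.obj M.property⟩
  map {M N} f := ObjectProperty.homMk
    ⟨f.hom.hom.toLinearMap, h.comm M.obj M.property N.obj N.property f.hom⟩

/-- The representation `g ↦ exp (Ψ_M⁻¹(θ)(g))`. -/
def expRep (N : S.MH) (h1 : expEnd p (S.psiInv N.carrier N.θ 0) = 1)
    (h : ∀ g g', expEnd p (S.psiInv N.carrier N.θ (g + g')) =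
      expEnd p (S.psiInv N.carrier N.θ g) * expEnd p (S.psiInv N.carrier N.θ g')) :
    Representation S.R1hat S.Delta N.carrier where
  toFun g := expEnd p (S.psiInv N.carrier N.θ (.ofMul g))
  map_one' := h1
  map_mul' g g' := h (.ofMul g) (.ofMul g')

/-- The functor `(M, θ) ↦ (M, exp Ψ_M⁻¹(θ))` is well defined. -/
structure ExpWellDefined (α β : ℚ) : Prop where
  isExp : ∀ N, S.HiggsQuasiSmall β N → ∀ g,
    IsExp p (S.psiInv N.carrier N.θ g) (expEnd p (S.psiInv N.carrier N.θ g))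
  one : ∀ N, S.HiggsQuasiSmall β N → expEnd p (S.psiInv N.carrier N.θ 0) = 1
  mul : ∀ N, S.HiggsQuasiSmall β N → ∀ g g', expEnd p (S.psiInv N.carrier N.θ (g + g')) =
    expEnd p (S.psiInv N.carrier N.θ g) * expEnd p (S.psiInv N.carrier N.θ g')
  quasiSmall : ∀ N (hN : S.HiggsQuasiSmall β N),
    S.RepQuasiSmall α (Rep.of (S.expRep N (one N hN) (mul N hN)))
  comm : ∀ N (hN : S.HiggsQuasiSmall β N) N' (hN' : S.HiggsQuasiSmall β N') (f : N ⟶ N') g,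
    f.lin ∘ₗ S.expRep N (one N hN) (mul N hN) g =
      S.expRep N' (one N' hN') (mul N' hN') g ∘ₗ f.lin

variable {S} in
/-- The functor `(M, θ) ↦ (M, exp Ψ_M⁻¹(θ))`, the identity on the underlying linear maps. -/
def expFunctor {α β : ℚ} (h : S.ExpWellDefined α β) :
    (S.HiggsQuasiSmall β).FullSubcategory ⥤ (S.RepQuasiSmall α).FullSubcategory where
  obj N := ⟨Rep.of (S.expRep N.obj (h.one N.obj N.property) (h.mul N.obj N.property)),
    h.quasiSmall N.obj N.property⟩
  map {N N'} f := ObjectProperty.homMk (Rep.ofHom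
    ⟨f.hom.lin, h.comm N.obj N.property N'.obj N'.property f.hom⟩)

end Setting

end

end FaltingsHiggs

/-!
The correspondence rests on three facts.

*Exponential and logarithm.* Put `τ = p^(1/(p-1))`, so that `p^α = p^β τ`. By Legendre's formula
`τ^n / (n+1)!` is integral, hence `(p^α)^n / n!` is a multiple of `(p^β)^(n-1) p^α` and the series for
`exp (p^α w)` and `log (1 + p^α w)` converge in the endomorphism ring of a complete module
(`ExpDatum`). Multiplicativity of `exp` is the binomial theorem. The logarithm of `u` is also the limit
of `(u^(p^m) - 1) / p^m`, which gives `log (u u') = log u + log u'` for commuting `u`, `u'`, and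
`log (exp v) = v`; the logarithm being injective, `exp (log u) = u`. A finitely generated `O_C`-flat
`R̂_1`-module is indeed complete: submodules with `O_C`-flat quotient are closed, by division with
remainder in restricted power series over a valuation ring of rank one (`mem_of_mem_closure`,
`isAdicComplete_of_isOCFlat`).

*The two sides of the pairing.* For a generator `ε` of `ℤ_p(1)`, the element
`ξ = 1 + [ε^(1/p)] + ⋯ + [ε^(1/p)]^(p-1)` generates the kernel of Fontaine's homomorphism, and
`log[ε] = ([ε^(1/p)] - 1) ξ` is `(ζ_p - 1) ξ`, the factor `ζ_p - 1` being `τ` up to a unit (`xi_dvd`,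
`apply_tateLog`, `associated_sub_one_tau`). The module `Ω̃` is free, with basis the `dlog` of elements
of `P^gp` lifting a basis of `P^gp/ℤλ` modulo torsion (`Coords.exists_basis`).

*Kummer theory.* The characters of `Δ_∞` given by the same elements of `P^gp` identify a quotient of
`Δ_∞` with `ℤ_p(1)^n`, the kernel being `p`-divisible (`Coords.exists_chi_eq`,
`Coords.exists_pow_eq`). What has to be shown is that an element of `P^gp` which has a `p`-th root `f`
in `F_1` is divisible by `p` modulo torsion and `λ`. The logarithmic derivations `D` of `R` extend to
`F_1`, and `D f = (a/p) f` with `a` an integer. The set of `x ∈ R_1[1/p]` with `x f ∈ R_1[1/p]` is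
stable under the derivations, hence contains an element of `P`, and one may suppose `f ∈ R_1`. If `a`
is prime to `p`, then `f` is divisible by `p` in `R_1`, since `D` preserves `R_1`, and so by all the
powers of `p`. This is impossible by Krull's principal ideal theorem (`eq_zero_of_forall_mem_R1`,
`Coords.dvd_of_pow_mul_eq`).

Together the last two facts produce a basis of `E` and elements of `Δ_∞`, dual to it up to `τ` and a
unit, on whose values a homomorphism from `Δ_∞` to a complete module depends (`Frame`). So a field `θ`
is the same as a homomorphism from `Δ_∞` to endomorphisms, a factor `p^β` on one side corresponding to
`p^α` on the other (`bijOn_psiInv`). Under this bijection `θ ∧ θ = 0` means that the endomorphisms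
commute (`commute_contr`, `wedgeSq_eq_zero_of_commute`), which is what the exponential needs to be a
representation; continuity holds because the contraction with `g` tends to `0` as `g` tends to `1`.
The two constructions are then mutually inverse on objects, and preserve the underlying module, so
they restrict to free modules (`exists_equivalence`, `exists_equivalence_restrict`).
-/


/-! ### Adic completeness for principal ideals -/

section PrincipalAdic

variable {A : Type*} [CommRing A] {M : Type*} [AddCommGroup M] [Module A M] {c : A}

theorem smodEq_span_singleton_pow {n : ℕ} {x y : M} :
    x ≡ y [SMOD (Ideal.span {c} ^ n • ⊤ : Submodule A M)] ↔ ∃ z, x - y = c ^ n • z := by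
  rw [SModEq.sub_mem, Ideal.span_singleton_pow, Submodule.ideal_span_singleton_smul]
  simp only [Submodule.mem_smul_pointwise_iff_exists, Submodule.mem_top, true_and]
  exact exists_congr fun z => eq_comm

theorem isHausdorff_span_singleton_iff :
    IsHausdorff (Ideal.span {c}) M ↔ ∀ x : M, (∀ n, ∃ z, x = c ^ n • z) → x = 0 := by
  simp only [isHausdorff_iff, smodEq_span_singleton_pow, sub_zero]

/-- Completeness for a principal ideal `(c)` says that the series `∑ c^i z_i` converge. -/
theorem isPrecomplete_span_singleton_iff :
    IsPrecomplete (Ideal.span {c}) M ↔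
      ∀ z : ℕ → M, ∃ L, ∀ n, ∃ y, ∑ i ∈ Finset.range n, c ^ i • z i - L = c ^ n • y := by
  simp only [isPrecomplete_iff, smodEq_span_singleton_pow]
  constructor
  · intro h z
    apply h
    intro m n hmn
    obtain ⟨k, rfl⟩ := Nat.exists_eq_add_of_le hmn
    refine ⟨-∑ i ∈ Finset.range k, c ^ i • z (m + i), ?_⟩
    rw [Finset.sum_range_add, smul_neg, Finset.smul_sum]
    simp only [smul_smul, pow_add]
    abel
  · intro h f hf
    have hf' (n : ℕ) : ∃ z, f (n + 1) - f n = c ^ n • z := by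
      obtain ⟨z, hz⟩ := hf n.le_succ
      exact ⟨-z, by rw [smul_neg, ← hz, neg_sub]⟩
    choose z hz using hf'
    obtain ⟨L, hL⟩ := h z
    refine ⟨f 0 + L, fun n => ?_⟩
    obtain ⟨y, hy⟩ := hL n
    refine ⟨y, ?_⟩
    rw [← hy, ← Finset.sum_congr rfl (fun i _ => hz i), Finset.sum_range_sub]
    abel

theorem isPrecomplete_of_surjective {N : Type*} [AddCommGroup N] [Module A N] (f : M →ₗ[A] N)
    (hf : Function.Surjective f) [h : IsPrecomplete (Ideal.span {c}) M] :
    IsPrecomplete (Ideal.span {c}) N := by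
  rw [isPrecomplete_span_singleton_iff] at h ⊢
  intro z
  choose w hw using fun i => hf (z i)
  obtain ⟨L, hL⟩ := h w
  refine ⟨f L, fun n => ?_⟩
  obtain ⟨y, hy⟩ := hL n
  refine ⟨f y, ?_⟩
  rw [← map_smul, ← hy]
  simp [hw]

theorem isPrecomplete_pi (ι : Type*) [h : IsPrecomplete (Ideal.span {c}) M] :
    IsPrecomplete (Ideal.span {c}) (ι → M) := by
  rw [isPrecomplete_span_singleton_iff] at h ⊢
  intro z
  choose L hL using fun j => h (fun i => z i j)
  choose y hy using hL
  refine ⟨L, fun n => ⟨fun j => y j n, ?_⟩⟩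
  ext j
  simpa using hy j n

theorem isHausdorff_pi (ι : Type*) [h : IsHausdorff (Ideal.span {c}) M] :
    IsHausdorff (Ideal.span {c}) (ι → M) := by
  rw [isHausdorff_span_singleton_iff] at h ⊢
  intro x hx
  ext j
  refine h _ fun n => ?_
  obtain ⟨z, hz⟩ := hx n
  exact ⟨z j, by rw [hz]; rfl⟩

theorem isPrecomplete_of_finite [IsPrecomplete (Ideal.span {c}) A] [Module.Finite A M] :
    IsPrecomplete (Ideal.span {c}) M := by
  obtain ⟨n, f, hf⟩ := Module.Finite.exists_fin' A M
  have := isPrecomplete_pi (M := A) (c := c) (Fin n)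
  exact isPrecomplete_of_surjective f hf

theorem isAdicComplete_of_linearEquiv {N : Type*} [AddCommGroup N] [Module A N] (e : M ≃ₗ[A] N)
    [h : IsAdicComplete (Ideal.span {c}) M] : IsAdicComplete (Ideal.span {c}) N := by
  have h1 := isPrecomplete_of_surjective (c := c) e.toLinearMap e.surjective
  have h2 : IsHausdorff (Ideal.span {c}) N := by
    have h2 : IsHausdorff (Ideal.span {c}) M := inferInstance
    rw [isHausdorff_span_singleton_iff] at h2 ⊢
    intro x hx
    rw [← e.symm.map_eq_zero_iff]
    refine h2 _ fun n => ?_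
    obtain ⟨z, hz⟩ := hx n
    exact ⟨e.symm z, by rw [hz, map_smul]⟩
  exact { h1, h2 with }

theorem isAdicComplete_of_free [IsAdicComplete (Ideal.span {c}) A] [Module.Finite A M]
    [Module.Free A M] : IsAdicComplete (Ideal.span {c}) M := by
  have h1 := isPrecomplete_pi (M := A) (c := c) (Module.Free.ChooseBasisIndex A M)
  have h2 := isHausdorff_pi (M := A) (c := c) (Module.Free.ChooseBasisIndex A M)
  have : IsAdicComplete (Ideal.span {c}) (Module.Free.ChooseBasisIndex A M → A) := { h1, h2 with }
  exact isAdicComplete_of_linearEquiv (Module.Free.chooseBasis A M).equivFun.symm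

/-- If a power of `c` is a multiple of `d`, the `c`-adic topology is finer than the `d`-adic one.
-/
theorem isHausdorff_of_dvd_pow {d : A} {N : ℕ} (hd : d ∣ c ^ N)
    [h : IsHausdorff (Ideal.span {d}) M] : IsHausdorff (Ideal.span {c}) M := by
  rw [isHausdorff_span_singleton_iff] at h ⊢
  intro x hx
  refine h x fun n => ?_
  obtain ⟨z, hz⟩ := hx (N * n)
  obtain ⟨e, he⟩ := hd
  exact ⟨e ^ n • z, by rw [hz, pow_mul, he, mul_pow, mul_smul]⟩

/-- Completeness depends only on the topology: group the terms of `∑ c^i z_i` in blocks of length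
`N`, so that it becomes a series in the powers of `d`. -/
theorem isPrecomplete_of_dvd_pow {d : A} {N : ℕ} (hd : d ∣ c ^ N) (hc : c ∣ d)
    [h : IsPrecomplete (Ideal.span {d}) M] : IsPrecomplete (Ideal.span {c}) M := by
  rw [isPrecomplete_span_singleton_iff] at h ⊢
  intro z
  obtain ⟨e, he⟩ := hd
  obtain ⟨e', he'⟩ := hc
  obtain ⟨L, hL⟩ := h fun n => e ^ n • ∑ i ∈ Finset.range N, c ^ i • z (N * n + i)
  have key (m : ℕ) : ∑ i ∈ Finset.range m, d ^ i • e ^ i • ∑ j ∈ Finset.range N,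
      c ^ j • z (N * i + j) = ∑ i ∈ Finset.range (N * m), c ^ i • z i := by
    induction m with
    | zero => simp
    | succ m ih =>
      rw [Finset.sum_range_succ, ih, mul_add, mul_one, Finset.sum_range_add, smul_smul, ← mul_pow,
        ← he, Finset.smul_sum]
      simp only [smul_smul, ← pow_mul, ← pow_add]
  have hfar (a b : ℕ) : ∃ y, ∑ i ∈ Finset.range (a + b), c ^ i • z i =
      ∑ i ∈ Finset.range a, c ^ i • z i + c ^ a • y := by
    refine ⟨∑ i ∈ Finset.range b, c ^ i • z (a + i), ?_⟩
    rw [Finset.sum_range_add, Finset.smul_sum]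
    simp only [smul_smul, pow_add]
  refine ⟨L, fun n => ?_⟩
  obtain ⟨y, hy⟩ := hL n
  rw [key] at hy
  rcases Nat.eq_zero_or_pos N with rfl | hN
  · -- `d` is a unit, and so is `c`
    rw [pow_zero] at he
    refine ⟨(e' * e) ^ n • (∑ i ∈ Finset.range n, c ^ i • z i - L), ?_⟩
    rw [smul_smul, ← mul_pow, ← mul_assoc, ← he', ← he, one_pow, one_smul]
  · obtain ⟨k, hk⟩ := Nat.exists_eq_add_of_le (Nat.le_mul_of_pos_left n hN)
    obtain ⟨y', hy'⟩ := hfar n k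
    rw [← hk] at hy'
    refine ⟨e' ^ n • y - y', ?_⟩
    rw [smul_sub, smul_smul, ← mul_pow, ← he', ← hy, hy']
    abel

theorem isUnit_of_isUnit_mk {I : Ideal A} [IsAdicComplete I A] {x : A}
    (hx : IsUnit (Ideal.Quotient.mk I x)) : IsUnit x := by
  obtain ⟨y, hy⟩ := hx.exists_right_inv
  obtain ⟨y, rfl⟩ := Ideal.Quotient.mk_surjective y
  rw [← map_mul, ← map_one (Ideal.Quotient.mk I), Ideal.Quotient.eq] at hy
  have := Ideal.mem_jacobson_bot.1 (IsAdicComplete.le_jacobson_bot I hy) 1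
  rw [mul_one, sub_add_cancel] at this
  exact isUnit_of_mul_isUnit_left this

end PrincipalAdic

/-! ### Integral closures of complete discrete valuation rings -/

section IntegralClosure

/-- In an Artinian ring the idempotent `e` attached to `b` by Fitting's lemma: `b` is nilpotent
when `e = 0` and invertible when `e = 1`. -/
theorem exists_fitting_idempotent {B : Type*} [CommRing B] [IsArtinianRing B] (b : B) :
    ∃ e : B, e * e = e ∧ (e = 0 → IsUnit (1 - b)) ∧ (e = 1 → IsUnit b) := by
  obtain ⟨n, c, hc⟩ : ∃ (n : ℕ) (c : B), b ^ (n + 1) = b ^ (n + 1 + (n + 1)) * c := by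
    obtain ⟨n, hn⟩ := IsArtinian.monotone_stabilizes (R := B) (M := B)
      ⟨fun n => OrderDual.toDual (Ideal.span {b ^ n}), fun a c hac =>
        OrderDual.toDual_le_toDual.2 (Ideal.span_singleton_le_span_singleton.2 (pow_dvd_pow _ hac))⟩
    have h1 : Ideal.span {b ^ n} = Ideal.span {b ^ (n + 1)} := hn (n + 1) (by omega)
    have h2 : Ideal.span {b ^ n} = Ideal.span {b ^ (n + 1 + (n + 1))} := hn _ (by omega)
    have h : b ^ (n + 1) ∈ Ideal.span {b ^ (n + 1 + (n + 1))} := by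
      rw [← h2, h1]; exact Ideal.mem_span_singleton_self _
    obtain ⟨c, hc⟩ := Ideal.mem_span_singleton.1 h
    exact ⟨n, c, hc⟩
  refine ⟨b ^ (n + 1) * c, ?_, fun h => ?_, fun h => ?_⟩
  · calc b ^ (n + 1) * c * (b ^ (n + 1) * c) = (b ^ (n + 1 + (n + 1)) * c) * c := by ring
      _ = _ := by rw [← hc]
  · exact IsNilpotent.isUnit_one_sub ⟨n + 1, by rw [hc, pow_add, mul_assoc, h, mul_zero]⟩
  · exact (isUnit_pow_iff n.succ_ne_zero).1 (IsUnit.of_mul_eq_one _ h)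

theorem isUnit_two_mul_sub_one_of_idempotent {B : Type*} [CommRing B] {e : B} (he : e * e = e) :
    IsUnit (2 * e - 1) :=
  IsUnit.of_mul_eq_one (2 * e - 1) (by linear_combination 4 * he)

/-- Idempotents lift along an ideal for which the ring is complete. -/
theorem exists_idempotent_lift {B : Type*} [CommRing B] (I : Ideal B) [IsAdicComplete I B]
    (e : B ⧸ I) (he : e * e = e) : ∃ a : B, a * a = a ∧ Ideal.Quotient.mk I a = e := by
  obtain ⟨e, rfl⟩ := Ideal.Quotient.mk_surjective e
  have hmonic : (Polynomial.X ^ 2 - Polynomial.X : Polynomial B).Monic :=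
    by monicity!
  have hder : (Polynomial.X ^ 2 - Polynomial.X : Polynomial B).derivative.eval e = 2 * e - 1 := by
    simp [one_add_one_eq_two]
  have h0 : (Polynomial.X ^ 2 - Polynomial.X : Polynomial B).eval e ∈ I := by
    rw [Polynomial.eval_sub, Polynomial.eval_pow, Polynomial.eval_X, pow_two]
    rw [← map_mul] at he
    exact Ideal.Quotient.eq.1 he
  have h1 : IsUnit (Ideal.Quotient.mk I
      ((Polynomial.X ^ 2 - Polynomial.X : Polynomial B).derivative.eval e)) := by
    rw [hder, map_sub, map_mul, map_one, map_ofNat]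
    exact isUnit_two_mul_sub_one_of_idempotent he
  obtain ⟨a, ha, hab⟩ := HenselianRing.is_henselian (I := I) _ hmonic e h0 h1
  refine ⟨a, ?_, Ideal.Quotient.eq.2 hab⟩
  rw [Polynomial.IsRoot, Polynomial.eval_sub, Polynomial.eval_pow, Polynomial.eval_X] at ha
  rw [← pow_two, ← sub_eq_zero, ha]

/-- In a domain complete for an ideal with Artinian quotient, one of `b` and `1 - b` is a unit. -/
theorem isUnit_or_isUnit_one_sub {B : Type*} [CommRing B] [IsDomain B] (I : Ideal B)
    [IsAdicComplete I B] [IsArtinianRing (B ⧸ I)] (b : B) : IsUnit b ∨ IsUnit (1 - b) := by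
  obtain ⟨e, he, h0, h1⟩ := exists_fitting_idempotent (Ideal.Quotient.mk I b)
  obtain ⟨a, ha, rfl⟩ := exists_idempotent_lift I e he
  rcases mul_eq_zero.1 (show a * (a - 1) = 0 by linear_combination ha) with h | h
  · right
    apply isUnit_of_isUnit_mk (I := I)
    rw [map_sub, map_one]
    exact h0 (by rw [h, map_zero])
  · left
    apply isUnit_of_isUnit_mk (I := I)
    exact h1 (by rw [sub_eq_zero.1 h, map_one])

variable {O : Type*} [CommRing O] [IsDomain O] [IsDiscreteValuationRing O]
  [IsAdicComplete (IsLocalRing.maximalIdeal O) O]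

/-- A finite domain over a complete discrete valuation ring is local. -/
theorem isLocalRing_of_finite_complete (B : Type*) [CommRing B] [IsDomain B] [Algebra O B]
    [Module.Finite O B] [Module.Free O B] : IsLocalRing B := by
  obtain ⟨ϖ, hϖ⟩ := IsDiscreteValuationRing.exists_irreducible O
  have hm : IsLocalRing.maximalIdeal O = Ideal.span {ϖ} := hϖ.maximalIdeal_eq
  have hA : IsAdicComplete (Ideal.span {ϖ}) O := hm ▸ inferInstance
  have hc : IsAdicComplete (IsLocalRing.maximalIdeal O) B := by
    rw [hm]; exact isAdicComplete_of_free
  have h1 : IsAdicComplete ((IsLocalRing.maximalIdeal O).map (algebraMap O B)) B := by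
    rw [IsAdicComplete.map_algebraMap_iff]; exact hc
  have h2 : IsArtinianRing (B ⧸ (IsLocalRing.maximalIdeal O).map (algebraMap O B)) := by
    let _ : Field (O ⧸ IsLocalRing.maximalIdeal O) := Ideal.Quotient.field _
    exact IsArtinianRing.of_finite (O ⧸ IsLocalRing.maximalIdeal O) _
  exact IsLocalRing.of_isUnit_or_isUnit_one_sub_self
    (isUnit_or_isUnit_one_sub ((IsLocalRing.maximalIdeal O).map (algebraMap O B)))

variable (O) (K : Type*) (L : Type u) [Field K] [Algebra O K] [IsFractionRing O K] [CharZero O]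
  [Field L] [Algebra K L] [Algebra O L] [IsScalarTower O K L]

theorem isDiscreteValuationRing_integralClosure [FiniteDimensional K L] :
    IsDiscreteValuationRing (integralClosure O L) := by
  have : CharZero K := charZero_of_injective_algebraMap (IsFractionRing.injective O K)
  have : IsDedekindDomain (integralClosure O L) := integralClosure.isDedekindDomain O K L
  have h1 : Module.Finite O (integralClosure O L) :=
    IsIntegralClosure.finite O K L (integralClosure O L)
  have : FaithfulSMul O K := inferInstance
  have : FaithfulSMul O L := by
    rw [faithfulSMul_iff_algebraMap_injective, IsScalarTower.algebraMap_eq O K L]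
    exact (algebraMap K L).injective.comp (IsFractionRing.injective O K)
  have : Module.IsTorsionFree O (integralClosure O L) := inferInstance
  have h2 : Module.Free O (integralClosure O L) := inferInstance
  have h3 : IsLocalRing (integralClosure O L) :=
    isLocalRing_of_finite_complete (O := O) (integralClosure O L)
  have h4 : ¬ IsField (integralClosure O L) := by
    intro h
    have h5 : Algebra.IsIntegral O (integralClosure O L) := inferInstance
    exact IsDiscreteValuationRing.not_isField O (isField_of_isIntegral_of_isField
      (FaithfulSMul.algebraMap_injective O (integralClosure O L)) h)
  exact ((IsDiscreteValuationRing.TFAE (integralClosure O L) h4).out 0 2).2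
    (‹IsDedekindDomain (integralClosure O L)› :)

/-- Any two elements of the integral closure in an algebraic extension lie in a discrete valuation
ring: the integral closure in a finite subextension. -/
theorem exists_discreteValuationRing_hom [Algebra.IsAlgebraic K L] (a b : integralClosure O L) :
    ∃ (B : Type u) (_ : CommRing B) (_ : IsDomain B) (_ : IsDiscreteValuationRing B)
      (j : B →+* integralClosure O L), Function.Injective j ∧ IsLocalHom j ∧
        a ∈ Set.range j ∧ b ∈ Set.range j := by
  let F : IntermediateField K L := IntermediateField.adjoin K {(a : L), (b : L)}
  have : FiniteDimensional K F := by
    apply IntermediateField.finiteDimensional_adjoin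
    intro x _
    exact Algebra.IsIntegral.isIntegral x
  let f : F →ₐ[O] L := F.val.restrictScalars O
  have hf : Function.Injective f := F.val.injective
  let j : integralClosure O F →+* integralClosure O L :=
    (f.mapIntegralClosure : integralClosure O F →ₐ[O] integralClosure O L)
  have hmem (x : integralClosure O L) (hx : (x : L) ∈ F) : x ∈ Set.range j := by
    have h1 : IsIntegral O (⟨x, hx⟩ : F) :=
      (isIntegral_algHom_iff f hf).1 x.2
    exact ⟨⟨⟨x, hx⟩, h1⟩, Subtype.ext rfl⟩
  have hj : Function.Injective j := fun x y hxy =>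
    Subtype.ext (hf (congrArg (algebraMap (integralClosure O L) L) hxy))
  refine ⟨integralClosure O F, inferInstance, inferInstance,
    isDiscreteValuationRing_integralClosure O K F, j, hj, ⟨fun x hx => ?_⟩,
    hmem a (IntermediateField.subset_adjoin _ _ (by simp)),
    hmem b (IntermediateField.subset_adjoin _ _ (by simp))⟩
  obtain ⟨y, hy⟩ := hx.exists_right_inv
  have hx0 : (x : F) ≠ 0 := by
    intro h0
    have : x = 0 := Subtype.ext h0
    rw [this, map_zero, zero_mul] at hy
    exact zero_ne_one hy
  have hy' : (y : L) = ((x : F)⁻¹ : F) := by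
    have h1 : ((x : F) : L) * (y : L) = 1 := congrArg (algebraMap (integralClosure O L) L) hy
    have h2 : ((x : F) : L) ≠ 0 := fun h => hx0 (Subtype.ext h)
    rw [eq_comm]
    push_cast
    exact inv_eq_of_mul_eq_one_right h1
  obtain ⟨z, hz⟩ := hmem y (by rw [hy']; exact SetLike.coe_mem _)
  refine IsUnit.of_mul_eq_one z (hj ?_)
  rw [map_mul, hz, hy, map_one]

include K in
theorem integralClosure_dvd_total [Algebra.IsAlgebraic K L] (a b : integralClosure O L) :
    a ∣ b ∨ b ∣ a := by
  obtain ⟨B, _, _, _, j, -, -, ⟨x, rfl⟩, ⟨y, rfl⟩⟩ := exists_discreteValuationRing_hom O K L a b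
  rcases ValuationRing.dvd_total x y with h | h
  · exact Or.inl (map_dvd j h)
  · exact Or.inr (map_dvd j h)

include K in
/-- The integral closure has rank one. -/
theorem integralClosure_exists_dvd_pow [Algebra.IsAlgebraic K L] (a c : integralClosure O L)
    (ha : a ≠ 0) (hc : ¬ IsUnit c) : ∃ N, a ∣ c ^ N := by
  obtain ⟨B, _, _, _, j, hj, hj', ⟨x, rfl⟩, ⟨y, rfl⟩⟩ :=
    exists_discreteValuationRing_hom O K L a c
  obtain ⟨ϖ, hϖ⟩ := IsDiscreteValuationRing.exists_irreducible B
  have hx : x ≠ 0 := by rintro rfl; exact ha (map_zero j)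
  obtain ⟨n, u, rfl⟩ := IsDiscreteValuationRing.eq_unit_mul_pow_irreducible hx hϖ
  have hy : ϖ ∣ y := by
    rw [← Ideal.mem_span_singleton, ← hϖ.maximalIdeal_eq, IsLocalRing.mem_maximalIdeal]
    exact fun h => hc (h.map j)
  refine ⟨n, ?_⟩
  rw [← map_pow]
  exact map_dvd j (u.mul_left_dvd.2 (pow_dvd_pow_of_dvd hy n))

end IntegralClosure

/-! ### Closed ideals in Tate algebras over valuation rings of rank one -/

section TateAlgebra

/-- Dickson's lemma: a set of exponents has finitely many minimal elements, and they lie below all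
the others. -/
theorem exists_finset_le_of_finite {σ : Type*} [Finite σ] (S : Set (σ →₀ ℕ)) :
    ∃ D : Finset (σ →₀ ℕ), ↑D ⊆ S ∧ ∀ d ∈ S, ∃ e ∈ D, e ≤ d := by
  have hfin : {x | Minimal (· ∈ S) x}.Finite :=
    (setOfPred_minimal_antichain _).finite_of_partiallyWellOrderedOn
      (Set.isPWO_of_wellQuasiOrderedLE _)
  refine ⟨hfin.toFinset, fun x hx => ?_, fun d hd => ?_⟩
  · exact ((Set.Finite.mem_toFinset hfin).1 hx).1
  · obtain ⟨e, he, hmin⟩ := exists_minimal_le_of_wellFoundedLT (· ∈ S) d hd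
    exact ⟨e, (Set.Finite.mem_toFinset hfin).2 hmin, he⟩

variable {V : Type*} [CommRing V] [IsDomain V] [ValuationRing V]

/-- A nonempty finite set of elements of a valuation ring has a member dividing all of them. -/
theorem exists_mem_dvd_of_finset (s : Finset V) (hs : s.Nonempty) : ∃ c ∈ s, ∀ x ∈ s, c ∣ x := by
  classical
  induction hs using Finset.Nonempty.cons_induction with
  | singleton a => exact ⟨a, by simp⟩
  | cons a s ha hs ih =>
    obtain ⟨c, hc, h⟩ := ih
    rcases ValuationRing.dvd_total a c with hac | hca
    · refine ⟨a, by simp, fun x hx => ?_⟩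
      rcases Finset.mem_cons.1 hx with rfl | hx
      · exact dvd_rfl
      · exact hac.trans (h x hx)
    · refine ⟨c, by simp [hc], fun x hx => ?_⟩
      rcases Finset.mem_cons.1 hx with rfl | hx
      · exact hca
      · exact h x hx

/-- The Gauss content of a nonzero polynomial over a valuation ring. -/
theorem exists_eq_C_mul_primitive {σ : Type*} (F : MvPolynomial σ V) (hF : F ≠ 0) :
    ∃ (e : V) (F₀ : MvPolynomial σ V), e ≠ 0 ∧ F = MvPolynomial.C e * F₀ ∧
      MvPolynomial.map (IsLocalRing.residue V) F₀ ≠ 0 := by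
  classical
  obtain ⟨e, he, hdvd⟩ := exists_mem_dvd_of_finset (F.support.image fun d => F.coeff d)
    ((MvPolynomial.support_nonempty.2 hF).image _)
  obtain ⟨d, hd, rfl⟩ := Finset.mem_image.1 he
  have he0 : F.coeff d ≠ 0 := MvPolynomial.mem_support_iff.1 hd
  have : MvPolynomial.C (F.coeff d) ∣ F := by
    rw [MvPolynomial.C_dvd_iff_dvd_coeff]
    intro i
    by_cases hi : i ∈ F.support
    · exact hdvd _ (Finset.mem_image_of_mem _ hi)
    · rw [MvPolynomial.notMem_support_iff.1 hi]; exact dvd_zero _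
  obtain ⟨F₀, h0⟩ := this
  refine ⟨_, F₀, he0, h0, fun h => ?_⟩
  have h1 := congrArg (MvPolynomial.coeff d) h0
  rw [MvPolynomial.coeff_C_mul] at h1
  have h2 : F₀.coeff d = 1 := mul_left_cancel₀ he0 (by rw [← h1, mul_one])
  have h3 := congrArg (MvPolynomial.coeff d) h
  rw [MvPolynomial.coeff_map, h2, map_one, MvPolynomial.coeff_zero] at h3
  exact one_ne_zero h3

theorem residue_eq_zero_iff_not_isUnit (x : V) : IsLocalRing.residue V x = 0 ↔ ¬ IsUnit x := by
  rw [IsLocalRing.residue_eq_zero_iff, IsLocalRing.mem_maximalIdeal, mem_nonunits_iff]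

variable {T : Type*} [CommRing T] {σ : Type*} [Finite σ] (j : MvPolynomial σ V →+* T) (p : ℕ)

/-- An ideal `N` of a `p`-adically complete ring `T` with `T/p^k = V[σ]/p^k`, where `V` is a
valuation ring of rank one, is closed for the `p`-adic topology when `T/N` is torsion-free over
`V`. The leading exponents of the elements of `N` not divisible by a non-unit are those of
finitely many `f_d`; modulo a suitable non-unit `c` the `f_d` have invertible leading coefficients,
and division by them shows that the closure of `N` is `(f_d)_d` modulo `c`. -/
theorem mem_of_mem_closure (hrank : ∀ a c : V, a ≠ 0 → ¬ IsUnit c → ∃ N, a ∣ c ^ N)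
    (hp0 : (p : V) ≠ 0) (hp1 : ¬ IsUnit (p : V)) [hT : IsAdicComplete (Ideal.span {(p : T)}) T]
    (hsurj : ∀ (k : ℕ) (t : T), ∃ F s, t = j F + p ^ k * s)
    (N : Ideal T) (hN : ∀ (e : V) (t : T), e ≠ 0 → j (MvPolynomial.C e) * t ∈ N → t ∈ N)
    (t : T) (ht : ∀ k, ∃ n ∈ N, ∃ w, t = n + p ^ k * w) : t ∈ N := by
  classical
  have : LinearOrder σ := (LinearOrder.lift' (Finite.equivFin σ) (Finite.equivFin σ).injective)
  have : WellFoundedGT σ := Finite.to_wellFoundedGT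
  let mo : MonomialOrder σ := MonomialOrder.lex
  set res := IsLocalRing.residue V
  -- the closure of `N`
  let Nb : Ideal T :=
    { carrier := {t | ∀ k, ∃ n ∈ N, ∃ w, t = n + p ^ k * w}
      add_mem' := by
        intro a b ha hb k
        obtain ⟨n, hn, w, rfl⟩ := ha k
        obtain ⟨n', hn', w', rfl⟩ := hb k
        exact ⟨n + n', N.add_mem hn hn', w + w', by ring⟩
      zero_mem' := fun k => ⟨0, N.zero_mem, 0, by ring⟩
      smul_mem' := by
        intro c x hx k
        obtain ⟨n, hn, w, rfl⟩ := hx k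
        exact ⟨c * n, N.mul_mem_left c hn, c * w, by rw [smul_eq_mul]; ring⟩ }
  have hNb (x : T) : x ∈ Nb ↔ ∀ k, ∃ n ∈ N, ∃ w, x = n + p ^ k * w := Iff.rfl
  have hNb_sat (e : V) (x : T) (he : e ≠ 0) (hx : j (MvPolynomial.C e) * x ∈ Nb) : x ∈ Nb := by
    intro k
    obtain ⟨K, e', he'⟩ := hrank e p he hp1
    have hpK : (p : T) ^ K = j (MvPolynomial.C e) * j (MvPolynomial.C e') := by
      rw [← map_mul, ← map_mul, ← he']; simp
    obtain ⟨n, hn, w, hw⟩ := hx (K + k)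
    refine ⟨x - p ^ k * (j (MvPolynomial.C e') * w), hN e _ he ?_, j (MvPolynomial.C e') * w,
      by ring⟩
    have : j (MvPolynomial.C e) * (x - p ^ k * (j (MvPolynomial.C e') * w)) = n := by
      rw [mul_sub, hw, pow_add, hpK]; ring
    rwa [this]
  -- the leading exponents of `N`
  let S : Set (σ →₀ ℕ) := {d | ∃ F s, j F + p * s ∈ N ∧
    MvPolynomial.map res F ≠ 0 ∧ mo.degree (MvPolynomial.map res F) = d}
  obtain ⟨D, hDS, hD⟩ := exists_finset_le_of_finite S
  have hDS' : ∀ d : D, ∃ F s, j F + p * s ∈ N ∧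
    MvPolynomial.map res F ≠ 0 ∧ mo.degree (MvPolynomial.map res F) = d := fun d => hDS d.2
  choose F s hFN hF0 hFd using hDS'
  -- `c` divides `p` and all the coefficients of the `F d` that are not units
  obtain ⟨c, hc, hcdvd⟩ := exists_mem_dvd_of_finset
    (insert (p : V) (Finset.univ.biUnion fun d =>
      ((F d).support.image fun e => (F d).coeff e).filter fun x => ¬ IsUnit x))
    (Finset.insert_nonempty _ _)
  have hcu : ¬ IsUnit c := by
    rcases Finset.mem_insert.1 hc with rfl | hc
    · exact hp1
    · obtain ⟨d, -, hc⟩ := Finset.mem_biUnion.1 hc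
      exact (Finset.mem_filter.1 hc).2
  obtain ⟨p', hp'⟩ := hcdvd p (Finset.mem_insert_self _ _)
  have hcF (d : D) (e : σ →₀ ℕ) (he : ¬ IsUnit ((F d).coeff e)) : c ∣ (F d).coeff e := by
    by_cases h : e ∈ (F d).support
    · exact hcdvd _ (Finset.mem_insert_of_mem (Finset.mem_biUnion.2 ⟨d, Finset.mem_univ _,
        Finset.mem_filter.2 ⟨Finset.mem_image_of_mem _ h, he⟩⟩))
    · rw [MvPolynomial.notMem_support_iff.1 h]; exact dvd_zero _
  have hc0 : c ≠ 0 := by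
    rintro rfl
    exact hp0 (by rw [hp', zero_mul])
  set q := Ideal.Quotient.mk (Ideal.span {c})
  have hnt : Nontrivial (V ⧸ Ideal.span {c}) := by
    apply Ideal.Quotient.nontrivial_iff.2
    rwa [Ne, Ideal.span_singleton_eq_top]
  have hqunit (x : V) (hx : ¬ IsUnit x) (hx' : c ∣ x) : q x = 0 :=
    Ideal.Quotient.eq_zero_iff_mem.2 (Ideal.mem_span_singleton.2 hx')
  -- the leading coefficients of the `F d` modulo `c` are invertible
  have hunit (d : D) : IsUnit ((F d).coeff d) := by
    by_contra h
    have h1 := mo.coeff_degree_ne_zero_iff.2 (hF0 d)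
    rw [hFd, MvPolynomial.coeff_map] at h1
    exact h1 ((residue_eq_zero_iff_not_isUnit _).2 h)
  have hdeg (d : D) : mo.degree (MvPolynomial.map q (F d)) = d := by
    apply mo.toSyn.injective
    apply le_antisymm
    · rw [mo.degree_le_iff]
      intro b hb
      rw [← hFd d]
      apply mo.le_degree
      rw [MvPolynomial.mem_support_iff, MvPolynomial.coeff_map] at hb ⊢
      intro h
      have h1 := (residue_eq_zero_iff_not_isUnit _).1 h
      exact hb (hqunit _ h1 (hcF d b h1))
    · apply mo.le_degree
      rw [MvPolynomial.mem_support_iff, MvPolynomial.coeff_map]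
      exact ((hunit d).map q).ne_zero
  have hlead (d : D) : IsUnit (mo.leadingCoeff (MvPolynomial.map q (F d))) := by
    rw [MonomialOrder.leadingCoeff, hdeg, MvPolynomial.coeff_map]
    exact (hunit d).map q
  set jc := j (MvPolynomial.C c)
  have hpjc : (p : T) = jc * j (MvPolynomial.C p') := by
    rw [← map_mul, ← map_mul, ← hp']; simp
  let f : D → T := fun d => j (F d) + p * s d
  -- divide by the `F d` modulo `c`
  have hdiv (x : T) (hx : x ∈ Nb) : ∃ (a : D → T), ∃ y ∈ Nb, x = ∑ d, a d * f d + jc * y := by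
    obtain ⟨G, w, rfl⟩ := hsurj 1 x
    obtain ⟨g, r, hgr, -, hr⟩ := mo.div hlead (MvPolynomial.map q G)
    have hq : Function.Surjective q := Ideal.Quotient.mk_surjective
    choose a ha using fun d => MvPolynomial.map_surjective q hq (g d)
    obtain ⟨r', hr', hr'2⟩ : ∃ r' : MvPolynomial σ V, MvPolynomial.map q r' = r ∧
        r'.support ⊆ r.support := by
      choose l hl using hq
      refine ⟨∑ e ∈ r.support, MvPolynomial.monomial e (l (r.coeff e)), ?_, ?_⟩
      · rw [map_sum]
        simp only [MvPolynomial.map_monomial, hl]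
        exact (MvPolynomial.as_sum r).symm
      · intro e he
        obtain ⟨e', he', h⟩ := Finset.mem_biUnion.1 (MvPolynomial.support_sum he)
        rwa [Finset.mem_singleton.1 (MvPolynomial.support_monomial_subset h)]
    have hker : MvPolynomial.C c ∣ G - ∑ d, a d * F d - r' := by
      rw [MvPolynomial.C_dvd_iff_map_hom_eq_zero q c (fun x => by
        rw [Ideal.Quotient.eq_zero_iff_mem, Ideal.mem_span_singleton])]
      rw [map_sub, map_sub, hgr, hr', map_sum, Finsupp.linearCombination_apply,
        Finsupp.sum_fintype _ _ (by simp)]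
      simp [ha]
    obtain ⟨G', hG'⟩ := hker
    have hG : G = ∑ d, a d * F d + r' + MvPolynomial.C c * G' := by rw [← hG']; ring
    -- the remainder is in the closure of `N`
    set y := j G' + j (MvPolynomial.C p') * (w - ∑ d, j (a d) * s d) with hy
    have hx2 : j G + (p : T) ^ 1 * w = ∑ d, j (a d) * f d + (j r' + jc * y) := by
      rw [hG, map_add, map_add, map_sum, map_mul, pow_one, hy]
      simp only [map_mul, f, mul_add, Finset.sum_add_distrib, mul_sub, ← mul_assoc, ← hpjc,
        Finset.mul_sum]
      have : ∀ d, j (a d) * (p : T) * s d = (p : T) * j (a d) * s d := fun d => by ring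
      simp only [this]
      ring
    have hrem : j r' + jc * y ∈ Nb := by
      have h1 : ∑ d, j (a d) * f d ∈ Nb :=
        Nb.sum_mem fun d _ => Nb.mul_mem_left _ fun k => ⟨f d, hFN d, 0, by ring⟩
      rw [hx2] at hx
      exact (Nb.add_mem_iff_right h1).1 hx
    -- otherwise `r' = e r₀` with `r₀` primitive and `e` a proper divisor of `c`; dividing the
    -- remainder by `e` shows that the leading exponent of `r₀` is in `S`, against the choice of `r`
    suffices h : ∃ r'', r' = MvPolynomial.C c * r'' by
      obtain ⟨r'', rfl⟩ := h
      rw [map_mul, ← mul_add] at hrem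
      refine ⟨fun d => j (a d), j r'' + y, hNb_sat c _ hc0 hrem, ?_⟩
      rw [hx2, map_mul]; ring
    by_cases hr0 : r' = 0
    · exact ⟨0, by rw [hr0, mul_zero]⟩
    obtain ⟨e, r₀, he0, hr₀, hr₀'⟩ := exists_eq_C_mul_primitive r' hr0
    rcases ValuationRing.dvd_total c e with ⟨e', rfl⟩ | ⟨e', he'⟩
    · exact ⟨MvPolynomial.C e' * r₀, by rw [hr₀, MvPolynomial.C_mul, mul_assoc]⟩
    by_cases hu : IsUnit e'
    · obtain ⟨v, hv⟩ := hu.exists_right_inv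
      refine ⟨MvPolynomial.C v * r₀, ?_⟩
      rw [hr₀, ← mul_assoc, ← MvPolynomial.C_mul, he', mul_assoc, hv, mul_one]
    exfalso
    have h1 : j r₀ + j (MvPolynomial.C e') * y ∈ Nb := by
      apply hNb_sat e _ he0
      rw [mul_add, ← map_mul, ← hr₀, ← mul_assoc, ← map_mul, ← MvPolynomial.C_mul, ← he']
      exact hrem
    obtain ⟨Y, y', hyY⟩ := hsurj 1 y
    obtain ⟨n, hn, w', hw'⟩ := h1 1
    have hS : mo.degree (MvPolynomial.map res r₀) ∈ S := by
      have hred : MvPolynomial.map res (r₀ + MvPolynomial.C e' * Y) = MvPolynomial.map res r₀ := by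
        rw [map_add, map_mul, MvPolynomial.map_C, (residue_eq_zero_iff_not_isUnit _).2 hu]
        simp
      refine ⟨r₀ + MvPolynomial.C e' * Y, j (MvPolynomial.C e') * y' - w', ?_, ?_, ?_⟩
      · have : j (r₀ + MvPolynomial.C e' * Y) + p * (j (MvPolynomial.C e') * y' - w') = n := by
          rw [hyY] at hw'
          rw [map_add, map_mul]
          linear_combination hw'
        rwa [this]
      · rwa [hred]
      · rw [hred]
    obtain ⟨d, hd, hle⟩ := hD _ hS
    refine hr (mo.degree (MvPolynomial.map res r₀)) (hr'2 ?_) ⟨d, hd⟩ ?_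
    · have := mo.coeff_degree_ne_zero_iff.2 hr₀'
      rw [MvPolynomial.coeff_map] at this
      rw [MvPolynomial.mem_support_iff, hr₀, MvPolynomial.coeff_C_mul]
      exact mul_ne_zero he0 fun h => this (by rw [h, map_zero])
    · rw [hdeg]; exact hle
  -- by Nakayama's lemma for complete modules, the `f d` generate the closure of `N`
  obtain ⟨K, hK⟩ := hrank p c hp0 hcu
  have hpK : (p : T) ∣ jc ^ K := by
    obtain ⟨x, hx⟩ := hK
    exact ⟨j (MvPolynomial.C x), by rw [← map_pow, ← map_pow, hx]; simp⟩
  have hjcp : jc ∣ (p : T) := ⟨_, hpjc⟩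
  have hpre : IsPrecomplete (Ideal.span {jc}) T := isPrecomplete_of_dvd_pow hpK hjcp
  have hpre' := isPrecomplete_pi (M := T) (c := jc) D
  have hhaus : IsHausdorff (Ideal.span {jc}) T := isHausdorff_of_dvd_pow hpK
  have hhaus' : IsHausdorff (Ideal.span {jc}) Nb := by
    rw [isHausdorff_span_singleton_iff] at hhaus ⊢
    intro x hx
    apply Subtype.ext
    refine hhaus _ fun n => ?_
    obtain ⟨z, hz⟩ := hx n
    exact ⟨z, congrArg Subtype.val hz⟩
  have hfNb (d : D) : f d ∈ Nb := fun k => ⟨f d, hFN d, 0, by ring⟩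
  let φ : (D → T) →ₗ[T] Nb := Fintype.linearCombination T fun d => (⟨f d, hfNb d⟩ : Nb)
  have hφ (a : D → T) : (φ a : T) = ∑ d, a d * f d := by
    simp [φ, Fintype.linearCombination_apply]
  have hsurj' : Function.Surjective φ := by
    apply surjective_of_mkQ_comp_surjective (I := Ideal.span {jc})
    intro y
    obtain ⟨x, rfl⟩ := Submodule.mkQ_surjective _ y
    obtain ⟨a, z, hz, hxz⟩ := hdiv x x.2
    refine ⟨a, ?_⟩
    rw [LinearMap.comp_apply, ← sub_eq_zero, ← map_sub, Submodule.mkQ_apply,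
      Submodule.Quotient.mk_eq_zero]
    have : φ a - x = jc • (-⟨z, hz⟩ : Nb) := by
      apply Subtype.ext
      rw [Submodule.coe_sub, hφ, hxz]
      simp
    rw [this]
    exact Submodule.smul_mem_smul (Ideal.mem_span_singleton_self _) trivial
  obtain ⟨a, ha⟩ := hsurj' ⟨t, ht⟩
  have : t = ∑ d, a d * f d := by rw [← hφ, ha]
  rw [this]
  exact N.sum_mem fun d _ => N.mul_mem_left _ (hFN d)

theorem isAdicComplete_trivSqZeroExt {A : Type*} [CommRing A] (n : ℕ)
    [hA : IsAdicComplete (Ideal.span {(p : A)}) A] :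
    IsAdicComplete (Ideal.span {(p : TrivSqZeroExt A (Fin n → A))})
      (TrivSqZeroExt A (Fin n → A)) := by
  have hpA : ((algebraMap A (TrivSqZeroExt A (Fin n → A))) (p : A)) =
      (p : TrivSqZeroExt A (Fin n → A)) := map_natCast _ _
  have h : Ideal.span {(p : TrivSqZeroExt A (Fin n → A))} =
      (Ideal.span {(p : A)}).map (algebraMap A (TrivSqZeroExt A (Fin n → A))) := by
    rw [Ideal.map_span, Set.image_singleton, hpA]
  rw [h, IsAdicComplete.map_algebraMap_iff]
  have : Module.Free A (TrivSqZeroExt A (Fin n → A)) :=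
    inferInstanceAs (Module.Free A (A × (Fin n → A)))
  have : Module.Finite A (TrivSqZeroExt A (Fin n → A)) :=
    inferInstanceAs (Module.Finite A (A × (Fin n → A)))
  exact isAdicComplete_of_free

/-- A finitely generated module `M` without `V`-torsion over a torsion-free `p`-adically complete
`V`-algebra `A` topologically generated by finitely many elements is separated: apply
`mem_of_mem_closure` to the square-zero extension of `A` by `M`, a quotient of the square-zero
extension of `A` by a free module. -/
theorem isHausdorff_of_finite_of_torsionFree
    (hrank : ∀ a c : V, a ≠ 0 → ¬ IsUnit c → ∃ N, a ∣ c ^ N) (hp0 : (p : V) ≠ 0)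
    (hp1 : ¬ IsUnit (p : V)) {A : Type*} [CommRing A] [Algebra V A]
    [IsAdicComplete (Ideal.span {(p : A)}) A]
    (hA : ∀ (e : V) (a : A), e ≠ 0 → algebraMap V A e * a = 0 → a = 0)
    (x : σ → A) (hx : ∀ (k : ℕ) (a : A), ∃ F s, a = MvPolynomial.aeval (R := V) x F + p ^ k * s)
    (M : Type*) [AddCommGroup M] [Module A M] [Module.Finite A M]
    (hM : ∀ (e : V) (m : M), e ≠ 0 → algebraMap V A e • m = 0 → m = 0) :
    IsHausdorff (Ideal.span {(p : A)}) M := by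
  classical
  obtain ⟨n, f, hf⟩ := Module.Finite.exists_fin' A M
  have := isAdicComplete_trivSqZeroExt p (A := A) n
  let j : MvPolynomial (σ ⊕ Fin n) V →ₐ[V] TrivSqZeroExt A (Fin n → A) :=
    MvPolynomial.aeval (Sum.elim (fun i => TrivSqZeroExt.inl (x i))
      (fun i => TrivSqZeroExt.inr (Pi.single i 1)))
  have hjC (e : V) : j (MvPolynomial.C e) = TrivSqZeroExt.inl (algebraMap V A e) := by
    rw [← MvPolynomial.algebraMap_eq, AlgHom.commutes]; rfl
  have hjF (F : MvPolynomial σ V) : j (MvPolynomial.rename Sum.inl F) =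
      TrivSqZeroExt.inl (MvPolynomial.aeval x F) := by
    rw [MvPolynomial.aeval_rename]
    have : (TrivSqZeroExt.inlAlgHom V A (Fin n → A)).comp (MvPolynomial.aeval x) =
        MvPolynomial.aeval (Sum.elim (fun i => TrivSqZeroExt.inl (x i))
      (fun i => TrivSqZeroExt.inr (Pi.single i 1)) ∘ Sum.inl) := by
      apply MvPolynomial.algHom_ext
      intro i
      simp
    exact (DFunLike.congr_fun this F).symm
  have hpT (k : ℕ) : ((p : TrivSqZeroExt A (Fin n → A)) ^ k) = TrivSqZeroExt.inl ((p : A) ^ k) := by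
    rw [← TrivSqZeroExt.inl_pow, TrivSqZeroExt.inl_natCast]
  let N : Ideal (TrivSqZeroExt A (Fin n → A)) :=
    { carrier := {t | t.fst = 0 ∧ f t.snd = 0}
      add_mem' := by
        rintro a b ⟨ha, ha'⟩ ⟨hb, hb'⟩
        exact ⟨by simp [ha, hb], by simp [ha', hb']⟩
      zero_mem' := by simp
      smul_mem' := by
        rintro c a ⟨ha, ha'⟩
        exact ⟨by simp [ha], by simp [ha, ha']⟩ }
  rw [isHausdorff_span_singleton_iff]
  intro m hm
  obtain ⟨v, rfl⟩ := hf m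
  have key := mem_of_mem_closure j.toRingHom p hrank hp0 hp1 (fun k t => ?_) N
    (fun e t he ht => ?_) (TrivSqZeroExt.inr v) (fun k => ?_)
  · exact key.2
  · obtain ⟨F, s, hF⟩ := hx k t.fst
    choose G s' hG using fun i => hx k (t.snd i)
    refine ⟨MvPolynomial.rename Sum.inl F +
      ∑ i, MvPolynomial.rename Sum.inl (G i) * MvPolynomial.X (Sum.inr i),
      TrivSqZeroExt.inl s + TrivSqZeroExt.inr s', ?_⟩
    change t = j _ + _
    rw [map_add, map_sum, hjF, hpT]
    simp only [map_mul, hjF]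
    have hX (i : Fin n) : j (MvPolynomial.X (Sum.inr i)) = TrivSqZeroExt.inr (Pi.single i 1) := by
      simp [j]
    simp only [hX, TrivSqZeroExt.inl_mul_inr]
    ext i
    · simp [hF, TrivSqZeroExt.fst_sum]
    · simp [hG i, Pi.single_apply, TrivSqZeroExt.snd_sum]
  · change j (MvPolynomial.C e) * t ∈ N at ht
    rw [hjC] at ht
    obtain ⟨h1, h2⟩ := ht
    have h1' : t.fst = 0 := hA e _ he (by simpa using h1)
    refine ⟨h1', hM e _ he ?_⟩
    have h3 : (TrivSqZeroExt.inl (algebraMap V A e) * t).snd = algebraMap V A e • t.snd := by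
      simp [h1', -algebraMap_smul]
    rw [h3, map_smul] at h2
    exact h2
  · obtain ⟨z, hz⟩ := hm k
    obtain ⟨w, rfl⟩ := hf z
    refine ⟨TrivSqZeroExt.inr (v - (p : A) ^ k • w), ⟨by simp, ?_⟩, TrivSqZeroExt.inr w, ?_⟩
    · simp [hz]
    · rw [hpT, TrivSqZeroExt.inl_mul_inr, ← TrivSqZeroExt.inr_add, sub_add_cancel]

end TateAlgebra

namespace FaltingsHiggs

noncomputable section

/-! ### `p`-adic completions of domains -/

section Completion

variable {p : ℕ} {A : Type u} [CommRing A]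

/-- The image of `A` is dense in its completion. -/
theorem exists_eq_algebraMap_add (k : ℕ) (x : AdicCompletion (Ideal.span {(p : A)}) A) :
    ∃ (a : A) (y : AdicCompletion (Ideal.span {(p : A)}) A),
      x = algebraMap A _ a + (p : AdicCompletion (Ideal.span {(p : A)}) A) ^ k * y := by
  obtain ⟨a, ha⟩ := Submodule.mkQ_surjective _ (AdicCompletion.eval (Ideal.span {(p : A)}) A k x)
  have h1 : x - AdicCompletion.of (Ideal.span {(p : A)}) A a ∈
      (AdicCompletion.eval (Ideal.span {(p : A)}) A k).ker := by
    rw [LinearMap.mem_ker, map_sub, AdicCompletion.eval_of, ha, sub_self]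
  rw [← AdicCompletion.pow_smul_top_eq_ker_eval (Submodule.fg_span (Set.finite_singleton _)),
    ← SModEq.sub_mem, smodEq_span_singleton_pow] at h1
  obtain ⟨y, hy⟩ := h1
  refine ⟨a, y, ?_⟩
  rw [sub_eq_iff_eq_add'] at hy
  rw [hy, Algebra.smul_def, map_pow, map_natCast]
  rfl

theorem dvd_of_algebraMap_eq {k : ℕ} {a : A} {y : AdicCompletion (Ideal.span {(p : A)}) A}
    (h : algebraMap A _ a = (p : AdicCompletion (Ideal.span {(p : A)}) A) ^ k * y) :
    (p : A) ^ k ∣ a := by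
  have h1 : AdicCompletion.of (Ideal.span {(p : A)}) A a ∈
      (AdicCompletion.eval (Ideal.span {(p : A)}) A k).ker := by
    rw [← AdicCompletion.pow_smul_top_eq_ker_eval (Submodule.fg_span (Set.finite_singleton _)),
      ← sub_zero (AdicCompletion.of _ A a), ← SModEq.sub_mem, smodEq_span_singleton_pow]
    refine ⟨y, ?_⟩
    rw [sub_zero, Algebra.smul_def, map_pow, map_natCast, ← h]
    rfl
  rw [LinearMap.mem_ker, AdicCompletion.eval_of, Submodule.mkQ_apply,
    Submodule.Quotient.mk_eq_zero, smul_eq_mul, Ideal.mul_top, Ideal.span_singleton_pow,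
    Ideal.mem_span_singleton] at h1
  exact h1

theorem isHausdorff_completion :
    IsHausdorff (Ideal.span {(p : AdicCompletion (Ideal.span {(p : A)}) A)})
      (AdicCompletion (Ideal.span {(p : A)}) A) :=
  (isAdicComplete_completion p A).toIsHausdorff

/-- The completion of a domain has no `p`-torsion. -/
theorem eq_zero_of_p_pow_mul_eq_zero [IsDomain A] (hp : (p : A) ≠ 0) (k : ℕ)
    {x : AdicCompletion (Ideal.span {(p : A)}) A}
    (hx : (p : AdicCompletion (Ideal.span {(p : A)}) A) ^ k * x = 0) : x = 0 := by
  refine isHausdorff_span_singleton_iff.1 (isHausdorff_completion (p := p) (A := A)) x fun n => ?_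
  obtain ⟨a, y, rfl⟩ := exists_eq_algebraMap_add n x
  have h1 : algebraMap A (AdicCompletion (Ideal.span {(p : A)}) A) ((p : A) ^ k * a) =
      (p : AdicCompletion (Ideal.span {(p : A)}) A) ^ (k + n) * (-y) := by
    rw [map_mul, map_pow, map_natCast]
    linear_combination hx
  have h2 := dvd_of_algebraMap_eq h1
  rw [pow_add] at h2
  obtain ⟨b, rfl⟩ := (mul_dvd_mul_iff_left (pow_ne_zero k hp)).1 h2
  refine ⟨algebraMap _ _ b + y, ?_⟩
  rw [map_mul, map_pow, map_natCast, smul_eq_mul, mul_add]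

theorem eq_zero_of_algebraMap_mul_eq_zero [IsDomain A] (hp : (p : A) ≠ 0) {c : A} {k : ℕ}
    (hc : c ∣ (p : A) ^ k) {x : AdicCompletion (Ideal.span {(p : A)}) A}
    (hx : algebraMap A _ c * x = 0) : x = 0 := by
  obtain ⟨d, hd⟩ := hc
  apply eq_zero_of_p_pow_mul_eq_zero hp k
  have : (p : AdicCompletion (Ideal.span {(p : A)}) A) ^ k = algebraMap A _ ((p : A) ^ k) := by
    rw [map_pow, map_natCast]
  rw [this, hd, map_mul, mul_comm (algebraMap A _ c), mul_assoc, hx, mul_zero]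

theorem completionMap_algebraMap (B : Type u) [CommRing B] [Algebra A B] (a : A) :
    completionMap p A B (algebraMap A _ a) = algebraMap B _ (algebraMap A B a) := by
  have := isAdicComplete_completion p B
  apply AdicCompletion.ext_evalₐ
  intro n
  rw [completionMap]
  generalize_proofs
  rename_i h
  rw [AdicCompletion.evalₐ_liftRingHom _ _ (fun hle => h hle)]
  simp

end Completion

namespace Setting
variable {p : ℕ} [Fact p.Prime] (S : Setting.{u} p)

instance : IsDomain S.OKbar := inferInstance
instance : Algebra.IsAlgebraic S.K S.Kbar := IsAlgClosure.isAlgebraic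

instance : ValuationRing S.OKbar :=
  ValuationRing.iff_dvd_total.2 ⟨integralClosure_dvd_total S.𝒪K S.K S.Kbar⟩

/-- `O_K̄` is a valuation ring of rank one. -/
theorem exists_dvd_pow (a c : S.OKbar) (ha : a ≠ 0) (hc : ¬ IsUnit c) : ∃ N, a ∣ c ^ N :=
  integralClosure_exists_dvd_pow S.𝒪K S.K S.Kbar a c ha hc

theorem p_ne_zero : (p : S.OKbar) ≠ 0 := by
  have h : (p : S.OKbar) = algebraMap S.𝒪K S.OKbar p := by simp
  rw [h, Ne, ← map_zero (algebraMap S.𝒪K S.OKbar), S.injective_OKbar.eq_iff]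
  exact Nat.cast_ne_zero.2 (Fact.out : p.Prime).ne_zero

instance : IsAdicComplete (Ideal.span {(p : S.R1hat)}) S.R1hat :=
  isAdicComplete_completion p S.R1

theorem algebraMap_OC_R1hat (a : S.OKbar) :
    algebraMap S.OC S.R1hat (algebraMap S.OKbar S.OC a) =
      algebraMap S.R1 S.R1hat (algebraMap S.OKbar S.R1 a) :=
  completionMap_algebraMap S.R1 a

theorem finiteType_R : Algebra.FiniteType S.𝒪K S.R := by
  let _ := (chartHom S.γ S.γ_l).toRingHom.toAlgebra
  have h1 : Algebra.Etale (ChartRing S.𝒪K S.P S.ϖ S.l) S.R := S.etale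
  have : IsScalarTower S.𝒪K (ChartRing S.𝒪K S.P S.ϖ S.l) S.R :=
    IsScalarTower.of_algebraMap_eq fun x => ((chartHom S.γ S.γ_l).commutes x).symm
  have : AddMonoid.FG S.P := S.isToricMonoidP.fg
  have h2 : Algebra.FiniteType S.𝒪K (AddMonoidAlgebra S.𝒪K S.P) := inferInstance
  have h3 : Algebra.FiniteType S.𝒪K (ChartRing S.𝒪K S.P S.ϖ S.l) := inferInstance
  have h4 : Algebra.FiniteType (ChartRing S.𝒪K S.P S.ϖ S.l) S.R := inferInstance
  exact Algebra.FiniteType.trans h3 h4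

theorem finiteType_R1 : Algebra.FiniteType S.OKbar S.R1 := by
  obtain ⟨s, hs⟩ := S.finiteType_R
  rw [← Subalgebra.fg_iff_finiteType]
  classical
  refine ⟨s.image (algebraMap S.R S.Fa), ?_⟩
  apply le_antisymm
  · apply Algebra.adjoin_mono
    intro x hx
    obtain ⟨y, -, rfl⟩ := Finset.mem_image.1 hx
    exact ⟨y, rfl⟩
  · rw [R1, Algebra.adjoin_le_iff]
    rintro _ ⟨r, rfl⟩
    have hr : r ∈ Algebra.adjoin S.𝒪K (s : Set S.R) := hs ▸ Algebra.mem_top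
    induction hr using Algebra.adjoin_induction with
    | mem x hx => exact Algebra.subset_adjoin (Finset.mem_image_of_mem _ hx)
    | algebraMap x =>
      have : algebraMap S.R S.Fa (algebraMap S.𝒪K S.R x) =
          algebraMap S.OKbar S.Fa (algebraMap S.𝒪K S.OKbar x) := by
        rw [← IsScalarTower.algebraMap_apply, IsScalarTower.algebraMap_apply S.𝒪K S.Kbar S.Fa]
        rfl
      rw [this]
      exact Subalgebra.algebraMap_mem _ _
    | add x y _ _ hx hy => rw [map_add]; exact add_mem hx hy
    | mul x y _ _ hx hy => rw [map_mul]; exact mul_mem hx hy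

theorem dvd_p_pow {c : S.OKbar} (hc : c ≠ 0) : ∃ k, c ∣ (p : S.OKbar) ^ k :=
  S.exists_dvd_pow c p hc S.not_isUnit_p_OKbar

/-- `O_C` is torsion-free over `O_K̄`. -/
theorem eq_zero_of_algebraMap_OC_mul {c : S.OKbar} (hc : c ≠ 0) {x : S.OC}
    (h : algebraMap S.OKbar S.OC c * x = 0) : x = 0 := by
  obtain ⟨k, hk⟩ := S.dvd_p_pow hc
  exact eq_zero_of_algebraMap_mul_eq_zero S.p_ne_zero hk h

theorem exists_eq_algebraMap_OC_add (k : ℕ) (x : S.OC) :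
    ∃ (a : S.OKbar) (y : S.OC), x = algebraMap S.OKbar S.OC a + (p : S.OC) ^ k * y :=
  exists_eq_algebraMap_add k x

theorem algebraMap_OC_injective : Function.Injective (algebraMap S.OKbar S.OC) := by
  rw [injective_iff_map_eq_zero]
  intro a ha
  by_contra h
  have : (1 : S.OC) = 0 := S.eq_zero_of_algebraMap_OC_mul h (by rw [ha, zero_mul])
  have h0 : IsUnit (p : S.OC) := by
    rw [← mul_one (p : S.OC), this, mul_zero, ← this]
    exact isUnit_one
  exact (Fact.out : ¬ IsUnit (p : S.OC)) h0

instance : Nontrivial S.OC := S.algebraMap_OC_injective.nontrivial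

/-- Every nonzero element of `O_C` is the product of an element of `O_K̄` and a unit. -/
theorem exists_eq_algebraMap_OC_mul_unit {x : S.OC} (hx : x ≠ 0) :
    ∃ (c : S.OKbar) (u : S.OCˣ), c ≠ 0 ∧ x = algebraMap S.OKbar S.OC c * u := by
  have hH : IsHausdorff (Ideal.span {(p : S.OC)}) S.OC := inferInstance
  rw [isHausdorff_span_singleton_iff] at hH
  obtain ⟨k, hk⟩ : ∃ k, ¬ ∃ z, x = (p : S.OC) ^ k • z := by
    by_contra! h
    exact hx (hH x h)
  obtain ⟨c, y, rfl⟩ := S.exists_eq_algebraMap_OC_add k x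
  have hpk : (p : S.OC) ^ k = algebraMap S.OKbar S.OC ((p : S.OKbar) ^ k) := by
    rw [map_pow, map_natCast]
  have hc : ¬ (p : S.OKbar) ^ k ∣ c := by
    rintro ⟨d, rfl⟩
    exact hk ⟨algebraMap _ _ d + y, by rw [map_mul, ← hpk, smul_eq_mul, mul_add]⟩
  obtain ⟨e, he⟩ := (ValuationRing.dvd_total ((p : S.OKbar) ^ k) c).resolve_left hc
  have hc0 : c ≠ 0 := by rintro rfl; exact hc (dvd_zero _)
  have heu : ¬ IsUnit e := by
    intro h
    obtain ⟨f, hf⟩ := h.exists_right_inv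
    exact hc ⟨f, by rw [he, mul_assoc, hf, mul_one]⟩
  obtain ⟨N, hN⟩ := S.exists_dvd_pow p e S.p_ne_zero heu
  have hunit : IsUnit (1 + algebraMap S.OKbar S.OC e * y) := by
    apply isUnit_of_isUnit_mk (I := Ideal.span {(p : S.OC)})
    rw [map_add, map_one]
    apply IsNilpotent.isUnit_one_add
    refine ⟨N, ?_⟩
    rw [← map_pow, Ideal.Quotient.eq_zero_iff_mem, Ideal.mem_span_singleton, mul_pow]
    apply Dvd.dvd.mul_right
    have := map_dvd (algebraMap S.OKbar S.OC) hN
    rwa [map_natCast, map_pow] at this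
  refine ⟨c, hunit.unit, hc0, ?_⟩
  rw [hpk, he, map_mul, IsUnit.unit_spec]
  ring

instance : IsDomain S.OC :=
  have : NoZeroDivisors S.OC := ⟨by
    intro a b hab
    by_contra! h
    obtain ⟨c, u, hc, rfl⟩ := S.exists_eq_algebraMap_OC_mul_unit h.1
    rw [mul_assoc] at hab
    have := S.eq_zero_of_algebraMap_OC_mul hc hab
    exact h.2 ((Units.mul_right_eq_zero u).1 this)⟩
  NoZeroDivisors.to_isDomain _

instance : ValuationRing S.OC := ValuationRing.iff_dvd_total.2 ⟨fun a b => by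
  by_cases ha : a = 0
  · exact Or.inr (ha ▸ dvd_zero _)
  by_cases hb : b = 0
  · exact Or.inl (hb ▸ dvd_zero _)
  obtain ⟨c, u, hc, rfl⟩ := S.exists_eq_algebraMap_OC_mul_unit ha
  obtain ⟨d, v, hd, rfl⟩ := S.exists_eq_algebraMap_OC_mul_unit hb
  rw [Units.mul_right_dvd, Units.dvd_mul_right, Units.mul_right_dvd, Units.dvd_mul_right]
  exact (ValuationRing.dvd_total c d).imp (map_dvd _) (map_dvd _)⟩

instance : Algebra S.OKbar S.R1hat :=
  ((algebraMap S.OC S.R1hat).comp (algebraMap S.OKbar S.OC)).toAlgebra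

theorem algebraMap_OKbar_R1hat (a : S.OKbar) : algebraMap S.OKbar S.R1hat a =
    algebraMap S.R1 S.R1hat (algebraMap S.OKbar S.R1 a) := S.algebraMap_OC_R1hat a

theorem p_ne_zero_R1 : (p : S.R1) ≠ 0 := by
  intro h
  have h1 : algebraMap S.Kbar S.Fa (algebraMap S.OKbar S.Kbar p) = 0 := by
    simpa using congrArg (fun x : S.R1 => (x : S.Fa)) h
  rw [map_eq_zero] at h1
  exact S.p_ne_zero (Subtype.ext h1)

theorem eq_zero_of_algebraMap_R1hat_mul {c : S.OKbar} (hc : c ≠ 0) {x : S.R1hat}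
    (h : algebraMap S.OKbar S.R1hat c * x = 0) : x = 0 := by
  obtain ⟨k, hk⟩ := S.dvd_p_pow hc
  rw [algebraMap_OKbar_R1hat] at h
  refine eq_zero_of_algebraMap_mul_eq_zero S.p_ne_zero_R1 (k := k) ?_ h
  have := map_dvd (algebraMap S.OKbar S.R1) hk
  rwa [map_pow, map_natCast] at this

/-- `R̂_1` is topologically of finite type over `O_K̄`. -/
theorem exists_eq_aeval_add : ∃ (n : ℕ) (x : Fin n → S.R1hat), ∀ (k : ℕ) (a : S.R1hat),
    ∃ F s, a = MvPolynomial.aeval (R := S.OKbar) x F + (p : S.R1hat) ^ k * s := by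
  obtain ⟨n, f, hf⟩ := Algebra.FiniteType.iff_quotient_mvPolynomial''.1 S.finiteType_R1
  refine ⟨n, fun i => algebraMap S.R1 S.R1hat (f (MvPolynomial.X i)), fun k a => ?_⟩
  obtain ⟨b, y, rfl⟩ : ∃ (b : S.R1) (y : S.R1hat), a = algebraMap S.R1 S.R1hat b + p ^ k * y :=
    exists_eq_algebraMap_add k a
  obtain ⟨F, rfl⟩ := hf b
  refine ⟨F, y, ?_⟩
  congr 1
  let g : S.R1 →ₐ[S.OKbar] S.R1hat :=
    { algebraMap S.R1 S.R1hat with commutes' := fun r => (S.algebraMap_OKbar_R1hat r).symm }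
  have : g.comp f = MvPolynomial.aeval fun i => algebraMap S.R1 S.R1hat (f (MvPolynomial.X i)) := by
    apply MvPolynomial.algHom_ext
    intro i
    rw [MvPolynomial.aeval_X]
    rfl
  exact DFunLike.congr_fun this F

section Module
variable {M : Type u} [AddCommGroup M] [Module S.R1hat M]

/-- Flatness over the valuation ring `O_C` is the absence of `O_K̄`-torsion. -/
theorem isOCFlat_iff : S.IsOCFlat M ↔
    ∀ (c : S.OKbar) (m : M), c ≠ 0 → algebraMap S.OKbar S.R1hat c • m = 0 → m = 0 := by
  let _ : Module S.OC M := Module.compHom M (algebraMap S.OC S.R1hat)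
  have hsm (x : S.OC) (m : M) : x • m = algebraMap S.OC S.R1hat x • m := rfl
  change Module.Flat S.OC M ↔ _
  rw [Module.Flat.flat_iff_torsion_eq_bot_of_isBezout, eq_bot_iff]
  constructor
  · intro h c m hc hm
    refine h (Submodule.mem_torsion_iff _ |>.2 ⟨⟨algebraMap S.OKbar S.OC c, ?_⟩, hm⟩)
    rw [mem_nonZeroDivisors_iff_ne_zero, Ne, ← map_zero (algebraMap S.OKbar S.OC),
      S.algebraMap_OC_injective.eq_iff]
    exact hc
  · intro h m hm
    obtain ⟨⟨x, hx⟩, hxm⟩ := (Submodule.mem_torsion_iff m).1 hm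
    obtain ⟨c, u, hc, rfl⟩ :=
      S.exists_eq_algebraMap_OC_mul_unit (nonZeroDivisors.ne_zero hx)
    replace hxm : (algebraMap S.OKbar S.OC c * u) • m = 0 := hxm
    rw [mul_smul] at hxm
    have := h c _ hc hxm
    rw [Submodule.mem_bot, ← one_smul S.OC m, ← u.inv_mul, mul_smul, this, smul_zero]

/-- A finitely generated `O_C`-flat `R̂_1`-module is `p`-adically complete and separated. -/
theorem isAdicComplete_of_isOCFlat [Module.Finite S.R1hat M] (hM : S.IsOCFlat M) :
    IsAdicComplete (Ideal.span {(p : S.R1hat)}) M := by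
  obtain ⟨n, x, hx⟩ := S.exists_eq_aeval_add
  have h1 := isHausdorff_of_finite_of_torsionFree p S.exists_dvd_pow S.p_ne_zero
    S.not_isUnit_p_OKbar (fun _ _ h h' => S.eq_zero_of_algebraMap_R1hat_mul h h') x hx M
    (S.isOCFlat_iff.1 hM)
  have h2 : IsPrecomplete (Ideal.span {(p : S.R1hat)}) M := isPrecomplete_of_finite
  exact { h1, h2 with }

theorem isOCFlat_of_free [Module.Free S.R1hat M] : S.IsOCFlat M := by
  rw [isOCFlat_iff]
  intro c m hc hm
  apply (Module.Free.chooseBasis S.R1hat M).repr.injective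
  ext i
  rw [map_zero, Finsupp.zero_apply]
  apply S.eq_zero_of_algebraMap_R1hat_mul hc
  rw [← smul_eq_mul, ← Finsupp.smul_apply, ← map_smul, hm, map_zero, Finsupp.zero_apply]

end Module

end Setting

/-! ### Limits and series for the `p`-adic topology -/

section PadicLimits

variable (p : ℕ) {M N : Type*} [AddCommGroup M] [AddCommGroup N]

/-- `x` is a multiple of `p^k`. -/
def PDvd (k : ℕ) (x : M) : Prop := ∃ z : M, x = p ^ k • z

/-- The sequence `f` tends to `s` for the `p`-adic topology. -/
def IsPadicLim (f : ℕ → M) (s : M) : Prop := ∀ k, ∃ n₀, ∀ n ≥ n₀, PDvd p k (f n - s)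

variable {p}

theorem PDvd.zero (k : ℕ) : PDvd p k (0 : M) := ⟨0, by simp⟩

theorem PDvd.add {k : ℕ} {x y : M} (hx : PDvd p k x) (hy : PDvd p k y) : PDvd p k (x + y) := by
  obtain ⟨a, rfl⟩ := hx; obtain ⟨b, rfl⟩ := hy
  exact ⟨a + b, by rw [smul_add]⟩

theorem PDvd.neg {k : ℕ} {x : M} (hx : PDvd p k x) : PDvd p k (-x) := by
  obtain ⟨a, rfl⟩ := hx
  exact ⟨-a, by rw [smul_neg]⟩

theorem PDvd.sub {k : ℕ} {x y : M} (hx : PDvd p k x) (hy : PDvd p k y) : PDvd p k (x - y) := by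
  rw [sub_eq_add_neg]; exact hx.add hy.neg

theorem PDvd.sum {k : ℕ} {ι : Type*} {s : Finset ι} {f : ι → M} (h : ∀ i ∈ s, PDvd p k (f i)) :
    PDvd p k (∑ i ∈ s, f i) :=
  Finset.sum_induction f _ (fun _ _ => PDvd.add) (PDvd.zero k) h

theorem PDvd.mono {k l : ℕ} (hkl : k ≤ l) {x : M} (hx : PDvd p l x) : PDvd p k x := by
  obtain ⟨a, rfl⟩ := hx
  obtain ⟨m, rfl⟩ := Nat.exists_eq_add_of_le hkl
  exact ⟨p ^ m • a, by rw [smul_smul, pow_add]⟩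

theorem PDvd.map {k : ℕ} {x : M} (hx : PDvd p k x) (f : M →+ N) : PDvd p k (f x) := by
  obtain ⟨a, rfl⟩ := hx
  exact ⟨f a, map_nsmul _ _ _⟩

theorem PDvd.smul {A : Type*} [CommRing A] [Module A M] {k : ℕ} {x : M} (hx : PDvd p k x) (a : A) :
    PDvd p k (a • x) := by
  obtain ⟨z, rfl⟩ := hx
  exact ⟨a • z, smul_comm _ _ _⟩

theorem PDvd.smul_left {A : Type*} [CommRing A] [Module A M] {k : ℕ} {a : A} (ha : PDvd p k a)
    (x : M) : PDvd p k (a • x) := by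
  obtain ⟨b, rfl⟩ := ha
  exact ⟨b • x, smul_assoc _ _ _⟩

theorem PDvd.mul_left {E : Type*} [Ring E] {k : ℕ} {x : E} (hx : PDvd p k x) (a : E) :
    PDvd p k (a * x) := hx.map (AddMonoidHom.mulLeft a)

theorem PDvd.mul_right {E : Type*} [Ring E] {k : ℕ} {x : E} (hx : PDvd p k x) (a : E) :
    PDvd p k (x * a) := hx.map (AddMonoidHom.mulRight a)

theorem isPadicSum_iff {A : Type u} [CommRing A] {M : Type u} [AddCommGroup M] [Module A M]
    {y : ℕ → M} {s : M} :
    IsPadicSum p y s ↔ IsPadicLim p (fun n => ∑ i ∈ Finset.range n, y i) s := Iff.rfl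

theorem IsPadicLim.congr {f g : ℕ → M} {s : M} (hf : IsPadicLim p f s)
    (h : ∀ k, ∃ n₀, ∀ n ≥ n₀, PDvd p k (g n - f n)) : IsPadicLim p g s := by
  intro k
  obtain ⟨n₀, h0⟩ := hf k
  obtain ⟨n₁, h1⟩ := h k
  refine ⟨max n₀ n₁, fun n hn => ?_⟩
  have := (h1 n (le_of_max_le_right hn)).add (h0 n (le_of_max_le_left hn))
  rwa [sub_add_sub_cancel] at this

theorem IsPadicLim.comp {f : ℕ → M} {s : M} (hf : IsPadicLim p f s) {g : ℕ → ℕ}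
    (hg : ∀ n, n ≤ g n) : IsPadicLim p (fun n => f (g n)) s := fun k => by
  obtain ⟨n₀, h0⟩ := hf k
  exact ⟨n₀, fun n hn => h0 _ (hn.trans (hg n))⟩

theorem IsPadicLim.add {f g : ℕ → M} {s t : M} (hf : IsPadicLim p f s) (hg : IsPadicLim p g t) :
    IsPadicLim p (fun n => f n + g n) (s + t) := fun k => by
  obtain ⟨n₀, h0⟩ := hf k
  obtain ⟨n₁, h1⟩ := hg k
  refine ⟨max n₀ n₁, fun n hn => ?_⟩
  rw [add_sub_add_comm]
  exact (h0 n (le_of_max_le_left hn)).add (h1 n (le_of_max_le_right hn))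

theorem IsPadicLim.map {f : ℕ → M} {s : M} (hf : IsPadicLim p f s) (φ : M →+ N) :
    IsPadicLim p (fun n => φ (f n)) (φ s) := fun k => by
  obtain ⟨n₀, h0⟩ := hf k
  exact ⟨n₀, fun n hn => by rw [← map_sub]; exact (h0 n hn).map φ⟩

theorem IsPadicLim.mul {E : Type*} [Ring E] {f g : ℕ → E} {s t : E} (hf : IsPadicLim p f s)
    (hg : IsPadicLim p g t) : IsPadicLim p (fun n => f n * g n) (s * t) := fun k => by
  obtain ⟨n₀, h0⟩ := hf k
  obtain ⟨n₁, h1⟩ := hg k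
  refine ⟨max n₀ n₁, fun n hn => ?_⟩
  have h := ((h0 n (le_of_max_le_left hn)).mul_right (g n)).add
    ((h1 n (le_of_max_le_right hn)).mul_left s)
  rwa [sub_mul, mul_sub, sub_add_sub_cancel] at h

theorem IsPadicLim.const (s : M) : IsPadicLim p (fun _ => s) s := fun k =>
  ⟨0, fun n _ => by rw [sub_self]; exact PDvd.zero k⟩

theorem IsPadicLim.pDvd {f : ℕ → M} {s : M} (hf : IsPadicLim p f s) {k : ℕ} {n₁ : ℕ}
    (h : ∀ n ≥ n₁, PDvd p k (f n)) : PDvd p k s := by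
  obtain ⟨n₀, h0⟩ := hf k
  have := (h _ (le_max_right n₀ n₁)).sub (h0 _ (le_max_left n₀ n₁))
  rwa [sub_sub_cancel] at this

variable {A : Type*} [CommRing A] [Module A M]

theorem pDvd_iff_exists_smul {k : ℕ} {x : M} : PDvd p k x ↔ ∃ z, x = (p : A) ^ k • z := by
  simp only [PDvd, ← Nat.cast_pow, Nat.cast_smul_eq_nsmul]

variable (A) in
theorem eq_zero_of_forall_pDvd [h : IsHausdorff (Ideal.span {(p : A)}) M] {x : M}
    (hx : ∀ k, PDvd p k x) : x = 0 :=
  isHausdorff_span_singleton_iff.1 h x fun n => pDvd_iff_exists_smul.1 (hx n)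

variable (A) in
theorem IsPadicLim.unique [IsHausdorff (Ideal.span {(p : A)}) M] {f : ℕ → M} {s t : M}
    (hs : IsPadicLim p f s) (ht : IsPadicLim p f t) : s = t := by
  rw [← sub_eq_zero]
  refine eq_zero_of_forall_pDvd A (p := p) (M := M) fun k => ?_
  obtain ⟨n₀, h0⟩ := hs k
  obtain ⟨n₁, h1⟩ := ht k
  have := (h1 _ (le_max_right n₀ n₁)).sub (h0 _ (le_max_left n₀ n₁))
  rwa [sub_sub_sub_cancel_left] at this

variable (A) in
/-- A series whose general term tends to zero converges. -/
theorem exists_isPadicLim_sum [h : IsPrecomplete (Ideal.span {(p : A)}) M] {y : ℕ → M}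
    (hy : ∀ k, ∃ n₀, ∀ n ≥ n₀, PDvd p k (y n)) :
    ∃ s, IsPadicLim p (fun n => ∑ i ∈ Finset.range n, y i) s := by
  choose n₀ hn₀ using hy
  let m : ℕ → ℕ := fun k => ∑ i ∈ Finset.range (k + 1), n₀ i
  have hm : ∀ k, n₀ k ≤ m k := fun k =>
    Finset.single_le_sum (f := n₀) (fun _ _ => Nat.zero_le _) (Finset.self_mem_range_succ k)
  have hmono : Monotone m := fun a c hac =>
    Finset.sum_le_sum_of_subset (Finset.range_mono (Nat.succ_le_succ hac))
  have hdiff (k a c : ℕ) (ha : m k ≤ a) (hac : a ≤ c) :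
      PDvd p k (∑ i ∈ Finset.range c, y i - ∑ i ∈ Finset.range a, y i) := by
    rw [← Finset.sum_Ico_eq_sub _ hac]
    exact PDvd.sum fun i hi => hn₀ k i ((hm k).trans (ha.trans (Finset.mem_Ico.1 hi).1))
  rw [isPrecomplete_iff] at h
  simp only [smodEq_span_singleton_pow, ← pDvd_iff_exists_smul] at h
  obtain ⟨L, hL⟩ := h (fun k => ∑ i ∈ Finset.range (m k), y i) (fun {a c} hac => by
    rw [← neg_sub]
    exact (hdiff a _ _ le_rfl (hmono hac)).neg)
  refine ⟨L, fun k => ⟨m k, fun n hn => ?_⟩⟩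
  have := (hdiff k _ _ le_rfl hn).add (hL k)
  rwa [sub_add_sub_cancel] at this

end PadicLimits

/-! ### The ring of endomorphisms of a complete module -/

/-- The endomorphisms of a complete module form a complete module. -/
theorem isAdicComplete_end {A M : Type*} [CommRing A] [AddCommGroup M] [Module A M] (c : A)
    [hM : IsAdicComplete (Ideal.span {c}) M] :
    IsAdicComplete (Ideal.span {c}) (Module.End A M) := by
  have hH : IsHausdorff (Ideal.span {c}) M := inferInstance
  have hP : IsPrecomplete (Ideal.span {c}) M := inferInstance
  rw [isHausdorff_span_singleton_iff] at hH
  rw [isPrecomplete_span_singleton_iff] at hP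
  have h1 : IsHausdorff (Ideal.span {c}) (Module.End A M) := by
    rw [isHausdorff_span_singleton_iff]
    intro f hf
    ext x
    refine hH _ fun n => ?_
    obtain ⟨z, rfl⟩ := hf n
    exact ⟨z x, rfl⟩
  -- the operator `z ↦ ∑ c^i z_i`
  choose T hT using hP
  have huniq (z : ℕ → M) (L : M)
      (hL : ∀ n, ∃ y, ∑ i ∈ Finset.range n, c ^ i • z i - L = c ^ n • y) : T z = L := by
    rw [← sub_eq_zero]
    refine hH _ fun n => ?_
    obtain ⟨y, hy⟩ := hL n
    obtain ⟨y', hy'⟩ := hT z n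
    exact ⟨y - y', by rw [smul_sub, ← hy, ← hy', sub_sub_sub_cancel_left]⟩
  have hadd (z z' : ℕ → M) : T (z + z') = T z + T z' := by
    refine huniq _ _ fun n => ?_
    obtain ⟨y, hy⟩ := hT z n
    obtain ⟨y', hy'⟩ := hT z' n
    refine ⟨y + y', ?_⟩
    rw [smul_add, ← hy, ← hy', ← add_sub_add_comm, ← Finset.sum_add_distrib]
    simp
  have hsmul (a : A) (z : ℕ → M) : T (a • z) = a • T z := by
    refine huniq _ _ fun n => ?_
    obtain ⟨y, hy⟩ := hT z n
    refine ⟨a • y, ?_⟩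
    rw [smul_comm, ← hy, smul_sub, Finset.smul_sum]
    congr 1
    exact Finset.sum_congr rfl fun i _ => smul_comm _ _ _
  have hshift (n : ℕ) (z : ℕ → M) :
      T z = ∑ i ∈ Finset.range n, c ^ i • z i + c ^ n • T (fun i => z (n + i)) := by
    refine huniq _ _ fun m => ?_
    obtain ⟨y, hy⟩ := hT z m
    obtain ⟨y', hy'⟩ := hT (fun i => z (n + i)) m
    have h2 : ∑ i ∈ Finset.range (n + m), c ^ i • z i = ∑ i ∈ Finset.range n, c ^ i • z i +
        c ^ n • ∑ i ∈ Finset.range m, c ^ i • z (n + i) := by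
      rw [Finset.sum_range_add, Finset.smul_sum]
      simp only [smul_smul, pow_add]
    have h3 : ∑ i ∈ Finset.range (n + m), c ^ i • z i = ∑ i ∈ Finset.range m, c ^ i • z i +
        c ^ m • ∑ i ∈ Finset.range n, c ^ i • z (m + i) := by
      rw [add_comm n m, Finset.sum_range_add, Finset.smul_sum]
      simp only [smul_smul, pow_add]
    refine ⟨c ^ n • y' - ∑ i ∈ Finset.range n, c ^ i • z (m + i), ?_⟩
    rw [smul_sub, smul_comm, ← hy', smul_sub, ← sub_eq_zero]
    have h4 := h2.symm.trans h3
    rw [← sub_eq_zero] at h4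
    rw [← neg_eq_zero, ← h4]
    abel
  have h2 : IsPrecomplete (Ideal.span {c}) (Module.End A M) := by
    rw [isPrecomplete_span_singleton_iff]
    intro z
    let L : (ℕ → Module.End A M) → Module.End A M := fun z =>
      { toFun := fun x => T (fun i => z i x)
        map_add' := fun x x' => by
          rw [← hadd]; congr 1; ext i; simp
        map_smul' := fun a x => by
          rw [RingHom.id_apply, ← hsmul]; congr 1; ext i; simp }
    refine ⟨L z, fun n => ⟨-L (fun i => z (n + i)), ?_⟩⟩
    ext x
    have := hshift n (fun i => z i x)
    change (∑ i ∈ Finset.range n, c ^ i • z i : Module.End A M) x - T (fun i => z i x) = _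
    rw [this, LinearMap.sum_apply]
    change _ = c ^ n • -(T fun i => z (n + i) x)
    simp
  exact { h1, h2 with }


/-! ### Exponential and logarithm in `p`-adically complete algebras -/

theorem IsPadicLim.smul {p : ℕ} {A M : Type*} [AddCommGroup M] [Monoid A] [DistribMulAction A M]
    {f : ℕ → M} {s : M} (hf : IsPadicLim p f s) (a : A) : IsPadicLim p (fun n => a • f n) (a • s) :=
  hf.map (DistribSMul.toAddMonoidHom M a)

theorem pow_dvd_choose_prime_pow {p : ℕ} [hp : Fact p.Prime] (k i m : ℕ) (hm : k + i ≤ m) :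
    p ^ k ∣ (p ^ m).choose (i + 1) := by
  have hpm : 0 < p ^ m := pow_pos hp.out.pos m
  rcases Nat.eq_zero_or_pos ((p ^ m).choose (i + 1)) with h0 | h0
  · rw [h0]; exact dvd_zero _
  have h1 : (p ^ m).choose (i + 1) * (i + 1) = p ^ m * (p ^ m - 1).choose i := by
    have := Nat.add_one_mul_choose_eq (p ^ m - 1) i
    rw [Nat.sub_add_cancel hpm] at this
    exact this.symm
  have h2 : p ^ m ∣ (p ^ m).choose (i + 1) * (i + 1) := ⟨_, h1⟩
  rw [padicValNat_dvd_iff_le (Nat.mul_pos h0 i.succ_pos).ne',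
    padicValNat.mul h0.ne' i.succ_ne_zero] at h2
  rw [padicValNat_dvd_iff_le h0.ne']
  change m ≤ _ + padicValNat p (i + 1) at h2
  have h3 : padicValNat p (i + 1) ≤ i := by
    have h4 : p ^ padicValNat p (i + 1) ≤ i + 1 := Nat.le_of_dvd i.succ_pos pow_padicValNat_dvd
    have h5 : padicValNat p (i + 1) < p ^ padicValNat p (i + 1) :=
      Nat.lt_pow_self hp.out.one_lt
    omega
  omega

/-- `C(p^m - 1, i)` tends to `(-1)^i` as `m` tends to infinity. -/
theorem pow_dvd_choose_pred_sub {p : ℕ} [hp : Fact p.Prime] (k i m : ℕ) (hm : k + i ≤ m) :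
    (p : ℤ) ^ k ∣ ((p ^ m - 1).choose i : ℤ) - (-1) ^ i := by
  induction i with
  | zero => simp
  | succ i ih =>
    have h1 := ih (by omega)
    have h2 : (p : ℤ) ^ k ∣ ((p ^ m).choose (i + 1) : ℤ) := by
      exact_mod_cast pow_dvd_choose_prime_pow k i m (by omega)
    have h3 : (p ^ m).choose (i + 1) = (p ^ m - 1).choose i + (p ^ m - 1).choose (i + 1) := by
      conv_lhs => rw [← Nat.sub_add_cancel (pow_pos hp.out.pos m : 0 < p ^ m)]
      exact Nat.choose_succ_succ _ _
    rw [h3, Nat.cast_add] at h2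
    have := dvd_sub h2 h1
    rw [pow_succ]
    have h4 : ((p ^ m - 1).choose (i + 1) : ℤ) - (-1) ^ i * -1 =
        ((p ^ m - 1).choose i : ℤ) + ((p ^ m - 1).choose (i + 1) : ℤ) -
          (((p ^ m - 1).choose i : ℤ) - (-1) ^ i) := by ring
    rwa [h4]

/-- Data expressing that `q = bτ` has valuation `> 1/(p-1)`: the numbers `τ^n / (n+1)!` are
integral (they are the `d n`), and `b` is topologically nilpotent, `b^N` being a multiple of `p`. -/
structure ExpDatum (p : ℕ) (A : Type*) [CommRing A] where
  b : A
  τ : A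
  d : ℕ → A
  factorial_mul_d : ∀ n, ((n + 1).factorial : A) * d n = τ ^ n
  N : ℕ
  dvd : (p : A) ∣ b ^ N

namespace ExpDatum

variable {p : ℕ} {A : Type*} [CommRing A] (D : ExpDatum p A)

/-- The element `q = bτ`. -/
def q : A := D.b * D.τ

/-- `q^n / n!` -/
def e : ℕ → A
  | 0 => 1
  | n + 1 => D.q * (D.b ^ n * D.d n)

/-- `q^(n+1) / (n+1)` -/
def l (n : ℕ) : A := D.q * (D.b ^ n * (n.factorial * D.d n))

theorem factorial_mul_e (n : ℕ) : (n.factorial : A) * D.e n = D.q ^ n := by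
  cases n with
  | zero => simp [e]
  | succ n =>
    have := D.factorial_mul_d n
    rw [e, pow_succ]
    have h2 : D.q ^ n = D.b ^ n * D.τ ^ n := by rw [q, mul_pow]
    rw [h2, ← this]
    ring

theorem succ_mul_l (n : ℕ) : ((n + 1 : ℕ) : A) * D.l n = D.q ^ (n + 1) := by
  rw [← factorial_mul_e, l, e, Nat.factorial_succ, Nat.cast_mul]
  ring

theorem pDvd_b_pow (k n : ℕ) (hn : k * D.N ≤ n) : PDvd p k (D.b ^ n) := by
  obtain ⟨c, hc⟩ := D.dvd
  obtain ⟨m, rfl⟩ := Nat.exists_eq_add_of_le hn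
  refine ⟨c ^ k * D.b ^ m, ?_⟩
  rw [pow_add, mul_comm k, pow_mul, hc, mul_pow, nsmul_eq_mul, Nat.cast_pow, mul_assoc]

theorem pDvd_e (k n : ℕ) (hn : k * D.N + 1 ≤ n) : PDvd p k (D.e n) := by
  cases n with
  | zero => omega
  | succ n => exact ((D.pDvd_b_pow k n (by omega)).mul_right _).mul_left _

theorem pDvd_l (k n : ℕ) (hn : k * D.N ≤ n) : PDvd p k (D.l n) :=
  ((D.pDvd_b_pow k n hn).mul_right _).mul_left _

theorem choose_mul_e (hA : ∀ (n : ℕ) (x : A), n ≠ 0 → (n : A) * x = 0 → x = 0) (i j : ℕ) :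
    ((i + j).choose i : A) * D.e (i + j) = D.e i * D.e j := by
  have h := D.factorial_mul_e (i + j)
  rw [pow_add, ← D.factorial_mul_e i, ← D.factorial_mul_e j,
    ← Nat.add_choose_mul_factorial_mul_factorial] at h
  rw [← sub_eq_zero]
  apply hA (i.factorial * j.factorial) _ (by positivity)
  push_cast at h ⊢
  rw [Nat.choose_symm_add]
  linear_combination h

variable {E : Type*} [Ring E] [Algebra A E]

/-- The partial sums of `exp (qw)`. -/
def expSum (w : E) (n : ℕ) : E := ∑ i ∈ Finset.range n, D.e i • w ^ i

/-- The partial sums of `log (1 + qw)`. -/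
def logSum (w : E) (n : ℕ) : E := ∑ i ∈ Finset.range n, ((-1 : ℤ) ^ i • D.l i) • w ^ (i + 1)

theorem exists_exp [IsPrecomplete (Ideal.span {(p : A)}) E] (w : E) :
    ∃ s, IsPadicLim p (D.expSum w) s :=
  exists_isPadicLim_sum A fun k => ⟨k * D.N + 1, fun n hn => (D.pDvd_e k n hn).smul_left _⟩

theorem exists_log [IsPrecomplete (Ideal.span {(p : A)}) E] (w : E) :
    ∃ s, IsPadicLim p (D.logSum w) s :=
  exists_isPadicLim_sum A fun k => ⟨k * D.N, fun n hn =>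
    ((D.pDvd_l k n hn).smul (A := ℤ) _).smul_left _⟩

variable [IsAdicComplete (Ideal.span {(p : A)}) E]

/-- `exp (qw)` -/
def exp (w : E) : E := (D.exists_exp w).choose

/-- `log (1 + qw)` -/
def log (w : E) : E := (D.exists_log w).choose

theorem exp_spec (w : E) : IsPadicLim p (D.expSum w) (D.exp w) := (D.exists_exp w).choose_spec

theorem log_spec (w : E) : IsPadicLim p (D.logSum w) (D.log w) := (D.exists_log w).choose_spec

include A in
theorem _root_.FaltingsHiggs.IsPadicLim.commute {f : ℕ → E} {s z : E} (hf : IsPadicLim p f s)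
    (h : ∀ n, Commute (f n) z) : Commute s z :=
  IsPadicLim.unique A (hf.mul (IsPadicLim.const z))
    (by simpa only [(h _).eq] using (IsPadicLim.const z).mul hf)

/-- `exp (qw) = 1 + qw'` with `w'` in the closed subring generated by `w`. -/
theorem exists_exp_eq (w : E) : ∃ w', D.exp w = 1 + D.q • w' ∧ ∀ z, Commute w z → Commute w' z := by
  obtain ⟨s, hs⟩ := exists_isPadicLim_sum A (p := p)
    (y := fun n => (D.b ^ n * D.d n) • w ^ (n + 1))
    fun k => ⟨k * D.N, fun n hn => ((D.pDvd_b_pow k n hn).mul_right _).smul_left _⟩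
  refine ⟨s, ?_, fun z hz => hs.commute (A := A) fun n => ?_⟩
  · have h1 := (D.exp_spec w).comp (g := fun n => n + 1) fun n => n.le_succ
    refine IsPadicLim.unique A h1 ?_
    have h2 := (IsPadicLim.const (p := p) (1 : E)).add
      (hs.smul D.q)
    convert h2 using 2 with n
    rw [expSum, Finset.sum_range_succ', add_comm]
    simp [e, Finset.smul_sum, mul_smul]
  · exact Commute.sum_left _ _ _ fun i _ => (hz.pow_left _).smul_left _

/-- `log (1 + qw) = qw'` with `w'` in the closed subring generated by `w`. -/
theorem exists_log_eq (w : E) : ∃ w', D.log w = D.q • w' ∧ ∀ z, Commute w z → Commute w' z := by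
  obtain ⟨s, hs⟩ := exists_isPadicLim_sum A (p := p)
    (y := fun n => ((-1 : ℤ) ^ n • (D.b ^ n * (n.factorial * D.d n))) • w ^ (n + 1))
    fun k => ⟨k * D.N, fun n hn =>
      (((D.pDvd_b_pow k n hn).mul_right _).smul (A := ℤ) _).smul_left _⟩
  refine ⟨s, ?_, fun z hz => hs.commute (A := A) fun n => ?_⟩
  · refine IsPadicLim.unique A (D.log_spec w) ?_
    have h2 := hs.smul D.q
    convert h2 using 2 with n
    rw [logSum]
    simp only [Finset.smul_sum]
    refine Finset.sum_congr rfl fun i _ => ?_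
    rw [smul_smul, l, mul_smul_comm]
  · exact Commute.sum_left _ _ _ fun i _ => (hz.pow_left _).smul_left _

theorem exp_zero : D.exp (0 : E) = 1 := by
  refine IsPadicLim.unique A (D.exp_spec 0) ((IsPadicLim.const (1 : E)).congr fun k =>
    ⟨1, fun n hn => ?_⟩)
  obtain ⟨m, rfl⟩ := Nat.exists_eq_add_of_le' hn
  rw [expSum, Finset.sum_range_succ']
  simpa [e] using PDvd.zero (p := p) (M := E) k

variable (hA : ∀ (n : ℕ) (x : A), n ≠ 0 → (n : A) * x = 0 → x = 0)
include hA

/-- The product of the partial sums differs from the partial sum of the product by terms `q^i w^i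
/ i! * q^j w'^j / j!` with `i` or `j` large. -/
theorem exp_add {w w' : E} (h : Commute w w') : D.exp (w + w') = D.exp w * D.exp w' := by
  refine IsPadicLim.unique A (D.exp_spec _)
    (((D.exp_spec w).mul (D.exp_spec w')).congr fun k => ⟨2 * (k * D.N + 1), fun n hn => ?_⟩)
  have h1 : D.expSum (w + w') n = ∑ x ∈ Finset.range n ×ˢ Finset.range n with x.1 + x.2 < n,
      D.e x.1 • w ^ x.1 * D.e x.2 • w' ^ x.2 := by
    have : ∀ x ∈ (Finset.range n ×ˢ Finset.range n).filter (fun x => x.1 + x.2 < n),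
        x.1 + x.2 ∈ Finset.range n := fun x hx => Finset.mem_range.2 (Finset.mem_filter.1 hx).2
    rw [expSum, ← Finset.sum_fiberwise_of_maps_to this]
    refine Finset.sum_congr rfl fun m hm => ?_
    rw [Finset.mem_range] at hm
    have h2 : ((Finset.range n ×ˢ Finset.range n).filter (fun x => x.1 + x.2 < n)).filter
        (fun x => x.1 + x.2 = m) = Finset.HasAntidiagonal.antidiagonal m := by
      ext x
      simp only [Finset.mem_filter, Finset.mem_product, Finset.mem_range,
        Finset.HasAntidiagonal.mem_antidiagonal]
      omega
    rw [h2, h.add_pow', Finset.smul_sum]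
    refine Finset.sum_congr rfl fun x hx => ?_
    rw [Finset.HasAntidiagonal.mem_antidiagonal] at hx
    subst hx
    rw [smul_mul_smul_comm, ← D.choose_mul_e hA, mul_comm, mul_smul, Nat.cast_smul_eq_nsmul]
  have h2 : D.expSum w n * D.expSum w' n = ∑ x ∈ Finset.range n ×ˢ Finset.range n,
      D.e x.1 • w ^ x.1 * D.e x.2 • w' ^ x.2 := by
    rw [expSum, expSum, Finset.sum_mul_sum, Finset.sum_product]
  rw [h1, h2, ← Finset.sum_filter_add_sum_filter_not (Finset.range n ×ˢ Finset.range n)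
    (fun x => x.1 + x.2 < n), sub_add_cancel_left]
  refine (PDvd.sum fun x hx => ?_).neg
  have hx := (Finset.mem_filter.1 hx).2
  rcases le_or_gt (k * D.N + 1) x.1 with h3 | h3
  · exact ((D.pDvd_e k _ h3).smul_left _).mul_right _
  · exact ((D.pDvd_e k _ (by omega)).smul_left _).mul_left _

theorem exp_nsmul (w : E) (n : ℕ) : D.exp (n • w) = D.exp w ^ n := by
  induction n with
  | zero => rw [zero_smul, D.exp_zero, pow_zero]
  | succ n ih =>
    rw [succ_nsmul, D.exp_add hA ((Commute.refl w).smul_left n), ih, pow_succ]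

variable [hp : Fact p.Prime]

omit hA [IsAdicComplete (Ideal.span {(p : A)}) E] in
/-- The quotient `(u^(p^m) - 1) / p^m`, for `u = 1 + qw`, exists, and it approaches the partial sums
of the logarithm of `u`. -/
theorem exists_seq (w : E) : ∃ Λ : ℕ → E, (∀ m, p ^ m • Λ m = (1 + D.q • w) ^ p ^ m - 1) ∧
    ∀ k, ∃ n₀, ∀ m ≥ n₀, PDvd p k (Λ m - D.logSum w (p ^ m)) := by
  refine ⟨fun m => ∑ i ∈ Finset.range (p ^ m), (((p ^ m - 1).choose i : ℤ) • D.l i) • w ^ (i + 1),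
    fun m => ?_, fun k => ?_⟩
  · rw [add_comm, (Commute.one_right _).add_pow, Finset.sum_range_succ', Finset.smul_sum]
    simp only [one_pow, mul_one, pow_zero, Nat.choose_zero_right, Nat.cast_one,
      add_sub_cancel_right]
    refine Finset.sum_congr rfl fun i _ => ?_
    have h1 : (p ^ m).choose (i + 1) * (i + 1) = p ^ m * (p ^ m - 1).choose i := by
      have := Nat.add_one_mul_choose_eq (p ^ m - 1) i
      rw [Nat.sub_add_cancel (pow_pos hp.out.pos m)] at this
      exact this.symm
    rw [smul_pow, ← D.succ_mul_l, ← Nat.cast_comm, ← nsmul_eq_mul, ← nsmul_eq_mul, natCast_zsmul,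
      ← smul_assoc, smul_smul, ← h1, mul_smul, smul_assoc]
  · refine ⟨k + k * D.N, fun m hm => ?_⟩
    rw [logSum, ← Finset.sum_sub_distrib]
    refine PDvd.sum fun i _ => ?_
    rw [← sub_smul, ← sub_smul]
    rcases le_or_gt (k * D.N) i with h | h
    · exact ((D.pDvd_l k i h).smul _).smul_left _
    · obtain ⟨z, hz⟩ := pow_dvd_choose_pred_sub (p := p) k i m (by omega)
      rw [hz]
      exact PDvd.smul_left ⟨z • D.l i, by
        rw [mul_smul, ← Nat.cast_pow, natCast_zsmul]⟩ _

variable (hE : ∀ (n : ℕ) (x : E), n ≠ 0 → n • x = 0 → x = 0)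
include hE

omit hA in
/-- `log u` is the limit of `(u^(p^m) - 1) / p^m`. -/
theorem isPadicLim_log {w : E} {Λ : ℕ → E} (hΛ : ∀ m, p ^ m • Λ m = (1 + D.q • w) ^ p ^ m - 1) :
    IsPadicLim p Λ (D.log w) := by
  obtain ⟨Λ', h1, h2⟩ := D.exists_seq w
  have : Λ = Λ' := by
    ext m
    rw [← sub_eq_zero]
    apply hE (p ^ m) _ (pow_pos hp.out.pos m).ne'
    rw [smul_sub, hΛ, h1, sub_self]
  subst this
  exact ((D.log_spec w).comp (g := fun m => p ^ m)
    fun m => (Nat.lt_pow_self hp.out.one_lt).le).congr h2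

omit hA in
/-- If `Λ` and `Λ'` are the quotients `(u^(p^m) - 1) / p^m` for `u` and `u'`, the quotient for `u
* u'` is `Λ + Λ' + p^m Λ Λ'`. -/
theorem log_mul {w w' w'' : E} (h : Commute w w')
    (hw : 1 + D.q • w'' = (1 + D.q • w) * (1 + D.q • w')) : D.log w'' = D.log w + D.log w' := by
  obtain ⟨Λ, h1, -⟩ := D.exists_seq w
  obtain ⟨Λ', h1', -⟩ := D.exists_seq w'
  obtain ⟨Λ'', h1'', -⟩ := D.exists_seq w''
  have hc : Commute (1 + D.q • w) (1 + D.q • w') :=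
    (Commute.one_left _).add_left (((Commute.one_right _).add_right (h.smul_right _)).smul_left _)
  refine IsPadicLim.unique A (D.isPadicLim_log hE h1'')
    (((D.isPadicLim_log hE h1).add (D.isPadicLim_log hE h1')).congr fun k => ⟨k, fun m hm => ?_⟩)
  refine PDvd.mono hm ⟨Λ m * Λ' m, ?_⟩
  rw [← sub_eq_zero]
  apply hE (p ^ m) _ (pow_pos hp.out.pos m).ne'
  have h3 : p ^ m • p ^ m • (Λ m * Λ' m) = (p ^ m • Λ m) * (p ^ m • Λ' m) := by
    rw [smul_mul_smul_comm, smul_smul]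
  rw [smul_sub, h3, smul_sub, smul_add, h1, h1', h1'', hw, hc.mul_pow]
  noncomm_ring

/-- The quotient `(exp(qw)^(p^m) - 1) / p^m` is `(exp(p^m qw) - 1) / p^m`, which tends to `qw`. -/
theorem log_exp {w w' : E} (h : D.exp w = 1 + D.q • w') : D.log w' = D.q • w := by
  obtain ⟨Λ, h1, -⟩ := D.exists_seq w'
  refine IsPadicLim.unique A (D.isPadicLim_log hE h1) ((IsPadicLim.const _).congr fun k =>
    ⟨k, fun m hm => PDvd.mono hm ?_⟩)
  -- `exp (p^m q w) = 1 + p^m q w + p^(2m) (…)`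
  obtain ⟨s, hs⟩ := exists_isPadicLim_sum A (p := p)
    (y := fun n => D.e (n + 2) • (p ^ m) ^ n • w ^ (n + 2))
    fun k => ⟨k * D.N + 1, fun n hn => (D.pDvd_e k _ (by omega)).smul_left _⟩
  have h2 : D.exp (p ^ m • w) = 1 + p ^ m • D.q • w + p ^ m • p ^ m • s := by
    refine IsPadicLim.unique A ((D.exp_spec _).comp (g := fun n => n + 2) fun n => by omega) ?_
    have h3 := (IsPadicLim.const (p := p) (1 + p ^ m • D.q • w : E)).add
      (hs.smul (p ^ m * p ^ m))
    rw [mul_smul (p ^ m) (p ^ m) s] at h3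
    convert h3 using 2 with n
    rw [expSum, Finset.sum_range_succ', Finset.sum_range_succ', add_comm, add_comm (Finset.sum _ _)]
    have he : D.e 0 = 1 := rfl
    have he1 : (1 : ℕ).factorial * D.e 1 = D.q ^ 1 := D.factorial_mul_e 1
    rw [Nat.factorial_one, Nat.cast_one, one_mul, pow_one] at he1
    rw [← add_assoc, he, pow_zero, one_smul, zero_add, he1, pow_one, smul_comm D.q,
      Finset.smul_sum]
    congr 1
    refine Finset.sum_congr rfl fun i _ => ?_
    rw [smul_pow, smul_comm (p ^ m * p ^ m) (D.e _), smul_smul]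
    congr 2
    ring
  refine ⟨s, ?_⟩
  rw [← sub_eq_zero]
  apply hE (p ^ m) _ (pow_pos hp.out.pos m).ne'
  rw [smul_sub, smul_sub, h1, ← h, ← D.exp_nsmul hA, h2]
  abel

omit hA hE hp in
/-- The logarithm is injective on commuting elements: the difference of the logarithms of `1 + qw` and
`1 + qw'` is `q(w - w')(1 + bs)` for some `s`, and `1 + bs` is invertible. -/
theorem eq_of_log_eq (hq : ∀ x : E, D.q • x = 0 → x = 0) {w w' : E} (h : Commute w w')
    (hw : D.log w = D.log w') : w = w' := by
  obtain ⟨s, hs⟩ := exists_isPadicLim_sum A (p := p)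
    (y := fun n => ((-1 : ℤ) ^ (n + 1) • (D.b ^ n * ((n + 1).factorial * D.d (n + 1)))) •
      ∑ i ∈ Finset.range (n + 2), w ^ i * w' ^ (n + 1 - i))
    fun k => ⟨k * D.N, fun n hn =>
      (((D.pDvd_b_pow k n hn).mul_right _).smul (A := ℤ) _).smul_left _⟩
  have h1 : D.log w - D.log w' = D.q • ((w - w') * (1 + D.b • s)) := by
    have h2 := (((D.log_spec w).comp (g := fun n => n + 1) fun n => n.le_succ).add
      (((D.log_spec w').comp (g := fun n => n + 1) fun n => n.le_succ).map
        (negAddMonoidHom : E →+ E)))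
    have h3 := (((IsPadicLim.const (p := p) (1 : E)).add
      (hs.smul D.b)).map (AddMonoidHom.mulLeft (w - w'))).smul D.q
    rw [sub_eq_add_neg]
    refine IsPadicLim.unique A h2 ?_
    refine h3.congr fun k => ⟨0, fun n _ => ?_⟩
    convert PDvd.zero k using 1
    rw [sub_eq_zero]
    simp only [negAddMonoidHom_apply, AddMonoidHom.coe_mulLeft]
    rw [← sub_eq_add_neg, logSum, logSum, ← Finset.sum_sub_distrib, Finset.sum_range_succ']
    have hd0 : D.l 0 = D.q := by
      have := D.succ_mul_l 0
      simpa using this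
    rw [hd0, mul_add, smul_add, add_comm, pow_zero, one_smul, zero_add, pow_one, pow_one,
      mul_one, smul_sub, Finset.smul_sum, Finset.mul_sum, Finset.smul_sum]
    congr 1
    refine Finset.sum_congr rfl fun i _ => ?_
    rw [← smul_sub, mul_smul_comm, mul_smul_comm, smul_smul, smul_smul,
      ← h.mul_geom_sum₂ (i + 1 + 1)]
    simp only [l, Nat.add_sub_cancel]
    congr 1
    simp only [mul_smul_comm]
    congr 1
    ring
  rw [hw, sub_self] at h1
  have h2 := hq _ h1.symm
  have h3 : w - w' = (w - w') * (-(D.b • s)) := by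
    rw [mul_neg, eq_neg_iff_add_eq_zero, ← h2, mul_add, mul_one]
  -- this replaces the invertibility of `1 + bs`: `w - w'` is divisible by all powers of `b`
  have h4 (n : ℕ) : w - w' = (w - w') * (-(D.b • s)) ^ n := by
    induction n with
    | zero => rw [pow_zero, mul_one]
    | succ n ih => rw [pow_succ', ← mul_assoc, ← h3, ← ih]
  rw [← sub_eq_zero]
  refine eq_zero_of_forall_pDvd A (p := p) fun k => ?_
  rw [h4 (k * D.N), ← smul_neg, smul_pow]
  exact ((D.pDvd_b_pow k _ le_rfl).smul_left _).mul_left _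

/-- Both sides have the same logarithm. -/
theorem exp_log (hq : ∀ x : E, D.q • x = 0 → x = 0) {w w' : E} (h : D.log w = D.q • w') :
    D.exp w' = 1 + D.q • w := by
  obtain ⟨v, hv, hvc⟩ := D.exists_exp_eq w'
  obtain ⟨w₁, hw₁, hc₁⟩ := D.exists_log_eq w
  have : w₁ = w' := by
    rw [← sub_eq_zero]
    apply hq
    rw [smul_sub, ← h, ← hw₁, sub_self]
  subst this
  rw [hv, D.eq_of_log_eq hq (hvc _ (hc₁ _ (Commute.refl w)))
    ((D.log_exp hA hE hv).trans h.symm)]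

end ExpDatum

/-! ### Exponential and logarithm of endomorphisms -/

section EndExpLog

variable {p : ℕ} {A : Type u} [CommRing A] {M N : Type u} [AddCommGroup M] [Module A M]
  [AddCommGroup N] [Module A N] [IsHausdorff (Ideal.span {(p : A)}) N]
  (hN : ∀ (n : ℕ) (x : N), n ≠ 0 → n • x = 0 → x = 0)
include hN

/-- A linear map intertwining `v` and `v'` intertwines their exponentials. -/
theorem IsExp.comm {v w : Module.End A M} {v' w' : Module.End A N} (h : IsExp p v w)
    (h' : IsExp p v' w') {f : M →ₗ[A] N} (hf : f ∘ₗ v = v' ∘ₗ f) : f ∘ₗ w = w' ∘ₗ f := by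
  ext x
  obtain ⟨y, hy1, hy2⟩ := h x
  obtain ⟨y', hy1', hy2'⟩ := h' (f x)
  have hpow (n : ℕ) : f ((v ^ n) x) = (v' ^ n) (f x) := by
    induction n with
    | zero => rfl
    | succ n ih =>
      rw [pow_succ', pow_succ', Module.End.mul_apply, Module.End.mul_apply, ← ih]
      exact DFunLike.congr_fun hf _
  have : y' = fun n => f (y n) := by
    ext n
    rw [← sub_eq_zero]
    apply hN _ _ n.factorial_ne_zero
    rw [smul_sub, hy1', ← map_nsmul, hy1, hpow, sub_self]
  subst this
  refine IsPadicLim.unique A (((isPadicSum_iff (A := A)).1 hy2).map f.toAddMonoidHom) ?_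
  have := (isPadicSum_iff (A := A)).1 hy2'
  simp only [← map_sum] at this
  exact this

omit hN in
theorem intertwine_pow_sub_one {v : Module.End A M} {v' : Module.End A N}
    {f : M →ₗ[A] N} (hf : f ∘ₗ v = v' ∘ₗ f) (n : ℕ) (x : M) :
    f (((v - 1) ^ n) x) = ((v' - 1) ^ n) (f x) := by
  induction n with
  | zero => rfl
  | succ n ih =>
    rw [pow_succ', pow_succ', Module.End.mul_apply, Module.End.mul_apply, ← ih,
      LinearMap.sub_apply, map_sub, LinearMap.sub_apply]
    exact congrArg₂ _ (DFunLike.congr_fun hf _) rfl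

/-- A linear map intertwining `v` and `v'` intertwines their logarithms. -/
theorem IsLog.comm {v w : Module.End A M} {v' w' : Module.End A N} (h : IsLog p v w)
    (h' : IsLog p v' w') {f : M →ₗ[A] N} (hf : f ∘ₗ v = v' ∘ₗ f) : f ∘ₗ w = w' ∘ₗ f := by
  ext x
  obtain ⟨y, hy1, hy2⟩ := h x
  obtain ⟨y', hy1', hy2'⟩ := h' (f x)
  have : y' = fun n => f (y n) := by
    ext n
    rw [← sub_eq_zero]
    apply hN _ _ n.succ_ne_zero
    rw [smul_sub, hy1', ← map_nsmul, hy1, map_zsmul, intertwine_pow_sub_one hf, sub_self]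
  subst this
  refine IsPadicLim.unique A (((isPadicSum_iff (A := A)).1 hy2).map f.toAddMonoidHom) ?_
  have := (isPadicSum_iff (A := A)).1 hy2'
  simp only [← map_sum] at this
  exact this

theorem IsExp.expEnd_eq {v w : Module.End A N} (h : IsExp p v w) : expEnd p v = w := by
  have h0 : ∃ w, IsExp p v w := ⟨w, h⟩
  rw [expEnd, dif_pos h0]
  exact h0.choose_spec.comm hN h (f := LinearMap.id) rfl

theorem IsLog.logEnd_eq {v w : Module.End A N} (h : IsLog p v w) : logEnd p v = w := by
  have h0 : ∃ w, IsLog p v w := ⟨w, h⟩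
  rw [logEnd, dif_pos h0]
  exact h0.choose_spec.comm hN h (f := LinearMap.id) rfl

omit hN [IsHausdorff (Ideal.span {(p : A)}) N]
variable [IsAdicComplete (Ideal.span {(p : A)}) (Module.End A N)] (D : ExpDatum p A)

theorem ExpDatum.isExp_exp (w : Module.End A N) : IsExp p (D.q • w) (D.exp w) := by
  intro x
  refine ⟨fun n => D.e n • (w ^ n) x, fun n => ?_, ?_⟩
  · rw [← Nat.cast_smul_eq_nsmul A, smul_smul, D.factorial_mul_e, smul_pow]
    rfl
  · rw [isPadicSum_iff (A := A)]
    have := (D.exp_spec w).map (LinearMap.applyₗ x : Module.End A N →ₗ[A] N).toAddMonoidHom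
    refine this.congr fun k => ⟨0, fun n _ => ?_⟩
    convert PDvd.zero k using 1
    simp [ExpDatum.expSum]

theorem ExpDatum.isLog_log (w : Module.End A N) : IsLog p (1 + D.q • w) (D.log w) := by
  intro x
  refine ⟨fun n => ((-1 : ℤ) ^ n • D.l n) • (w ^ (n + 1)) x, fun n => ?_, ?_⟩
  · rw [add_sub_cancel_left, ← Nat.cast_smul_eq_nsmul A, smul_smul, mul_smul_comm,
      D.succ_mul_l, smul_pow, smul_assoc]
    rfl
  · rw [isPadicSum_iff (A := A)]
    have := (D.log_spec w).map (LinearMap.applyₗ x : Module.End A N →ₗ[A] N).toAddMonoidHom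
    refine this.congr fun k => ⟨0, fun n _ => ?_⟩
    convert PDvd.zero k using 1
    simp [ExpDatum.logSum]

end EndExpLog

/-! ### Fractional powers of `p` -/

namespace Setting
variable {p : ℕ} [hp : Fact p.Prime] (S : Setting.{u} p)

/-- `p^ε ∈ O_K̄`, for a rational number `ε ≥ 0`. -/
def rpow (ε : ℚ) : S.OKbar := S.rootP ε.den ^ ε.num.toNat

theorem pPow_eq (ε : ℚ) : S.pPow ε = algebraMap S.OKbar S.R1hat (S.rpow ε) := rfl

/-- `p^(m/n) = (p^(1/n))^m`, whether or not the fraction `m/n` is reduced. -/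
theorem rpow_div (m n : ℕ) (hn : 0 < n) : S.rpow ((m : ℚ) / n) = S.rootP n ^ m := by
  set ε : ℚ := (m : ℚ) / n with hε
  have h0 : 0 ≤ ε.num := Rat.num_nonneg.2 (by positivity)
  obtain ⟨a, ha⟩ := Int.eq_ofNat_of_zero_le h0
  have h1 : ε * n = m := by rw [hε]; field_simp
  have h2 : (a : ℚ) = ε * ε.den := by
    rw [Rat.mul_den_eq_num, ha]; rfl
  have h3 : a * n = m * ε.den := by
    have : (a : ℚ) * n = m * ε.den := by rw [h2, ← h1]; ring
    exact_mod_cast this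
  have hc : Nat.Coprime a ε.den := by
    have := ε.reduced
    rwa [ha] at this
  obtain ⟨k, hk⟩ : ε.den ∣ n := hc.symm.dvd_of_dvd_mul_left ⟨m, by rw [h3, mul_comm]⟩
  have hm : m = k * a := by
    apply Nat.eq_of_mul_eq_mul_right ε.den_pos
    rw [← h3, hk]; ring
  have hk0 : 0 < k := Nat.pos_of_ne_zero (by rintro rfl; simp at hk; omega)
  rw [rpow, ha, Int.toNat_natCast, hm, hk, pow_mul, mul_comm ε.den,
    S.rootP_mul k _ hk0 ε.den_pos]

theorem rpow_add {a b : ℚ} (ha : 0 ≤ a) (hb : 0 ≤ b) :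
    S.rpow (a + b) = S.rpow a * S.rpow b := by
  have key (c : ℚ) (hc : 0 ≤ c) (k : ℕ) (hk : 0 < k) :
      c = ((c.num.toNat * k : ℕ) : ℚ) / ((c.den * k : ℕ) : ℚ) := by
    have h0 : ((c.num.toNat : ℕ) : ℚ) = c.num := by
      have := Int.toNat_of_nonneg (Rat.num_nonneg.2 hc)
      exact_mod_cast congrArg (Int.cast : ℤ → ℚ) this
    rw [Nat.cast_mul, Nat.cast_mul, mul_div_mul_right _ _ (by positivity), h0, Rat.num_div_den]
  have h1 := key a ha b.den b.den_pos
  have h2 := key b hb a.den a.den_pos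
  rw [mul_comm b.den] at h2
  have hd : 0 < a.den * b.den := Nat.mul_pos a.den_pos b.den_pos
  generalize a.num.toNat * b.den = m at h1
  generalize b.num.toNat * a.den = m' at h2
  generalize a.den * b.den = d at h1 h2 hd
  rw [h1, h2, ← add_div, ← Nat.cast_add, rpow_div _ _ _ hd, rpow_div _ _ _ hd, rpow_div _ _ _ hd,
    pow_add]

theorem rootP_pow (n : ℕ) (hn : 0 < n) : S.rootP n ^ n = p := by
  rw [← S.rootP_one, ← S.rootP_mul n 1 hn one_pos, mul_one]

theorem rpow_ne_zero (ε : ℚ) : S.rpow ε ≠ 0 := by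
  refine pow_ne_zero _ fun h => S.p_ne_zero ?_
  rw [← S.rootP_pow _ ε.den_pos, h, zero_pow ε.den_pos.ne']

theorem not_isUnit_rpow {ε : ℚ} (hε : 0 < ε) : ¬ IsUnit (S.rpow ε) := by
  intro h
  have h1 : ε.num.toNat ≠ 0 := by
    have := Rat.num_pos.2 hε
    omega
  have h2 := (isUnit_pow_iff h1).1 h
  apply S.not_isUnit_p_OKbar
  rw [← S.rootP_pow _ ε.den_pos]
  exact h2.pow _

theorem isUnit_natCast_𝒪K {n : ℕ} (hn : n.Coprime p) : IsUnit (n : S.𝒪K) := by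
  by_contra h
  rw [← mem_nonunits_iff, ← IsLocalRing.mem_maximalIdeal, ← IsLocalRing.residue_eq_zero_iff,
    map_natCast, CharP.cast_eq_zero_iff _ p] at h
  exact hp.out.one_lt.ne' (Nat.eq_one_of_dvd_coprimes hn h dvd_rfl)

theorem isUnit_natCast_OKbar {n : ℕ} (hn : n.Coprime p) : IsUnit (n : S.OKbar) := by
  have := (S.isUnit_natCast_𝒪K hn).map (algebraMap S.𝒪K S.OKbar)
  rwa [map_natCast] at this

/-- `p^(1/(p-1))` -/
def tau : S.OKbar := S.rpow (1 / ((p : ℚ) - 1))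

theorem tau_pow : S.tau ^ (p - 1) = p := by
  have h1 : (1 / ((p : ℚ) - 1)) = ((1 : ℕ) : ℚ) / ((p - 1 : ℕ) : ℚ) := by
    rw [Nat.cast_sub hp.out.one_le]; simp
  have h2 : 0 < p - 1 := Nat.sub_pos_of_lt hp.out.one_lt
  rw [tau, h1, rpow_div _ _ _ h2, pow_one, S.rootP_pow _ h2]

/-- In `O_K̄` an integer is the product of its `p`-part and a unit. -/
theorem natCast_eq_pow_mul (n : ℕ) (hn : n ≠ 0) :
    ∃ u : S.OKbar, IsUnit u ∧ (n : S.OKbar) = p ^ padicValNat p n * u := by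
  obtain ⟨e, m, hm, rfl⟩ := Nat.exists_eq_pow_mul_and_not_dvd hn p hp.out.ne_one
  have hm0 : m ≠ 0 := by rintro rfl; exact hm (dvd_zero p)
  refine ⟨m, S.isUnit_natCast_OKbar ((hp.out.coprime_iff_not_dvd.2 hm).symm), ?_⟩
  rw [padicValNat.mul (pow_ne_zero _ hp.out.ne_zero) hm0, padicValNat.prime_pow,
    padicValNat.eq_zero_of_not_dvd hm, add_zero, Nat.cast_mul, Nat.cast_pow]

/-- Legendre's formula gives `v_p((n+1)!) ≤ n/(p-1)`. -/
theorem factorial_dvd_tau_pow (n : ℕ) : ((n + 1).factorial : S.OKbar) ∣ S.tau ^ n := by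
  have h1 := sub_one_mul_padicValNat_factorial (p := p) (n + 1)
  have h2 : 0 < (p.digits (n + 1)).sum := by
    have hne : p.digits (n + 1) ≠ [] := Nat.digits_ne_nil_iff_ne_zero.2 n.succ_ne_zero
    exact (Nat.pos_of_ne_zero (Nat.getLast_digit_ne_zero p n.succ_ne_zero)).trans_le
      (List.single_le_sum (fun _ _ => Nat.zero_le _) _ (List.getLast_mem hne))
  obtain ⟨u, hu, h⟩ := S.natCast_eq_pow_mul _ (n + 1).factorial_ne_zero
  rw [h, hu.mul_right_dvd, ← S.tau_pow, ← pow_mul, h1]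
  exact pow_dvd_pow _ (by omega)

/-- The numbers `b = p^β` and `τ = p^(1/(p-1))` in `R̂_1`, for `β > 0`. -/
def expDatum (β : ℚ) (hβ : 0 < β) : ExpDatum p S.R1hat where
  b := S.pPow β
  τ := algebraMap S.OKbar S.R1hat S.tau
  d n := algebraMap S.OKbar S.R1hat (S.factorial_dvd_tau_pow n).choose
  factorial_mul_d n := by
    rw [← map_natCast (algebraMap S.OKbar S.R1hat), ← map_mul, ← map_pow,
      ← (S.factorial_dvd_tau_pow n).choose_spec]
  N := (S.exists_dvd_pow p (S.rpow β) S.p_ne_zero (S.not_isUnit_rpow hβ)).choose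
  dvd := by
    have := map_dvd (algebraMap S.OKbar S.R1hat)
      (S.exists_dvd_pow p (S.rpow β) S.p_ne_zero (S.not_isUnit_rpow hβ)).choose_spec
    rwa [map_natCast, map_pow] at this

/-- `p^α = p^β p^(1/(p-1))` -/
theorem pPow_eq_mul_tau {α β : ℚ} (hβ0 : 0 ≤ β) (hβ : β = α - 1 / ((p : ℚ) - 1)) :
    S.pPow α = S.pPow β * algebraMap S.OKbar S.R1hat S.tau := by
  have h1 : α = β + 1 / ((p : ℚ) - 1) := by rw [hβ]; ring
  have h2 : (0 : ℚ) ≤ 1 / ((p : ℚ) - 1) := by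
    have : (1 : ℚ) < p := by exact_mod_cast hp.out.one_lt
    exact one_div_nonneg.2 (by linarith)
  rw [pPow_eq, h1, S.rpow_add hβ0 h2, map_mul]
  rfl

end Setting

/-! ### Roots of unity in `O_K̄` -/

theorem dvd_of_pow_dvd_pow {V : Type*} [CommRing V] [IsDomain V] [ValuationRing V] {a b : V}
    {n : ℕ} (hn : n ≠ 0) (h : a ^ n ∣ b ^ n) : a ∣ b := by
  refine (ValuationRing.dvd_total a b).elim id ?_
  rintro ⟨c, rfl⟩
  rcases eq_or_ne b 0 with rfl | hb
  · exact dvd_zero _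
  rw [mul_pow] at h
  have h1 : c ^ n ∣ 1 := by
    rw [← mul_dvd_mul_iff_left (pow_ne_zero n hb), mul_one]
    exact h
  exact ((isUnit_pow_iff hn).1 (isUnit_of_dvd_one h1)).mul_right_dvd.2 dvd_rfl

/-- The value at `1` of the cyclotomic polynomial of order `p^(k+1)`, which is `p`, is the product
of the `1 - ζ^i`, and these are associated to each other. -/
theorem _root_.IsPrimitiveRoot.associated_sub_one_pow_prime {V : Type*} [CommRing V] [IsDomain V]
    {p : ℕ} [hp : Fact p.Prime] {k : ℕ} {ζ : V} (hζ : IsPrimitiveRoot ζ (p ^ (k + 1))) :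
    Associated ((ζ - 1) ^ (p ^ k * (p - 1))) (p : V) := by
  have : NeZero (p ^ (k + 1)) := ⟨pow_ne_zero _ hp.out.ne_zero⟩
  have h1 := Polynomial.eval_one_cyclotomic_prime_pow (R := V) (p := p) k
  rw [Polynomial.cyclotomic_eq_prod_X_sub_primitiveRoots hζ, Polynomial.eval_prod] at h1
  rw [← h1]
  have h2 := Associated.prod (primitiveRoots (p ^ (k + 1)) V) (fun _ => ζ - 1)
    (fun μ => Polynomial.eval 1 (Polynomial.X - Polynomial.C μ)) fun μ hμ => by
      rw [mem_primitiveRoots (NeZero.pos _), hζ.isPrimitiveRoot_iff] at hμ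
      obtain ⟨i, -, hi, rfl⟩ := hμ
      rw [Polynomial.eval_sub, Polynomial.eval_X, Polynomial.eval_C, ← neg_sub (ζ ^ i) 1]
      exact (hζ.associated_sub_one_pow_sub_one_of_coprime hi).neg_right
  rwa [Finset.prod_const, hζ.card_primitiveRoots, Nat.totient_prime_pow_succ hp.out] at h2

namespace Setting
variable {p : ℕ} [hp : Fact p.Prime] (S : Setting.{u} p)

theorem exists_pow_eq_unit (x : S.OKbarˣ) : ∃ y : S.OKbarˣ, y ^ p = x := by
  have : IsAlgClosed S.Kbar := IsAlgClosure.isAlgClosed S.K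
  obtain ⟨z, hz⟩ := IsAlgClosed.exists_pow_nat_eq ((x : S.OKbar) : S.Kbar) hp.out.pos
  have hz' : IsIntegral S.𝒪K z := IsIntegral.of_pow hp.out.pos (by rw [hz]; exact (x : S.OKbar).2)
  have h : (⟨z, hz'⟩ : S.OKbar) ^ p = x := Subtype.ext hz
  have hu : IsUnit (⟨z, hz'⟩ : S.OKbar) :=
    (isUnit_pow_iff hp.out.ne_zero).1 (h ▸ x.isUnit)
  exact ⟨hu.unit, Units.ext h⟩

/-- Every `p`-th root of unity is the first component of an element of `ℤ_p(1)`. -/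
theorem exists_Zp1 (ζ : S.OKbarˣ) (hζ : ζ ^ p = 1) : ∃ z : S.Zp1, (z : ℕ → S.OKbarˣ) 1 = ζ := by
  choose f hf using S.exists_pow_eq_unit
  let z : ℕ → S.OKbarˣ := fun n => Nat.casesOn n 1 fun m => f^[m] ζ
  refine ⟨⟨z, rfl, fun n => ?_⟩, rfl⟩
  cases n with
  | zero => exact hζ
  | succ n =>
    change (f^[n + 1] ζ) ^ p = f^[n] ζ
    rw [Function.iterate_succ_apply', hf]

/-- There is a generator of `ℤ_p(1)`. -/
theorem exists_Zp1_ne_one : ∃ z : S.Zp1, (z : ℕ → S.OKbarˣ) 1 ≠ 1 := by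
  have : IsAlgClosed S.Kbar := IsAlgClosure.isAlgClosed S.K
  have : CharZero S.Kbar := by
    have : CharZero S.K :=
      charZero_of_injective_algebraMap (IsFractionRing.injective S.𝒪K S.K)
    exact charZero_of_injective_algebraMap (algebraMap S.K S.Kbar).injective
  have : NeZero (p : S.Kbar) := ⟨Nat.cast_ne_zero.2 hp.out.ne_zero⟩
  obtain ⟨ζ, hζ⟩ := IsAlgClosed.exists_root (Polynomial.cyclotomic p S.Kbar)
    (Polynomial.degree_cyclotomic_pos p _ hp.out.pos).ne'
  have hζ : IsPrimitiveRoot ζ p := Polynomial.isRoot_cyclotomic_iff.1 hζ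
  have hint : IsIntegral S.𝒪K ζ := IsIntegral.of_pow hp.out.pos (by
    rw [hζ.pow_eq_one]
    exact isIntegral_one)
  have h1 : (⟨ζ, hint⟩ : S.OKbar) ^ p = 1 := Subtype.ext hζ.pow_eq_one
  obtain ⟨z, hz⟩ := S.exists_Zp1 (Units.ofPowEqOne _ p h1 hp.out.ne_zero)
    (Units.pow_ofPowEqOne h1 hp.out.ne_zero)
  refine ⟨z, fun h => hζ.ne_one hp.out.one_lt ?_⟩
  rw [hz] at h
  have := congrArg (fun x : S.OKbarˣ => ((x : S.OKbar) : S.Kbar)) h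
  exact this

variable {S} in
theorem isPrimitiveRoot_Zp1 {z : S.Zp1} (hz : (z : ℕ → S.OKbarˣ) 1 ≠ 1) (n : ℕ) :
    IsPrimitiveRoot ((z : ℕ → S.OKbarˣ) (n + 1) : S.OKbar) (p ^ (n + 1)) := by
  rw [IsPrimitiveRoot.coe_units_iff]
  have h1 : ∀ n, (z : ℕ → S.OKbarˣ) (n + 1) ^ p ^ n = (z : ℕ → S.OKbarˣ) 1 := fun n => by
    induction n with
    | zero => rw [pow_zero, pow_one]
    | succ n ih => rw [pow_succ', pow_mul, z.2.2, ih]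
  rw [← orderOf_eq_prime_pow (by rwa [h1 n]) (S.Zp1_pow z (n + 1))]
  exact IsPrimitiveRoot.orderOf _

variable {S} in
theorem associated_sub_one_pow {z : S.Zp1} (hz : (z : ℕ → S.OKbarˣ) 1 ≠ 1) (n : ℕ) :
    Associated ((((z : ℕ → S.OKbarˣ) (n + 1) : S.OKbar) - 1) ^ (p ^ n * (p - 1))) p :=
  (isPrimitiveRoot_Zp1 hz n).associated_sub_one_pow_prime

variable {S} in
/-- The valuation of `ζ_p - 1` is `1/(p-1)`. -/
theorem associated_sub_one_tau {z : S.Zp1} (hz : (z : ℕ → S.OKbarˣ) 1 ≠ 1) :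
    Associated (((z : ℕ → S.OKbarˣ) 1 : S.OKbar) - 1) S.tau := by
  have h := associated_sub_one_pow hz 0
  rw [pow_zero, one_mul, ← S.tau_pow] at h
  have h0 : p - 1 ≠ 0 := (Nat.sub_pos_of_lt hp.out.one_lt).ne'
  exact associated_of_dvd_dvd (dvd_of_pow_dvd_pow h0 h.dvd) (dvd_of_pow_dvd_pow h0 h.symm.dvd)

/-! ### The kernel of Fontaine's homomorphism -/

/-- The reduction `O_K̄ → O_C/p`. -/
def modP : S.OKbar →+* ModP S.OC p :=
  (Ideal.Quotient.mk (Ideal.span {(p : S.OC)})).comp (algebraMap S.OKbar S.OC)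

theorem modP_surjective : Function.Surjective S.modP := fun x => by
  obtain ⟨x, rfl⟩ := Ideal.Quotient.mk_surjective x
  obtain ⟨a, y, rfl⟩ := S.exists_eq_algebraMap_OC_add 1 x
  refine ⟨a, ?_⟩
  rw [modP, RingHom.comp_apply, Ideal.Quotient.eq, Ideal.mem_span_singleton]
  exact ⟨-y, by ring⟩

theorem modP_eq_zero {a : S.OKbar} : S.modP a = 0 ↔ (p : S.OKbar) ∣ a := by
  rw [modP, RingHom.comp_apply, Ideal.Quotient.eq_zero_iff_mem, Ideal.mem_span_singleton]
  constructor
  · rintro ⟨y, hy⟩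
    have := dvd_of_algebraMap_eq (p := p) (k := 1) (a := a) (y := y) (by rw [pow_one]; exact hy)
    rwa [pow_one] at this
  · intro h
    have := map_dvd (algebraMap S.OKbar S.OC) h
    rwa [map_natCast] at this

theorem coeff_tiltHom (z : S.Zp1) (n : ℕ) :
    PreTilt.coeff n (S.tiltHom z) = S.modP ((z : ℕ → S.OKbarˣ) n) := rfl

theorem preTilt_ext {x y : PreTilt S.OC p} (h : ∀ n, PreTilt.coeff n x = PreTilt.coeff n y) :
    x = y := Perfection.ext h

/-- The components of `x ∈ lim O_C/p` are the reductions of `p^n`-th roots of its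
untilt. -/
theorem eq_zero_of_untilt {x : PreTilt S.OC p} (hx : x.untilt = 0) : x = 0 := by
  refine S.preTilt_ext fun n => ?_
  have h1 := PreTilt.untilt_iterate_frobeniusEquiv_symm_pow x n
  rw [hx] at h1
  have h2 := PreTilt.mk_untilt_eq_coeff_zero ((⇑(frobeniusEquiv (PreTilt S.OC p) p).symm)^[n] x)
  rw [eq_zero_of_pow_eq_zero h1, map_zero, PreTilt.coeff_iterate_frobeniusEquiv_symm,
    zero_add] at h2
  rw [map_zero]
  exact h2.symm

theorem untilt_zero : (0 : PreTilt S.OC p).untilt = 0 := by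
  have h := WittVector.fontaineTheta_teichmuller (R := S.OC) (p := p) 0
  rw [WittVector.teichmuller_zero, map_zero] at h
  exact h.symm

instance : Nontrivial (PreTilt S.OC p) :=
  ⟨0, 1, fun h => by
    have := congrArg PreTilt.untilt h
    rw [S.untilt_zero, map_one] at this
    exact zero_ne_one this⟩

instance : IsDomain (PreTilt S.OC p) :=
  have : NoZeroDivisors (PreTilt S.OC p) := ⟨fun {a b} hab => by
    have h := congrArg PreTilt.untilt hab
    rw [map_mul, S.untilt_zero, mul_eq_zero] at h
    exact h.imp S.eq_zero_of_untilt S.eq_zero_of_untilt⟩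
  NoZeroDivisors.to_isDomain _

/-- The shift `(z_(n+1))_n` of `z ∈ ℤ_p(1)`, as an element of `lim O_C/p`. -/
def shift (z : S.Zp1) : PreTilt S.OC p := (frobeniusEquiv (PreTilt S.OC p) p).symm (S.tiltHom z)

theorem shift_pow (z : S.Zp1) : S.shift z ^ p = S.tiltHom z :=
  frobeniusEquiv_symm_pow_p _ _ _

theorem coeff_shift (z : S.Zp1) (n : ℕ) :
    PreTilt.coeff n (S.shift z) = S.modP ((z : ℕ → S.OKbarˣ) (n + 1)) := by
  rw [shift, PreTilt.coeff_frobeniusEquiv_symm, coeff_tiltHom]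

/-- The untilt of `ε^(1/p)` is `ζ_p`. -/
theorem untilt_shift (z : S.Zp1) :
    (S.shift z).untilt = algebraMap S.OKbar S.OC ((z : ℕ → S.OKbarˣ) 1) := by
  have key (n : ℕ) : (p : S.OC) ^ (n + 1) ∣
      (S.shift z).untilt - algebraMap S.OKbar S.OC ((z : ℕ → S.OKbarˣ) 1) := by
    rw [← PreTilt.untilt_iterate_frobeniusEquiv_symm_pow (S.shift z) n]
    have h1 : (algebraMap S.OKbar S.OC ((z : ℕ → S.OKbarˣ) (n + 1))) ^ p ^ n =
        algebraMap S.OKbar S.OC ((z : ℕ → S.OKbarˣ) 1) := by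
      have h2 : ∀ n, (z : ℕ → S.OKbarˣ) (n + 1) ^ p ^ n = (z : ℕ → S.OKbarˣ) 1 := fun n => by
        induction n with
        | zero => rw [pow_zero, pow_one]
        | succ n ih => rw [pow_succ', pow_mul, z.2.2, ih]
      rw [← map_pow, ← Units.val_pow_eq_pow_val, h2]
    rw [← h1]
    apply dvd_sub_pow_of_dvd_sub
    rw [← Ideal.mem_span_singleton, ← Ideal.Quotient.eq]
    refine (PreTilt.mk_untilt_eq_coeff_zero _).trans ?_
    rw [PreTilt.coeff_iterate_frobeniusEquiv_symm, zero_add, coeff_shift]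
    rfl
  rw [← sub_eq_zero]
  have hH : IsHausdorff (Ideal.span {(p : S.OC)}) S.OC := inferInstance
  refine isHausdorff_span_singleton_iff.1 hH _ fun n => ?_
  obtain ⟨y, hy⟩ := (pow_dvd_pow _ n.le_succ).trans (key n)
  exact ⟨y, hy⟩

variable {S} in
/-- An element of `lim O_C/p` whose component of index `0` vanishes is divisible by
`(ε^(1/p) - 1)^(p-1)`, where `ε` is a generator of `ℤ_p(1)`. -/
theorem dvd_of_coeff_zero {z : S.Zp1} (hz : (z : ℕ → S.OKbarˣ) 1 ≠ 1) {x : PreTilt S.OC p}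
    (hx : PreTilt.coeff 0 x = 0) : (S.shift z - 1) ^ (p - 1) ∣ x := by
  have h0 : p - 1 ≠ 0 := (Nat.sub_pos_of_lt hp.out.one_lt).ne'
  have hcp : CharP (ModP S.OC p) p := inferInstance
  have hep : ExpChar (ModP S.OC p) p := ExpChar.prime hp.out
  choose X hX using fun n => S.modP_surjective (PreTilt.coeff n x)
  let d : ℕ → S.OKbar := fun n => (((z : ℕ → S.OKbarˣ) (n + 1) : S.OKbar) - 1) ^ (p - 1)
  have hd (n : ℕ) : Associated (d n ^ p ^ n) p := by
    have := associated_sub_one_pow hz n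
    rwa [mul_comm, pow_mul] at this
  have hd0 (n : ℕ) : d n ≠ 0 := fun h => S.p_ne_zero (by
    have := (hd n).symm
    rwa [h, zero_pow (pow_ne_zero _ hp.out.ne_zero), associated_zero_iff_eq_zero] at this)
  have hdδ (n : ℕ) : PreTilt.coeff n ((S.shift z - 1) ^ (p - 1)) = S.modP (d n) := by
    rw [map_pow, map_sub, map_one, coeff_shift, map_pow, map_sub, map_one]
  have hdp (n : ℕ) : S.modP (d (n + 1)) ^ p = S.modP (d n) := by
    rw [← hdδ, ← hdδ, PreTilt.coeff_pow_p]
  -- `d n` divides `X n`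
  have hdX (n : ℕ) : d n ∣ X n := by
    apply dvd_of_pow_dvd_pow (pow_ne_zero n hp.out.ne_zero)
    refine (hd n).dvd.trans ?_
    rw [← S.modP_eq_zero, map_pow, hX, ← hx]
    clear hX
    induction n with
    | zero => rw [pow_zero, pow_one]
    | succ n ih => rw [pow_succ', pow_mul, PreTilt.coeff_pow_p, ih]
  choose Z hZ using hdX
  have hXp (n : ℕ) : S.modP (X (n + 1)) ^ p = S.modP (X n) := by
    rw [hX, hX, PreTilt.coeff_pow_p]
  -- the quotients `Z n` are compatible modulo `p` only up to errors killed by `d n`, whose `p`-th power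
  -- is divisible by `p`; so `Y` is built from the `Z (n + 1) ^ p`
  have hy (n : ℕ) : S.modP (Z (n + 2)) ^ p ^ 2 = S.modP (Z (n + 1)) ^ p := by
    obtain ⟨s, hs⟩ : ∃ s, s = Z (n + 2) ^ p - Z (n + 1) := ⟨_, rfl⟩
    have h1 : (p : S.OKbar) ∣ d (n + 1) * s := by
      rw [← S.modP_eq_zero, hs, mul_sub, map_sub, ← hZ, map_mul, ← hdp, map_pow _ (Z (n + 2)),
        ← mul_pow, ← map_mul, ← hZ, hXp, sub_self]
    have h2 : d (n + 1) ^ p ∣ (p : S.OKbar) :=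
      (pow_dvd_pow _ (by
        rw [pow_succ']
        exact Nat.le_mul_of_pos_right _ (pow_pos hp.out.pos n))).trans (hd (n + 1)).dvd
    have h3 : (p : S.OKbar) ∣ s ^ p := by
      obtain ⟨t, ht⟩ := h2
      obtain ⟨r, hr⟩ := h1
      have h4 : d (n + 1) ^ p * s ^ p = d (n + 1) ^ p * (t * (p : S.OKbar) ^ (p - 1) * r ^ p) := by
        rw [← mul_pow, hr, mul_pow]
        have : (p : S.OKbar) ^ p = p * (p : S.OKbar) ^ (p - 1) := by
          rw [← pow_succ', Nat.sub_add_cancel hp.out.one_le]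
        rw [this]
        nth_rewrite 1 [ht]
        ring
      rw [mul_left_cancel₀ (pow_ne_zero p (hd0 _)) h4]
      exact ((dvd_pow_self _ h0).mul_left t).mul_right _
    rw [← S.modP_eq_zero] at h3
    have h5 : Z (n + 2) ^ p = Z (n + 1) + s := by rw [hs]; ring
    rw [pow_two, pow_mul, ← map_pow, h5, map_add, add_pow_expChar, ← map_pow _ s, h3, add_zero]
  obtain ⟨Y, hY⟩ : ∃ Y : PreTilt S.OC p, ∀ n, PreTilt.coeff n Y = S.modP (Z (n + 1)) ^ p :=
    ⟨⟨fun n => S.modP (Z (n + 1)) ^ p, fun n => by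
      rw [← pow_mul, ← pow_two]
      exact hy n⟩, fun n => rfl⟩
  refine ⟨Y, S.preTilt_ext fun n => ?_⟩
  rw [map_mul, hY, hdδ, ← hdp, ← mul_pow, ← map_mul, ← hZ, hXp, hX]

/-- The element `ξ = 1 + [ε^(1/p)] + ⋯ + [ε^(1/p)]^(p-1)`, for `ε ∈ ℤ_p(1)`. -/
def xi (z : S.Zp1) : WittVector p (PreTilt S.OC p) :=
  ∑ i ∈ Finset.range p, WittVector.teichmuller p (S.shift z) ^ i

theorem sub_one_mul_xi (z : S.Zp1) : (WittVector.teichmuller p (S.shift z) - 1) * S.xi z =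
    WittVector.teichmuller p (S.tiltHom z) - 1 := by
  rw [xi, mul_geom_sum, ← map_pow, S.shift_pow]

theorem theta_shift (z : S.Zp1) : S.theta (WittVector.teichmuller p (S.shift z)) =
    algebraMap S.OKbar S.OC ((z : ℕ → S.OKbarˣ) 1) := by
  rw [theta, WittVector.fontaineTheta_teichmuller, untilt_shift]

variable {S} in
/-- The image of `ξ` is `1 + ζ_p + ⋯ + ζ_p^(p-1)`. -/
theorem theta_xi {z : S.Zp1} (hz : (z : ℕ → S.OKbarˣ) 1 ≠ 1) : S.theta (S.xi z) = 0 := by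
  have h := isPrimitiveRoot_Zp1 hz 0
  rw [zero_add, pow_one] at h
  rw [xi, map_sum]
  simp only [map_pow, theta_shift]
  simp only [← map_pow, ← map_sum]
  rw [h.geom_sum_eq_zero hp.out.one_lt, map_zero]

variable {S} in
/-- Modulo `p`, `ξ` is `(ε - 1) / (ε^(1/p) - 1) = (ε^(1/p) - 1)^(p-1)`. -/
theorem coeff_zero_xi {z : S.Zp1} (hz : (z : ℕ → S.OKbarˣ) 1 ≠ 1) :
    (S.xi z).coeff 0 = (S.shift z - 1) ^ (p - 1) := by
  have hne : S.shift z - 1 ≠ 0 := fun h => by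
    have h1 : S.shift z = 1 := sub_eq_zero.1 h
    have h2 := S.untilt_shift z
    rw [h1, map_one, ← map_one (algebraMap S.OKbar S.OC)] at h2
    exact hz (Units.ext (S.algebraMap_OC_injective h2).symm)
  have h1 := congrArg (WittVector.constantCoeff (p := p)) (S.sub_one_mul_xi z)
  rw [map_mul, map_sub, map_sub, map_one] at h1
  simp only [WittVector.constantCoeff_apply, WittVector.teichmuller_coeff_zero] at h1
  apply mul_left_cancel₀ hne
  have : ExpChar (PreTilt S.OC p) p := ExpChar.prime hp.out
  rw [h1, ← pow_succ', Nat.sub_add_cancel hp.out.one_le, sub_pow_expChar, one_pow, S.shift_pow]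

variable {S} in
theorem xi_coeff_ne_zero {z : S.Zp1} (hz : (z : ℕ → S.OKbarˣ) 1 ≠ 1) : (S.xi z).coeff 0 ≠ 0 := by
  rw [coeff_zero_xi hz]
  refine pow_ne_zero _ fun h => ?_
  have h1 : S.shift z = 1 := sub_eq_zero.1 h
  have h2 := S.untilt_shift z
  rw [h1, map_one, ← map_one (algebraMap S.OKbar S.OC)] at h2
  exact hz (Units.ext (S.algebraMap_OC_injective h2).symm)

variable {S} in
/-- `ξ` generates the kernel of Fontaine's homomorphism: it does modulo `p`, and `O_C` has no
`p`-torsion, so that the quotient can be found by successive approximation. -/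
theorem xi_dvd {z : S.Zp1} (hz : (z : ℕ → S.OKbarˣ) 1 ≠ 1) {x : WittVector p (PreTilt S.OC p)}
    (hx : S.theta x = 0) : S.xi z ∣ x := by
  have step (x : WittVector p (PreTilt S.OC p)) (hx : S.theta x = 0) :
      ∃ y x', x = S.xi z * y + p * x' ∧ S.theta x' = 0 := by
    have h1 : PreTilt.coeff 0 (x.coeff 0) = 0 := by
      rw [← WittVector.mk_fontaineTheta]
      exact (congrArg _ hx).trans (map_zero _)
    obtain ⟨y, hy⟩ := dvd_of_coeff_zero hz h1
    obtain ⟨Y, rfl⟩ := WittVector.coeff_surjective (p := p) 0 y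
    have h2 : (x - S.xi z * Y).coeff 0 = 0 := by
      rw [← WittVector.constantCoeff_apply, map_sub, map_mul]
      simp only [WittVector.constantCoeff_apply]
      rw [hy, coeff_zero_xi hz, sub_self]
    rw [← WittVector.mem_span_p_iff_coeff_zero_eq_zero, Ideal.mem_span_singleton] at h2
    obtain ⟨x', hx'⟩ := h2
    refine ⟨Y, x', by rw [← hx']; ring, ?_⟩
    have h3 := congrArg S.theta hx'
    rw [map_sub, hx, map_mul, theta_xi hz, map_mul, map_natCast, zero_mul, sub_zero] at h3
    have h4 : algebraMap S.OKbar S.OC p * S.theta x' = 0 := by rw [map_natCast, ← h3]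
    exact S.eq_zero_of_algebraMap_OC_mul S.p_ne_zero h4
  choose! y f hf using step
  have hP : IsPrecomplete (Ideal.span {(p : WittVector p (PreTilt S.OC p))})
    (WittVector p (PreTilt S.OC p)) := inferInstance
  have hH : IsHausdorff (Ideal.span {(p : WittVector p (PreTilt S.OC p))})
    (WittVector p (PreTilt S.OC p)) := inferInstance
  rw [isPrecomplete_span_singleton_iff] at hP
  have hθ (n : ℕ) : S.theta (f^[n] x) = 0 := by
    induction n with
    | zero => exact hx
    | succ n ih => rw [Function.iterate_succ_apply']; exact (hf _ ih).2
  obtain ⟨L, hL⟩ := hP fun n => y (f^[n] x)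
  refine ⟨L, ?_⟩
  rw [← sub_eq_zero]
  refine isHausdorff_span_singleton_iff.1 hH _ fun n => ?_
  have h1 : x = S.xi z * ∑ i ∈ Finset.range n, (p : WittVector p (PreTilt S.OC p)) ^ i • y (f^[i] x)
      + p ^ n * f^[n] x := by
    clear hL
    induction n with
    | zero => simp
    | succ n ih =>
      refine ih.trans ?_
      rw [Finset.sum_range_succ, Function.iterate_succ_apply', smul_eq_mul, pow_succ]
      linear_combination (p : WittVector p (PreTilt S.OC p)) ^ n * (hf _ (hθ n)).1
  obtain ⟨w, hw⟩ := hL n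
  refine ⟨S.xi z * w + f^[n] x, ?_⟩
  rw [smul_eq_mul] at hw ⊢
  nth_rewrite 1 [h1]
  linear_combination (S.xi z) * hw

variable {S} in
/-- `ξ` is not a zero divisor, since it is not one modulo `p`. -/
theorem eq_zero_of_xi_mul {z : S.Zp1} (hz : (z : ℕ → S.OKbarˣ) 1 ≠ 1)
    {x : WittVector p (PreTilt S.OC p)} (hx : S.xi z * x = 0) : x = 0 := by
  have step (x : WittVector p (PreTilt S.OC p)) (hx : S.xi z * x = 0) :
      ∃ x', x = p * x' ∧ S.xi z * x' = 0 := by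
    have h1 := congrArg (WittVector.constantCoeff (p := p)) hx
    rw [map_mul, map_zero] at h1
    simp only [WittVector.constantCoeff_apply] at h1
    have h2 := (mul_eq_zero.1 h1).resolve_left (xi_coeff_ne_zero hz)
    rw [← WittVector.mem_span_p_iff_coeff_zero_eq_zero, Ideal.mem_span_singleton] at h2
    obtain ⟨x', rfl⟩ := h2
    exact ⟨x', rfl, WittVector.eq_zero_of_p_mul_eq_zero _ (by rw [← hx]; ring)⟩
  have hH : IsHausdorff (Ideal.span {(p : WittVector p (PreTilt S.OC p))})
    (WittVector p (PreTilt S.OC p)) := inferInstance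
  refine isHausdorff_span_singleton_iff.1 hH _ fun n => ?_
  have key : ∃ w, x = (p : WittVector p (PreTilt S.OC p)) ^ n • w ∧ S.xi z * w = 0 := by
    induction n with
    | zero => exact ⟨x, by simp, hx⟩
    | succ n ih =>
      obtain ⟨w, rfl, hw⟩ := ih
      obtain ⟨w', rfl, hw'⟩ := step w hw
      exact ⟨w', by rw [pow_succ, smul_eq_mul, smul_eq_mul, mul_assoc], hw'⟩
  obtain ⟨w, hw, -⟩ := key
  exact ⟨w, hw⟩

/-! ### The module `ξ⁻¹O_C` -/

variable {S}

/-- The class of `ξ` in `ker θ / (ker θ)²`. -/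
def xiClass {z : S.Zp1} (hz : (z : ℕ → S.OKbarˣ) 1 ≠ 1) : S.Xi :=
  (RingHom.ker S.theta).toCotangent ⟨S.xi z, theta_xi hz⟩

theorem smul_xiClass {z : S.Zp1} (hz : (z : ℕ → S.OKbarˣ) 1 ≠ 1)
    (w : WittVector p (PreTilt S.OC p)) (h : w * S.xi z ∈ RingHom.ker S.theta) :
    w • xiClass hz = (RingHom.ker S.theta).toCotangent ⟨w * S.xi z, h⟩ :=
  ((RingHom.ker S.theta).toCotangent.map_smul w ⟨S.xi z, theta_xi hz⟩).symm

theorem mul_xi_mem {z : S.Zp1} (hz : (z : ℕ → S.OKbarˣ) 1 ≠ 1)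
    (w : WittVector p (PreTilt S.OC p)) : w * S.xi z ∈ RingHom.ker S.theta := by
  rw [RingHom.mem_ker, map_mul, theta_xi hz, mul_zero]

/-- `log[ε] = ([ε^(1/p)] - 1) ξ` -/
theorem tateLog_eq {z : S.Zp1} (hz : (z : ℕ → S.OKbarˣ) 1 ≠ 1) :
    S.tateLog (.ofMul z) = (WittVector.teichmuller p (S.shift z) - 1) • xiClass hz := by
  rw [smul_xiClass hz _ (mul_xi_mem hz _)]
  exact congrArg (RingHom.ker S.theta).toCotangent (Subtype.ext (S.sub_one_mul_xi z).symm)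

/-- `ξO_C` is generated by the class of `ξ`. -/
theorem exists_smul_xiClass {z : S.Zp1} (hz : (z : ℕ → S.OKbarˣ) 1 ≠ 1) (x : S.Xi) :
    ∃ w : WittVector p (PreTilt S.OC p), x = w • xiClass hz := by
  obtain ⟨⟨x, hx⟩, rfl⟩ := Ideal.toCotangent_surjective _ x
  obtain ⟨w, rfl⟩ := xi_dvd hz (RingHom.mem_ker.1 hx)
  refine ⟨w, ?_⟩
  rw [smul_xiClass hz _ (mul_xi_mem hz _)]
  exact congrArg (RingHom.ker S.theta).toCotangent (Subtype.ext (mul_comm _ _))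

/-- The class of `ξ` is not annihilated by a nonzero element of `O_C`. -/
theorem theta_eq_of_smul_xiClass {z : S.Zp1} (hz : (z : ℕ → S.OKbarˣ) 1 ≠ 1)
    {w w' : WittVector p (PreTilt S.OC p)} (h : w • xiClass hz = w' • xiClass hz) :
    S.theta w = S.theta w' := by
  rw [smul_xiClass hz _ (mul_xi_mem hz _), smul_xiClass hz _ (mul_xi_mem hz _),
    Ideal.toCotangent_eq] at h
  have hI : RingHom.ker S.theta = Ideal.span {S.xi z} := by
    apply le_antisymm
    · intro x hx
      exact Ideal.mem_span_singleton.2 (xi_dvd hz (RingHom.mem_ker.1 hx))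
    · rw [Ideal.span_singleton_le_iff_mem]
      exact theta_xi hz
  have h0 : w * S.xi z - w' * S.xi z ∈ Ideal.span {S.xi z} ^ 2 := hI ▸ h
  rw [Ideal.span_singleton_pow, Ideal.mem_span_singleton] at h0
  obtain ⟨v, hv⟩ := h0
  have h1 : S.xi z * (w - w' - S.xi z * v) = 0 := by
    linear_combination hv
  have h2 := congrArg S.theta (eq_zero_of_xi_mul hz h1)
  rw [map_sub, map_sub, map_mul, theta_xi hz, zero_mul, sub_zero, map_zero, sub_eq_zero] at h2
  exact h2

/-- The generator of `ξ⁻¹O_C` dual to `ξ`. -/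
theorem exists_xiInv {z : S.Zp1} (hz : (z : ℕ → S.OKbarˣ) 1 ≠ 1) :
    ∃ μ : S.XiInv, μ (xiClass hz) = 1 := by
  choose f hf using exists_smul_xiClass hz
  have key (w : WittVector p (PreTilt S.OC p)) : S.theta (f (w • xiClass hz)) = S.theta w :=
    theta_eq_of_smul_xiClass hz (hf _).symm
  refine ⟨{ toFun := fun x => S.theta (f x)
            map_add' := fun x y => ?_
            map_smul' := fun c x => ?_ }, ?_⟩
  · rw [← map_add, ← key (f x + f y), add_smul, ← hf, ← hf]
  · rw [smul_eq_mul, ← map_mul, ← key (c * f x), mul_smul, ← hf]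
  · have := key 1
    rw [one_smul, map_one] at this
    exact this

theorem eq_smul_xiInv {z : S.Zp1} (hz : (z : ℕ → S.OKbarˣ) 1 ≠ 1) {μ : S.XiInv}
    (hμ : μ (xiClass hz) = 1) (ν : S.XiInv) : ν = ν (xiClass hz) • μ := by
  ext x
  obtain ⟨w, rfl⟩ := exists_smul_xiClass hz x
  rw [LinearMap.smul_apply, LinearMap.map_smulₛₗ, LinearMap.map_smulₛₗ, hμ, smul_eq_mul,
    smul_eq_mul, smul_eq_mul, mul_one, mul_comm]

/-- `log[ε] = (ζ_p - 1) ξ` -/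
theorem apply_tateLog {z : S.Zp1} (hz : (z : ℕ → S.OKbarˣ) 1 ≠ 1) (μ : S.XiInv) :
    μ (S.tateLog (.ofMul z)) =
      algebraMap S.OKbar S.OC ((z : ℕ → S.OKbarˣ) 1 - 1) * μ (xiClass hz) := by
  rw [tateLog_eq hz, LinearMap.map_smulₛₗ, map_sub, map_one, theta_shift, map_sub, map_one,
    smul_eq_mul]

/-- `p^(1/(p-1))` divides the logarithms of the elements of `ℤ_p(1)`. -/
theorem exists_apply_tateLog_eq (z : S.Zp1) : ∃ c : S.XiInv → S.OC,
    ∀ μ : S.XiInv, μ (S.tateLog (.ofMul z)) = algebraMap S.OKbar S.OC S.tau * c μ := by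
  by_cases hz : (z : ℕ → S.OKbarˣ) 1 = 1
  · let z' : S.Zp1 := ⟨fun n => (z : ℕ → S.OKbarˣ) (n + 1), hz, fun n => z.2.2 _⟩
    have h1 : z = z' ^ p := Subtype.ext (funext fun n => (z.2.2 n).symm)
    refine ⟨fun μ => algebraMap S.OKbar S.OC (S.tau ^ (p - 2)) * μ (S.tateLog (.ofMul z')),
      fun μ => ?_⟩
    rw [h1, ofMul_pow, map_nsmul, map_nsmul, nsmul_eq_mul, ← mul_assoc, ← map_mul, ← pow_succ',
      ← map_natCast (algebraMap S.OKbar S.OC), ← S.tau_pow]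
    congr 4
    have := hp.out.two_le
    omega
  · obtain ⟨c, hc⟩ := (associated_sub_one_tau hz).symm.dvd
    exact ⟨fun μ => algebraMap S.OKbar S.OC c * μ (xiClass hz), fun μ => by
      rw [apply_tateLog hz, hc, map_mul, mul_assoc]⟩

end Setting

/-! ### Logarithmic differentials -/

/-- An additive map satisfying the Leibniz rule and vanishing on `B` is zero when `R` is unramified
over `B`. -/
theorem eq_zero_of_formallyUnramified (B : Type*) {R N : Type*} [CommRing B] [CommRing R]
    [Algebra B R] [Algebra.FormallyUnramified B R] [AddCommGroup N] [Module R N] (D : R → N)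
    (hadd : ∀ a b, D (a + b) = D a + D b) (hmul : ∀ a b, D (a * b) = a • D b + b • D a)
    (hB : ∀ x : B, D (algebraMap B R x) = 0) (r : R) : D r = 0 := by
  let _ : Module B N := Module.compHom N (algebraMap B R)
  have : IsScalarTower B R N := ⟨fun a b c => by
    rw [Algebra.smul_def, mul_smul]; rfl⟩
  let D' : Derivation B R N := Derivation.mk'
    { toFun := D
      map_add' := hadd
      map_smul' := fun x r => by
        rw [Algebra.smul_def, hmul, hB, smul_zero, add_zero]
        rfl } hmul
  have h1 : D r = D'.liftKaehlerDifferential (KaehlerDifferential.D B R r) :=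
    (D'.liftKaehlerDifferential_comp_D r).symm
  rw [h1, Subsingleton.elim (KaehlerDifferential.D B R r) 0, map_zero]

namespace Setting
variable {p : ℕ} [hp : Fact p.Prime] (S : Setting.{u} p)

theorem exists_eq_of_sub_of (x : S.Pgp) : ∃ a c : S.P,
    x = Algebra.GrothendieckAddGroup.of a - Algebra.GrothendieckAddGroup.of c := by
  obtain ⟨⟨a, c⟩, h⟩ := (AddLocalization.addMonoidOf (⊤ : AddSubmonoid S.P)).surj x
  exact ⟨a, c, eq_sub_of_add_eq h⟩

/-- A family of elements `a i - c i` of `P^gp` lifting a basis of the quotient of `P^gp/ℤλ` by its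
torsion, with the dual basis `κ`; the order of the torsion is `m`. -/
structure Coords where
  n : ℕ
  a : Fin n → S.P
  c : Fin n → S.P
  κ : Fin n → (S.P →+ ℤ)
  κ_l : ∀ i, κ i S.l = 0
  κ_sub : ∀ i j, κ i (a j) - κ i (c j) = if i = j then 1 else 0
  m : ℕ
  coprime : m.Coprime p
  spec : ∀ x : S.P, ∃ y : ℤ, m • (Algebra.GrothendieckAddGroup.of x - ∑ i, κ i x •
    (Algebra.GrothendieckAddGroup.of (a i) - Algebra.GrothendieckAddGroup.of (c i))) =
      y • (Algebra.GrothendieckAddGroup.of S.l : S.Pgp)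

theorem nonempty_coords : Nonempty S.Coords := by
  have : AddMonoid.FG S.P := S.isToricMonoidP.fg
  let Z := AddSubgroup.zmultiples (Algebra.GrothendieckAddGroup.of S.l : S.Pgp)
  let Q := S.Pgp ⧸ Z
  let T := AddCommGroup.torsion Q
  have hfg : AddGroup.FG S.Pgp := AddGroup.fg_iff_addMonoid_fg.2 inferInstance
  have : Module.Finite ℤ S.Pgp := Module.Finite.iff_addGroup_fg.2 hfg
  let π : S.Pgp →+ Q ⧸ T := (QuotientAddGroup.mk' T).comp (QuotientAddGroup.mk' Z)
  have hπ : Function.Surjective π :=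
    (QuotientAddGroup.mk'_surjective T).comp (QuotientAddGroup.mk'_surjective Z)
  have hfin : Module.Finite ℤ (Q ⧸ T) := Module.Finite.of_surjective π.toIntLinearMap hπ
  have htf : IsAddTorsionFree (Q ⧸ T) := inferInstance
  have hfree : Module.Free ℤ (Q ⧸ T) := inferInstance
  let b := Module.finBasis ℤ (Q ⧸ T)
  choose t ht using fun i => hπ (b i)
  choose a c hac using fun i => S.exists_eq_of_sub_of (t i)
  refine ⟨⟨_, a, c, fun i => (b.coord i).toAddMonoidHom.comp
    (π.comp Algebra.GrothendieckAddGroup.of), fun i => ?_, fun i j => ?_, Nat.card T,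
    S.coprime_torsion, fun x => ?_⟩⟩
  · have : π (Algebra.GrothendieckAddGroup.of S.l) = 0 := by
      have h : QuotientAddGroup.mk' Z (Algebra.GrothendieckAddGroup.of S.l) = 0 :=
        (QuotientAddGroup.eq_zero_iff _).2 (AddSubgroup.mem_zmultiples _)
      change QuotientAddGroup.mk' T _ = 0
      rw [h, map_zero]
    change b.coord i (π _) = 0
    rw [this, map_zero]
  · change b.coord i (π _) - b.coord i (π _) = _
    rw [← map_sub, ← map_sub, ← hac, ht, Module.Basis.coord_apply, Module.Basis.repr_self,
      Finsupp.single_apply]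
    simp only [eq_comm]
  · set w : S.Pgp := Algebra.GrothendieckAddGroup.of x - ∑ i, b.coord i (π
      (Algebra.GrothendieckAddGroup.of x)) • (Algebra.GrothendieckAddGroup.of (a i) -
        Algebra.GrothendieckAddGroup.of (c i)) with hw
    have h1 : π w = 0 := by
      rw [hw, map_sub, map_sum]
      simp only [← hac, map_zsmul, ht, Module.Basis.coord_apply]
      rw [b.sum_repr, sub_self]
    have h2 : QuotientAddGroup.mk' Z w ∈ T := (QuotientAddGroup.eq_zero_iff _).1 h1
    have h3 : Nat.card T • (⟨_, h2⟩ : T) = 0 := card_nsmul_eq_zero'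
    have h4 : QuotientAddGroup.mk' Z (Nat.card T • w) = 0 := by
      rw [map_nsmul]
      exact congrArg Subtype.val h3
    obtain ⟨y, hy⟩ := AddSubgroup.mem_zmultiples_iff.1 ((QuotientAddGroup.eq_zero_iff _).1 h4)
    exact ⟨y, hy.symm⟩

theorem dlog_l : S.dlog (Algebra.GrothendieckAddGroup.of S.l) = 0 :=
  (Submodule.Quotient.mk_eq_zero _).2 (Submodule.subset_span (Or.inr rfl))

/-- `dγ(t) = γ(t) dlog t` -/
theorem mkQ_D_γ (t : S.P) : S.logRel.mkQ (KaehlerDifferential.D S.𝒪K S.R (S.γ (.ofAdd t)), 0) =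
    S.γ (.ofAdd t) • S.dlog (Algebra.GrothendieckAddGroup.of t) := by
  change _ = S.γ (.ofAdd t) • S.logRel.mkQ _
  rw [← map_smul, ← sub_eq_zero, ← map_sub]
  refine (Submodule.Quotient.mk_eq_zero _).2 (Submodule.subset_span (Or.inl ⟨t, ?_⟩))
  ext <;> simp [TensorProduct.smul_tmul']

/-- The logarithmic differentials are generated by the `dlog t`, since `R` is unramified over
`O_K[P]/(π - e^λ)`. -/
theorem span_dlog : Submodule.span S.R (Set.range S.dlog) = ⊤ := by
  set W := Submodule.span S.R (Set.range S.dlog)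
  let _ := (chartHom S.γ S.γ_l).toRingHom.toAlgebra
  have : Algebra.Etale (ChartRing S.𝒪K S.P S.ϖ S.l) S.R := S.etale
  have hTower : IsScalarTower S.𝒪K (ChartRing S.𝒪K S.P S.ϖ S.l) S.R :=
    IsScalarTower.of_algebraMap_eq fun x => ((chartHom S.γ S.γ_l).commutes x).symm
  let N := S.Omega ⧸ W
  let f : Ω[S.R⁄S.𝒪K] →ₗ[S.R] N := W.mkQ ∘ₗ S.logRel.mkQ ∘ₗ LinearMap.inl S.R _ _
  let D : S.R → N := fun r => f (KaehlerDifferential.D S.𝒪K S.R r)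
  have hDadd (a b : S.R) : D (a + b) = D a + D b := by simp [D]
  have hDmul (a b : S.R) : D (a * b) = a • D b + b • D a := by simp [D]
  have hDγ (t : S.P) : D (S.γ (.ofAdd t)) = 0 := by
    change W.mkQ (S.logRel.mkQ (KaehlerDifferential.D S.𝒪K S.R (S.γ (.ofAdd t)), 0)) = 0
    rw [mkQ_D_γ]
    exact (Submodule.Quotient.mk_eq_zero _).2 (W.smul_mem _ (Submodule.subset_span ⟨_, rfl⟩))
  have hDB (x : ChartRing S.𝒪K S.P S.ϖ S.l) : D (algebraMap _ S.R x) = 0 := by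
    obtain ⟨x, rfl⟩ := Ideal.Quotient.mk_surjective x
    induction x using AddMonoidAlgebra.induction_on with
    | of t =>
      have h1 : algebraMap (ChartRing S.𝒪K S.P S.ϖ S.l) S.R (Ideal.Quotient.mk _
          (AddMonoidAlgebra.of S.𝒪K S.P (.ofAdd t))) = S.γ (.ofAdd t) :=
        chartHom_monomial S.γ S.γ_l t
      rw [h1]
      exact hDγ t
    | add a b ha hb => rw [map_add, map_add, hDadd, ha, hb, add_zero]
    | smul r a ha =>
      have h1 : algebraMap (ChartRing S.𝒪K S.P S.ϖ S.l) S.R (Ideal.Quotient.mk _ (r • a)) =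
          algebraMap S.𝒪K S.R r * algebraMap (ChartRing S.𝒪K S.P S.ϖ S.l) S.R
            (Ideal.Quotient.mk _ a) := by
        rw [← Algebra.smul_def]
        exact map_smul (chartHom S.γ S.γ_l) r (Ideal.Quotient.mk _ a)
      have h2 : D (algebraMap S.𝒪K S.R r) = 0 := by simp [D]
      rw [h1, hDmul, ha, h2, smul_zero, smul_zero, add_zero]
  have hD0 := eq_zero_of_formallyUnramified (ChartRing S.𝒪K S.P S.ϖ S.l) D hDadd hDmul hDB
  have hf : f = 0 := by
    rw [← LinearMap.range_eq_bot, eq_bot_iff, LinearMap.range_eq_map,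
      ← KaehlerDifferential.span_range_derivation, Submodule.map_span, Submodule.span_le]
    rintro _ ⟨_, ⟨r, rfl⟩, rfl⟩
    exact hD0 r
  rw [eq_top_iff]
  rintro x -
  obtain ⟨⟨x, y⟩, rfl⟩ := S.logRel.mkQ_surjective x
  have h1 : S.logRel.mkQ (x, y) = S.logRel.mkQ (x, 0) + S.logRel.mkQ (0, y) := by
    rw [← map_add]; simp
  rw [h1]
  apply add_mem
  · exact (Submodule.Quotient.mk_eq_zero _).1 (DFunLike.congr_fun hf x)
  · induction y using TensorProduct.induction_on with
    | zero => exact (map_zero S.logRel.mkQ) ▸ W.zero_mem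
    | tmul r t =>
      have : S.logRel.mkQ (0, r ⊗ₜ t) = r • S.dlog t := by
        change _ = r • S.logRel.mkQ _
        rw [← map_smul, Prod.smul_mk, smul_zero, TensorProduct.smul_tmul', smul_eq_mul, mul_one]
      rw [this]
      exact W.smul_mem _ (Submodule.subset_span ⟨t, rfl⟩)
    | add y z hy hz =>
      have h2 : S.logRel.mkQ (0, y + z) = S.logRel.mkQ (0, y) + S.logRel.mkQ (0, z) := by
        rw [← map_add]; simp
      rw [h2]
      exact add_mem (hy (by rw [← map_add]; simp)) (hz (by rw [← map_add]; simp))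

variable {S}

/-- The basis `dlog (a i) - dlog (c i)` of the logarithmic differentials. -/
theorem Coords.exists_basis (X : S.Coords) : ∃ b : Module.Basis (Fin X.n) S.R S.Omega,
    ∀ i, b i = S.dlog (Algebra.GrothendieckAddGroup.of (X.a i)) -
      S.dlog (Algebra.GrothendieckAddGroup.of (X.c i)) := by
  let e : Fin X.n → S.Omega := fun i => S.dlog (Algebra.GrothendieckAddGroup.of (X.a i)) -
      S.dlog (Algebra.GrothendieckAddGroup.of (X.c i))
  have hli : LinearIndependent S.R e := by
    rw [Fintype.linearIndependent_iff]
    intro g hg i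
    obtain ⟨f, hf⟩ := S.exists_logLift S.R ((Int.castAddHom S.R).comp (X.κ i))
      (by simp [X.κ_l])
    have h1 (j : Fin X.n) : f (e j) = if i = j then 1 else 0 := by
      simp only [e, map_sub, hf]
      simp only [AddMonoidHom.comp_apply, Int.coe_castAddHom]
      rw [← Int.cast_sub, X.κ_sub]
      split_ifs <;> simp
    have h2 := congrArg f hg
    rw [map_sum, map_zero] at h2
    simpa [h1] using h2
  have hsp : ⊤ ≤ Submodule.span S.R (Set.range e) := by
    rw [← S.span_dlog, Submodule.span_le]
    have key (x : S.P) : S.dlog (Algebra.GrothendieckAddGroup.of x) ∈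
        Submodule.span S.R (Set.range e) := by
      obtain ⟨y, hy⟩ := X.spec x
      have h1 := congrArg S.dlog hy
      rw [map_nsmul, map_zsmul, dlog_l, smul_zero, map_sub, map_sum] at h1
      have hu := (S.isUnit_natCast_𝒪K X.coprime).map (algebraMap S.𝒪K S.R)
      rw [map_natCast] at hu
      rw [← Nat.cast_smul_eq_nsmul S.R, hu.smul_eq_zero, sub_eq_zero] at h1
      rw [h1]
      refine Submodule.sum_mem _ fun i _ => ?_
      rw [map_zsmul, map_sub, ← Int.cast_smul_eq_zsmul S.R]
      exact Submodule.smul_mem _ _ (Submodule.subset_span ⟨i, rfl⟩)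
    rintro _ ⟨x, rfl⟩
    obtain ⟨a, c, rfl⟩ := S.exists_eq_of_sub_of x
    rw [map_sub]
    exact sub_mem (key a) (key c)
  exact ⟨Module.Basis.mk hli hsp, fun i => Module.Basis.mk_apply hli hsp i⟩

/-- The basis of the module of coefficients of Higgs modules attached to coordinates and to a
generator of `ℤ_p(1)`. -/
theorem Coords.exists_basis_E (X : S.Coords) {z : S.Zp1} (hz : (z : ℕ → S.OKbarˣ) 1 ≠ 1) :
    ∃ (μ : S.XiInv) (e : Module.Basis (Fin X.n) S.R1hat S.E), μ (xiClass hz) = 1 ∧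
      ∀ i, e i = (1 ⊗ₜ (S.dlog (Algebra.GrothendieckAddGroup.of (X.a i)) -
        S.dlog (Algebra.GrothendieckAddGroup.of (X.c i)))) ⊗ₜ μ := by
  obtain ⟨b, hb⟩ := X.exists_basis
  obtain ⟨μ, hμ⟩ := exists_xiInv hz
  let e₁ : S.OC ≃ₗ[S.OC] S.XiInv := LinearEquiv.ofBijective
    (LinearMap.toSpanSingleton S.OC S.XiInv μ) ⟨by
      rw [← LinearMap.ker_eq_bot, LinearMap.ker_eq_bot']
      intro c hc
      have := DFunLike.congr_fun hc (xiClass hz)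
      simpa [hμ] using this, fun ν => ⟨_, (eq_smul_xiInv hz hμ ν).symm⟩⟩
  let e₂ : (S.R1hat ⊗[S.R] S.Omega) ≃ₗ[S.R1hat] S.E :=
    (TensorProduct.AlgebraTensorModule.rid S.OC S.R1hat (S.R1hat ⊗[S.R] S.Omega)).symm ≪≫ₗ
      TensorProduct.AlgebraTensorModule.congr (LinearEquiv.refl S.R1hat _) e₁
  refine ⟨μ, (b.baseChange S.R1hat).map e₂, hμ, fun i => ?_⟩
  rw [Module.Basis.map_apply, Module.Basis.baseChange_apply, hb]
  simp only [e₂, e₁, LinearEquiv.trans_apply, TensorProduct.AlgebraTensorModule.rid_symm_apply,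
    TensorProduct.AlgebraTensorModule.congr_tmul, LinearEquiv.refl_apply]
  exact congrArg _ (one_smul S.OC μ)

/-- The defining formula of the contraction. -/
theorem contract_tmul (g : Additive S.Delta) (t : S.P) (μ : S.XiInv) :
    S.contract g ((1 ⊗ₜ S.dlog (Algebra.GrothendieckAddGroup.of t)) ⊗ₜ μ) =
      algebraMap S.OC S.R1hat (μ (S.tateLog (.ofMul (S.chi (.ofAdd t) g.toMul)))) := by
  change S.delta (1 ⊗ₜ S.dlog (Algebra.GrothendieckAddGroup.of t)) g μ = _
  rw [delta, LinearMap.liftBaseChange_tmul, one_smul]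
  have h := (S.exists_logLift (Additive S.Delta →+ (S.XiInv →ₗ[S.OC] S.R1hat)) S.logChi
    S.logChi_l).choose_spec t
  exact congrArg (fun f : Additive S.Delta →+ (S.XiInv →ₗ[S.OC] S.R1hat) => f g μ) h

end Setting

/-! ### Divisibility in integral closures of Noetherian domains -/

/-- In an integral extension of a Noetherian domain, a nonzero element is not divisible by all the
powers of a given non-unit. By Krull's principal ideal theorem one reduces to a one-dimensional
local domain, in which the element divides a power of the non-unit. -/
theorem eq_zero_of_forall_isIntegral_div {R F : Type*} [CommRing R] [IsDomain R]
    [IsNoetherianRing R] [Field F] [Algebra R F] (hF : Function.Injective (algebraMap R F))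
    {c : R} (hc : ¬ IsUnit c) (hc0 : c ≠ 0) {a : R}
    (ha : ∀ n : ℕ, IsIntegral R (algebraMap R F a / algebraMap R F c ^ n)) : a = 0 := by
  by_contra ha0
  have hne : Ideal.span {c} ≠ ⊤ := by rwa [Ne, Ideal.span_singleton_eq_top]
  obtain ⟨M, hM, hle⟩ := Ideal.exists_le_maximal _ hne
  have := hM.isPrime
  obtain ⟨q, hq, -⟩ := Ideal.exists_minimalPrimes_le hle
  have hqp : q.IsPrime := hq.1.1
  have hcq : c ∈ q := hq.1.2 (Ideal.mem_span_singleton_self c)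
  have hht := Ideal.height_le_one_of_isPrincipal_of_mem_minimalPrimes (Ideal.span {c}) q hq
  -- the only primes contained in `q` are `0` and `q`
  have hprime (P : Ideal R) (hP : P.IsPrime) (hPq : P ≤ q) (h : a ∈ P) : P = q := by
    by_contra hPne
    have h1 := Ideal.height_le_iff.1 (by exact_mod_cast hht) P hP (lt_of_le_of_ne hPq hPne)
    have h2 : P.height = 0 := by
      have : P.height < 1 := by exact_mod_cast h1
      exact Order.lt_one_iff.1 this
    rw [Ideal.height_eq_zero_iff_eq_bot] at h2
    rw [h2, Ideal.mem_bot] at h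
    exact ha0 h
  have hrad : algebraMap R (Localization.AtPrime q) c ∈
      (Ideal.map (algebraMap R (Localization.AtPrime q)) (Ideal.span {a})).radical := by
    rw [Ideal.radical_eq_sInf, Ideal.mem_sInf]
    rintro P ⟨hP1, hP2⟩
    have h1 : (P.comap (algebraMap R (Localization.AtPrime q))).IsPrime := hP2.comap _
    have h2 : P.comap (algebraMap R (Localization.AtPrime q)) = q := by
      refine hprime _ h1 ?_ (Ideal.mem_comap.2 (hP1 (Ideal.mem_map_of_mem _
        (Ideal.mem_span_singleton_self a))))
      intro x hx
      by_contra hxq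
      exact hP2.ne_top (P.eq_top_of_isUnit_mem hx
        (IsLocalization.map_units (Localization.AtPrime q) (⟨x, hxq⟩ : q.primeCompl)))
    rw [← h2] at hcq
    exact hcq
  obtain ⟨k, hk⟩ := hrad
  rw [← map_pow, IsLocalization.algebraMap_mem_map_algebraMap_iff q.primeCompl] at hk
  obtain ⟨u, hu, hk⟩ := hk
  obtain ⟨b, hb⟩ := Ideal.mem_span_singleton.1 hk
  have hcF : algebraMap R F c ≠ 0 := by
    rwa [Ne, ← map_zero (algebraMap R F), hF.eq_iff]
  -- `u / c` is integral over `R`, and its equation shows that a power of `u` is in `q`,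
  -- a contradiction
  have h1 : IsIntegral R (algebraMap R F u / algebraMap R F c) := by
    have h2 := (isIntegral_algebraMap (R := R) (A := F) (x := b)).mul (ha (k + 1))
    have h3 := congrArg (algebraMap R F) hb
    rw [map_mul, map_mul, map_pow] at h3
    have h4 : algebraMap R F u / algebraMap R F c =
        algebraMap R F b * (algebraMap R F a / algebraMap R F c ^ (k + 1)) := by
      rw [mul_div_assoc', div_eq_div_iff hcF (pow_ne_zero _ hcF)]
      linear_combination (algebraMap R F c) * h3
    rwa [h4]
  obtain ⟨f, hf, hf0⟩ := h1
  have h2 := Polynomial.scaleRoots_aeval_eq_zero (r := c) hf0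
  rw [mul_div_cancel₀ _ hcF, Polynomial.aeval_algebraMap_apply, ← map_zero (algebraMap R F),
    hF.eq_iff, Polynomial.coe_aeval_eq_eval] at h2
  have h3 := congrArg (Ideal.Quotient.mk q) h2
  rw [map_zero, ← Polynomial.eval₂_at_apply, ← Polynomial.eval_map,
    Polynomial.map_scaleRoots _ _ _ (by rw [hf.leadingCoeff, map_one]; exact one_ne_zero),
    Ideal.Quotient.eq_zero_iff_mem.2 hcq, Polynomial.scaleRoots_zero,
    (hf.map _).leadingCoeff, one_smul, Polynomial.eval_pow, Polynomial.eval_X] at h3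
  exact hu (Ideal.Quotient.eq_zero_iff_mem.1 (eq_zero_of_pow_eq_zero h3))

namespace Setting
variable {p : ℕ} [hp : Fact p.Prime] (S : Setting.{u} p)

/-! ### The fields `Frac R` and `F_1` -/

instance : IsDomain S.R := S.injective_R.isDomain (algebraMap S.R S.Fa)

instance : IsNoetherianRing S.R :=
  have := S.finiteType_R
  Algebra.FiniteType.isNoetherianRing S.𝒪K S.R

theorem injective_𝒪K_Kbar : Function.Injective (algebraMap S.𝒪K S.Kbar) := by
  rw [IsScalarTower.algebraMap_eq S.𝒪K S.K S.Kbar]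
  exact (algebraMap S.K S.Kbar).injective.comp (IsFractionRing.injective S.𝒪K S.K)

theorem injective_𝒪K_R : Function.Injective (algebraMap S.𝒪K S.R) := by
  have h : Function.Injective (algebraMap S.𝒪K S.Fa) := by
    rw [IsScalarTower.algebraMap_eq S.𝒪K S.Kbar S.Fa]
    exact (algebraMap S.Kbar S.Fa).injective.comp S.injective_𝒪K_Kbar
  rw [IsScalarTower.algebraMap_eq S.𝒪K S.R S.Fa] at h
  exact Function.Injective.of_comp h

instance : CharZero S.Kbar := charZero_of_injective_algebraMap S.injective_𝒪K_Kbar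

instance : CharZero S.K := charZero_of_injective_algebraMap (IsFractionRing.injective S.𝒪K S.K)

instance : CharZero S.R := charZero_of_injective_algebraMap S.injective_𝒪K_R

theorem not_isUnit_p_R : ¬ IsUnit (p : S.R) := by
  intro h
  apply S.specialFibre_nonempty
  have h1 : S.ϖ ∣ (p : S.𝒪K) := by
    have := S.not_isUnit_p
    rw [← mem_nonunits_iff, ← IsLocalRing.mem_maximalIdeal, S.irreducible_ϖ.maximalIdeal_eq,
      Ideal.mem_span_singleton] at this
    exact this
  have h2 := map_dvd (algebraMap S.𝒪K S.R) h1
  rw [map_natCast] at h2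
  exact isUnit_of_dvd_unit h2 h

theorem isAlgebraic_𝒪K (x : S.Kbar) : IsAlgebraic S.𝒪K x :=
  (IsFractionRing.isAlgebraic_iff S.𝒪K S.K S.Kbar).2 (Algebra.IsAlgebraic.isAlgebraic x)

/-- `K̄ = O_K̄[1/p]` -/
theorem exists_p_pow_mul_eq (x : S.Kbar) : ∃ (N : ℕ) (y : S.OKbar), (p : S.Kbar) ^ N * x = y := by
  obtain ⟨a, ha, h⟩ := (S.isAlgebraic_𝒪K x).exists_integral_multiple
  have ha' : algebraMap S.𝒪K S.OKbar a ≠ 0 := by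
    rwa [Ne, ← map_zero (algebraMap S.𝒪K S.OKbar), S.injective_OKbar.eq_iff]
  obtain ⟨N, z, hz⟩ := S.dvd_p_pow ha'
  refine ⟨N, z * ⟨a • x, h⟩, ?_⟩
  have h1 := congrArg (algebraMap S.OKbar S.Kbar) hz
  rw [map_pow, map_natCast, map_mul] at h1
  rw [h1]
  change algebraMap S.𝒪K S.Kbar a * (z : S.Kbar) * x = z * (a • x)
  rw [Algebra.smul_def]
  ring

/-- `R_1[1/p] = K̄ R_1` -/
def R1K : Subalgebra S.Kbar S.Fa := Algebra.adjoin S.Kbar (Set.range (algebraMap S.R S.Fa))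

theorem algebraMap_mem_R1 (r : S.R) : algebraMap S.R S.Fa r ∈ S.R1 :=
  Algebra.subset_adjoin ⟨r, rfl⟩

theorem exists_p_pow_mul_mem_R1 {x : S.Fa} (hx : x ∈ S.R1K) :
    ∃ N : ℕ, (p : S.Fa) ^ N * x ∈ S.R1 := by
  have hpm (N : ℕ) : (p : S.Fa) ^ N ∈ S.R1 := pow_mem (natCast_mem _ _) _
  induction hx using Algebra.adjoin_induction with
  | mem x hx =>
    obtain ⟨r, rfl⟩ := hx
    exact ⟨0, by rw [pow_zero, one_mul]; exact S.algebraMap_mem_R1 r⟩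
  | algebraMap x =>
    obtain ⟨N, y, hy⟩ := S.exists_p_pow_mul_eq x
    refine ⟨N, ?_⟩
    have : (p : S.Fa) ^ N * algebraMap S.Kbar S.Fa x = algebraMap S.OKbar S.Fa y := by
      rw [← map_natCast (algebraMap S.Kbar S.Fa), ← map_pow, ← map_mul, hy]
      rfl
    rw [this]
    exact Subalgebra.algebraMap_mem _ _
  | add x y _ _ hx hy =>
    obtain ⟨N, hN⟩ := hx
    obtain ⟨N', hN'⟩ := hy
    refine ⟨N' + N, ?_⟩
    have : (p : S.Fa) ^ (N' + N) * (x + y) =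
        (p : S.Fa) ^ N' * (p ^ N * x) + (p : S.Fa) ^ N * (p ^ N' * y) := by ring
    rw [this]
    exact add_mem (mul_mem (hpm _) hN) (mul_mem (hpm _) hN')
  | mul x y _ _ hx hy =>
    obtain ⟨N, hN⟩ := hx
    obtain ⟨N', hN'⟩ := hy
    refine ⟨N + N', ?_⟩
    have : (p : S.Fa) ^ (N + N') * (x * y) = (p ^ N * x) * (p ^ N' * y) := by ring
    rw [this]
    exact mul_mem hN hN'

/-- The elements of `R_1` are integral over `R`. -/
theorem isIntegral_of_mem_R1 {x : S.Fa} (hx : x ∈ S.R1) : IsIntegral S.R x := by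
  induction hx using Algebra.adjoin_induction with
  | mem x hx =>
    obtain ⟨r, rfl⟩ := hx
    exact isIntegral_algebraMap
  | algebraMap x =>
    have h : IsIntegral S.𝒪K (algebraMap S.Kbar S.Fa x) := x.2.algebraMap
    exact h.tower_top
  | add _ _ _ _ hx hy => exact hx.add hy
  | mul _ _ _ _ hx hy => exact hx.mul hy

theorem R1_le_R1K {x : S.Fa} (hx : x ∈ S.R1) : x ∈ S.R1K := by
  induction hx using Algebra.adjoin_induction with
  | mem x hx => exact Algebra.subset_adjoin hx
  | algebraMap x => exact S.R1K.algebraMap_mem (x : S.Kbar)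
  | add _ _ _ _ hx hy => exact add_mem hx hy
  | mul _ _ _ _ hx hy => exact mul_mem hx hy

/-- `R_1` is `p`-adically separated. -/
theorem eq_zero_of_forall_mem_R1 {x : S.Fa} (hx : ∀ n : ℕ, x / (p : S.Fa) ^ n ∈ S.R1) : x = 0 := by
  by_contra hx0
  have hx1 : x ∈ S.R1 := by simpa using hx 0
  -- a nonzero multiple of `x` lies in `R`
  obtain ⟨a, ha0, y, hy, hxy⟩ : ∃ a : S.R, a ≠ 0 ∧ ∃ y ∈ S.R1, algebraMap S.R S.Fa a = x * y := by
    let x' : S.R1 := ⟨x, hx1⟩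
    have hx'0 : x' ∈ nonZeroDivisors S.R1 := by
      rw [mem_nonZeroDivisors_iff_ne_zero]
      exact fun h => hx0 (congrArg Subtype.val h)
    have : IsScalarTower S.R S.R1 S.Fa := IsScalarTower.of_algebraMap_eq fun _ => rfl
    have halg : IsAlgebraic S.R x' := by
      have h1 := (S.isIntegral_of_mem_R1 hx1).isAlgebraic
      exact (isAlgebraic_algebraMap_iff (A := S.Fa) (R := S.R) (a := x') Subtype.val_injective).1 h1
    obtain ⟨a, ha0, y, hy⟩ := halg.exists_nonzero_dvd hx'0
    exact ⟨a, ha0, y, y.2, congrArg Subtype.val hy⟩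
  refine ha0 (eq_zero_of_forall_isIntegral_div S.injective_R S.not_isUnit_p_R
    (Nat.cast_ne_zero.2 hp.out.ne_zero) fun n => ?_)
  rw [map_natCast, hxy, mul_div_right_comm]
  exact (S.isIntegral_of_mem_R1 (hx n)).mul (S.isIntegral_of_mem_R1 hy)

instance : Algebra S.R S.F1 :=
  ((algebraMap S.R S.Fa).codRestrict S.F1.toSubalgebra
    fun r => IntermediateField.subset_adjoin _ _ ⟨r, rfl⟩).toAlgebra

instance : IsScalarTower S.R S.F1 S.Fa := IsScalarTower.of_algebraMap_eq fun _ => rfl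

instance : IsScalarTower S.𝒪K S.R S.F1 := IsScalarTower.of_algebraMap_eq fun x =>
  Subtype.ext (by
    rw [IsScalarTower.algebraMap_apply S.𝒪K S.Kbar S.F1]
    change algebraMap S.Kbar S.Fa (algebraMap S.𝒪K S.Kbar x) =
      algebraMap S.R S.Fa (algebraMap S.𝒪K S.R x)
    rw [← IsScalarTower.algebraMap_apply, ← IsScalarTower.algebraMap_apply])

theorem injective_R_F1 : Function.Injective (algebraMap S.R S.F1) := fun _ _ h =>
  S.injective_R (congrArg (algebraMap S.F1 S.Fa) h)

instance : FaithfulSMul S.R S.F1 := (faithfulSMul_iff_algebraMap_injective _ _).2 S.injective_R_F1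

theorem isAlgebraic_Kbar (x : S.Kbar) : IsAlgebraic S.R (algebraMap S.Kbar S.Fa x) := by
  have h : IsAlgebraic S.𝒪K (algebraMap S.Kbar S.Fa x) := (S.isAlgebraic_𝒪K x).algebraMap
  exact h.extendScalars S.injective_𝒪K_R

instance : Algebra.IsAlgebraic S.R S.F1 := ⟨fun x => by
  refine (isAlgebraic_algebraMap_iff (A := S.Fa) (R := S.R) (a := x) Subtype.val_injective).1 ?_
  have hx := x.2
  change IsAlgebraic S.R (x : S.Fa)
  generalize (x : S.Fa) = y at hx
  induction hx using IntermediateField.adjoin_induction with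
  | mem x hx =>
    obtain ⟨r, rfl⟩ := hx
    exact isAlgebraic_algebraMap r
  | algebraMap x => exact S.isAlgebraic_Kbar x
  | add _ _ _ _ hx hy => exact hx.add hy
  | inv x _ hx => exact hx.inv
  | mul x y _ _ hx hy => exact hx.mul hy⟩

/-- `F_1` is a separable algebraic extension of the fraction field of `R`. -/
theorem formallyEtale_F1 : Algebra.FormallyEtale S.R S.F1 := by
  let _ : Algebra (FractionRing S.R) S.F1 := FractionRing.liftAlgebra S.R S.F1
  have : IsScalarTower S.R (FractionRing S.R) S.F1 := FractionRing.isScalarTower_liftAlgebra _ _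
  have : CharZero (FractionRing S.R) :=
    charZero_of_injective_algebraMap (IsFractionRing.injective S.R (FractionRing S.R))
  have : Algebra.IsAlgebraic (FractionRing S.R) S.F1 :=
    Algebra.IsAlgebraic.extendScalars (R := S.R) (IsFractionRing.injective S.R (FractionRing S.R))
  have : Algebra.FormallyEtale (FractionRing S.R) S.F1 := Algebra.FormallyEtale.of_isSeparable _ _
  have : Algebra.FormallyEtale S.R (FractionRing S.R) :=
    Algebra.FormallyEtale.of_isLocalization (nonZeroDivisors S.R)
  exact Algebra.FormallyEtale.comp S.R (FractionRing S.R) S.F1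

theorem formallyUnramified_Kbar : Algebra.FormallyUnramified S.𝒪K S.Kbar := by
  have : Algebra.FormallyEtale S.K S.Kbar := Algebra.FormallyEtale.of_isSeparable _ _
  have : Algebra.FormallyEtale S.𝒪K S.K :=
    Algebra.FormallyEtale.of_isLocalization (nonZeroDivisors S.𝒪K)
  have := Algebra.FormallyEtale.comp S.𝒪K S.K S.Kbar
  infer_instance

/-- The logarithmic derivation attached to `κ : P → ℤ` vanishing at `λ`, extended to `F_1`. -/
theorem exists_derivation_F1 (κ : S.P →+ ℤ) (hκ : κ S.l = 0) :
    ∃ D : Derivation S.𝒪K S.F1 S.F1,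
      (∀ x : S.Kbar, D (algebraMap S.Kbar S.F1 x) = 0) ∧
      (∀ r : S.R, ∃ r' : S.R, D (algebraMap S.R S.F1 r) = algebraMap S.R S.F1 r') ∧
      ∀ t : S.P, D (algebraMap S.R S.F1 (S.γ (.ofAdd t))) =
        κ t • algebraMap S.R S.F1 (S.γ (.ofAdd t)) := by
  obtain ⟨d, hd⟩ := S.exists_derivation S.R ((Int.castAddHom S.R).comp κ) (by simp [hκ])
  have := S.formallyEtale_F1
  let e := KaehlerDifferential.tensorKaehlerEquivOfFormallyEtale S.𝒪K S.R S.F1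
  let f : S.F1 ⊗[S.R] Ω[S.R⁄S.𝒪K] →ₗ[S.F1] S.F1 :=
    LinearMap.liftBaseChange S.F1 ((Algebra.linearMap S.R S.F1) ∘ₗ d.liftKaehlerDifferential)
  let D : Derivation S.𝒪K S.F1 S.F1 :=
    (f ∘ₗ e.symm.toLinearMap).compDer (KaehlerDifferential.D S.𝒪K S.F1)
  have hD (r : S.R) : D (algebraMap S.R S.F1 r) = algebraMap S.R S.F1 (d r) := by
    have h1 : e.symm (KaehlerDifferential.D S.𝒪K S.F1 (algebraMap S.R S.F1 r)) =
        1 ⊗ₜ KaehlerDifferential.D S.𝒪K S.R r := by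
      rw [LinearEquiv.symm_apply_eq]
      simp [e]
    refine (congrArg f h1).trans ?_
    simp [f]
  refine ⟨D, fun x => ?_, fun r => ⟨_, hD r⟩, fun t => ?_⟩
  · have := S.formallyUnramified_Kbar
    exact eq_zero_of_formallyUnramified S.𝒪K (fun x : S.Kbar => D (algebraMap S.Kbar S.F1 x))
      (fun a b => by rw [map_add, map_add])
      (fun a b => by rw [map_mul, D.leibniz, ← algebraMap_smul S.F1 a, ← algebraMap_smul S.F1 b])
      (fun x => by rw [← IsScalarTower.algebraMap_apply, D.map_algebraMap]) x
  · rw [hD, hd]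
    simp [mul_comm]

end Setting

/-- A nonzero algebraic element divides a nonzero element of the base ring, the quotient being a
polynomial in it. -/
theorem exists_algebraMap_eq_mul_of_isAlgebraic {A F : Type*} [CommRing A] [Field F] [Algebra A F]
    (B : Subring F) (hB : ∀ a, algebraMap A F a ∈ B) {v : F} (hv : v ∈ B) (hv0 : v ≠ 0)
    (halg : IsAlgebraic A v) : ∃ a : A, a ≠ 0 ∧ ∃ w ∈ B, algebraMap A F a = v * w := by
  obtain ⟨q, hq0, hq⟩ := halg.exists_nonzero_coeff_and_aeval_eq_zero
    (mem_nonZeroDivisors_iff_ne_zero.2 hv0)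
  refine ⟨q.coeff 0, hq0, -Polynomial.aeval v q.divX, neg_mem ?_, ?_⟩
  · rw [Polynomial.aeval_eq_sum_range]
    refine sum_mem fun i _ => ?_
    rw [Algebra.smul_def]
    exact mul_mem (hB _) (pow_mem hv i)
  · rw [← Polynomial.divX_mul_X_add q, map_add, map_mul, Polynomial.aeval_X,
      Polynomial.aeval_C] at hq
    linear_combination hq

namespace Setting
variable {p : ℕ} [hp : Fact p.Prime] (S : Setting.{u} p)

/-! ### Kummer theory over `F_1` -/

/-- The homomorphism `P → F_1` -/
def γF1 : Multiplicative S.P →* S.F1 := (algebraMap S.R S.F1).toMonoidHom.comp S.γ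

theorem γF1_ne_zero (t : Multiplicative S.P) : S.γF1 t ≠ 0 := fun h =>
  S.γ_ne_zero t (S.injective_R_F1 (h.trans (map_zero _).symm))

theorem γF1_l : S.γF1 (.ofAdd S.l) = algebraMap S.Kbar S.F1 (algebraMap S.𝒪K S.Kbar S.ϖ) := by
  rw [← IsScalarTower.algebraMap_apply, IsScalarTower.algebraMap_apply S.𝒪K S.R S.F1, ← S.γ_l]
  rfl

/-- `R_1[1/p]`, as a subalgebra of `F_1` -/
def R1KF1 : Subalgebra S.Kbar S.F1 := S.R1K.comap S.F1.val

theorem R1K_le_F1 {x : S.Fa} (hx : x ∈ S.R1K) : x ∈ S.F1 :=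
  IntermediateField.algebra_adjoin_le_adjoin _ _ hx

theorem γF1_mem (t : Multiplicative S.P) : S.γF1 t ∈ S.R1KF1 :=
  Algebra.subset_adjoin ⟨S.γ t, rfl⟩

section Derivation
variable {S} {D : Derivation S.𝒪K S.F1 S.F1}
  (hK : ∀ x : S.Kbar, D (algebraMap S.Kbar S.F1 x) = 0)
  (hR : ∀ r : S.R, ∃ r' : S.R, D (algebraMap S.R S.F1 r) = algebraMap S.R S.F1 r')
include hK

theorem derivation_mul (x : S.Kbar) (y : S.F1) :
    D (algebraMap S.Kbar S.F1 x * y) = algebraMap S.Kbar S.F1 x * D y := by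
  rw [D.leibniz, hK, smul_zero, add_zero, smul_eq_mul]

include hR

theorem derivation_mem_R1KF1 {x : S.F1} (hx : x ∈ S.R1KF1) : D x ∈ S.R1KF1 := by
  suffices h : ∀ y ∈ S.R1K, ∀ hy : y ∈ S.F1, D ⟨y, hy⟩ ∈ S.R1KF1 from h x hx x.2
  intro y hy
  induction hy using Algebra.adjoin_induction with
  | mem y hy =>
    obtain ⟨r, rfl⟩ := hy
    obtain ⟨r', hr'⟩ := hR r
    intro hy
    have : (⟨algebraMap S.R S.Fa r, hy⟩ : S.F1) = algebraMap S.R S.F1 r := rfl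
    rw [this, hr']
    exact Algebra.subset_adjoin ⟨r', rfl⟩
  | algebraMap x =>
    intro hy
    have : (⟨algebraMap S.Kbar S.Fa x, hy⟩ : S.F1) = algebraMap S.Kbar S.F1 x := rfl
    rw [this, hK]
    exact zero_mem _
  | add x y hx' hy' hx hy =>
    intro _
    have := D.map_add ⟨x, S.R1K_le_F1 hx'⟩ ⟨y, S.R1K_le_F1 hy'⟩
    exact this ▸ add_mem (hx _) (hy _)
  | mul x y hx' hy' hx hy =>
    intro _
    have := D.leibniz ⟨x, S.R1K_le_F1 hx'⟩ ⟨y, S.R1K_le_F1 hy'⟩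
    exact this ▸ add_mem (mul_mem (S := Subalgebra S.Kbar S.F1) hx' (hy _))
      (mul_mem (S := Subalgebra S.Kbar S.F1) hy' (hx _))

/-- A `K̄`-linear derivation of `F_1` that preserves `R` preserves `R_1`. -/
theorem derivation_mem_R1 {x : S.F1} (hx : (x : S.Fa) ∈ S.R1) : (D x : S.Fa) ∈ S.R1 := by
  suffices h : ∀ y ∈ S.R1, ∀ hy : y ∈ S.F1, (D ⟨y, hy⟩ : S.Fa) ∈ S.R1 from h x hx x.2
  intro y hy
  induction hy using Algebra.adjoin_induction with
  | mem y hy =>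
    obtain ⟨r, rfl⟩ := hy
    obtain ⟨r', hr'⟩ := hR r
    intro hy
    have : (⟨algebraMap S.R S.Fa r, hy⟩ : S.F1) = algebraMap S.R S.F1 r := rfl
    rw [this, hr']
    exact S.algebraMap_mem_R1 r'
  | algebraMap x =>
    intro hy
    have : (⟨algebraMap S.OKbar S.Fa x, hy⟩ : S.F1) = algebraMap S.Kbar S.F1 x := rfl
    rw [this, hK]
    exact zero_mem _
  | add x y hx' hy' hx hy =>
    intro _
    have := congrArg (Subtype.val) (D.map_add ⟨x, S.R1K_le_F1 (S.R1_le_R1K hx')⟩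
      ⟨y, S.R1K_le_F1 (S.R1_le_R1K hy')⟩)
    exact this ▸ add_mem (hx _) (hy _)
  | mul x y hx' hy' hx hy =>
    intro _
    have := congrArg (Subtype.val) (D.leibniz ⟨x, S.R1K_le_F1 (S.R1_le_R1K hx')⟩
      ⟨y, S.R1K_le_F1 (S.R1_le_R1K hy')⟩)
    exact this ▸ add_mem (mul_mem hx' (hy _)) (mul_mem hy' (hx _))

end Derivation

/-- The field generated over `K̄` by the image of `P` -/
def chartField : IntermediateField S.Kbar S.F1 :=
  IntermediateField.adjoin S.Kbar (Set.range S.γF1)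

theorem essFiniteType_F1 : Algebra.EssFiniteType S.Kbar S.F1 := by
  rw [IntermediateField.essFiniteType_iff]
  obtain ⟨s, hs⟩ := S.finiteType_R.out
  classical
  refine ⟨s.image (algebraMap S.R S.Fa), le_antisymm ?_ ?_⟩
  · rw [IntermediateField.adjoin_le_iff]
    intro x hx
    obtain ⟨r, -, rfl⟩ := Finset.mem_image.1 hx
    exact IntermediateField.subset_adjoin _ _ ⟨r, rfl⟩
  · refine IntermediateField.adjoin_le_iff.2 ?_
    rintro _ ⟨r, rfl⟩
    have hr : r ∈ Algebra.adjoin S.𝒪K (s : Set S.R) := hs ▸ Algebra.mem_top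
    change _ ∈ IntermediateField.adjoin _ _
    induction hr using Algebra.adjoin_induction with
    | mem r hr =>
      exact IntermediateField.subset_adjoin _ _ (Finset.mem_image_of_mem _ hr)
    | algebraMap x =>
      rw [← IsScalarTower.algebraMap_apply, IsScalarTower.algebraMap_apply S.𝒪K S.Kbar]
      exact IntermediateField.algebraMap_mem _ _
    | add x y _ _ hx hy => rw [map_add]; exact add_mem hx hy
    | mul x y _ _ hx hy => rw [map_mul]; exact mul_mem hx hy

/-- `F_1` is algebraic over the field generated by `P`, because `R` is unramified over the ring of
the chart. -/
theorem isAlgebraic_chartField : Algebra.IsAlgebraic S.chartField S.F1 := by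
  let ch := chartHom S.γ S.γ_l
  let _ : Algebra (ChartRing S.𝒪K S.P S.ϖ S.l) S.R := ch.toRingHom.toAlgebra
  have : Algebra.Etale (ChartRing S.𝒪K S.P S.ϖ S.l) S.R := S.etale
  let _ : Algebra (ChartRing S.𝒪K S.P S.ϖ S.l) S.F1 :=
    ((algebraMap S.R S.F1).comp ch.toRingHom).toAlgebra
  have : IsScalarTower (ChartRing S.𝒪K S.P S.ϖ S.l) S.R S.F1 :=
    IsScalarTower.of_algebraMap_eq fun _ => rfl
  have := S.formallyEtale_F1
  have h1 : Algebra.FormallyUnramified (ChartRing S.𝒪K S.P S.ϖ S.l) S.F1 :=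
    Algebra.FormallyUnramified.comp _ S.R _
  let γL : Multiplicative S.P →* S.chartField :=
    S.γF1.codRestrict S.chartField.toSubfield.toSubmonoid
      fun t => IntermediateField.subset_adjoin _ _ ⟨t, rfl⟩
  have hL : γL (.ofAdd S.l) = algebraMap S.𝒪K S.chartField S.ϖ := by
    refine Subtype.ext (S.γF1_l.trans ?_)
    rw [IsScalarTower.algebraMap_apply S.𝒪K S.Kbar S.chartField]
    rfl
  have : IsScalarTower S.𝒪K S.chartField S.F1 := IsScalarTower.of_algebraMap_eq fun x => by
    rw [IsScalarTower.algebraMap_apply S.𝒪K S.Kbar S.F1,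
      IsScalarTower.algebraMap_apply S.𝒪K S.Kbar S.chartField]
    rfl
  let _ : Algebra (ChartRing S.𝒪K S.P S.ϖ S.l) S.chartField := (chartHom γL hL).toRingHom.toAlgebra
  have hcomp : (IsScalarTower.toAlgHom S.𝒪K S.R S.F1).comp ch =
      (IsScalarTower.toAlgHom S.𝒪K S.chartField S.F1).comp (chartHom γL hL) := by
    apply Ideal.Quotient.algHom_ext
    refine AddMonoidAlgebra.algHom_ext (fun t => ?_) (by ext)
    have h1 := chartHom_monomial γL hL t
    have h2 := chartHom_monomial S.γ S.γ_l t
    exact (congrArg (algebraMap S.R S.F1) h2).trans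
      (congrArg (algebraMap S.chartField S.F1) h1).symm
  have : IsScalarTower (ChartRing S.𝒪K S.P S.ϖ S.l) S.chartField S.F1 :=
    IsScalarTower.of_algebraMap_eq fun b => DFunLike.congr_fun hcomp b
  have : Algebra.FormallyUnramified S.chartField S.F1 :=
    Algebra.FormallyUnramified.of_restrictScalars (ChartRing S.𝒪K S.P S.ϖ S.l) _ _
  have := S.essFiniteType_F1
  have : Algebra.EssFiniteType S.chartField S.F1 := Algebra.EssFiniteType.of_comp S.Kbar _ _
  have := Algebra.FormallyUnramified.isSeparable S.chartField S.F1
  infer_instance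

/-- Every element of `F_1` is a fraction with numerator in `R_1[1/p]` and denominator a linear
combination of elements of `P`. -/
theorem exists_mul_mem_R1KF1 (f : S.F1) : ∃ c : S.P →₀ S.Kbar,
    (c.sum fun t x => x • S.γF1 (.ofAdd t)) ≠ 0 ∧
      (c.sum fun t x => x • S.γF1 (.ofAdd t)) * f ∈ S.R1KF1 := by
  obtain ⟨u, hu, v, hv, huv⟩ := IntermediateField.mem_adjoin_iff_div.1 f.2
  by_cases hf : f = 0
  · refine ⟨Finsupp.single 0 1, ?_, ?_⟩
    · simp
    · rw [hf, mul_zero]; exact zero_mem _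
  have hv0 : v ≠ 0 := by
    rintro rfl
    rw [div_zero] at huv
    exact hf (Subtype.ext huv)
  let A := Algebra.adjoin S.Kbar (Set.range S.γF1)
  have hA : A ≤ S.R1KF1 := by
    rw [Algebra.adjoin_le_iff]
    rintro _ ⟨t, rfl⟩
    exact S.γF1_mem t
  let v' : S.F1 := ⟨v, S.R1K_le_F1 hv⟩
  have hv' : v' ∈ S.R1KF1 := hv
  have halg : IsAlgebraic A v' := by
    have h1 : IsAlgebraic S.chartField v' := S.isAlgebraic_chartField.isAlgebraic _
    open scoped IntermediateField.algebraAdjoinAdjoin in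
    exact (IsFractionRing.isAlgebraic_iff A
      (IntermediateField.adjoin S.Kbar (Set.range S.γF1)) S.F1).2 h1
  -- a nonzero element of `A` is a multiple of `v` in `R_1[1/p]`
  obtain ⟨a, ha0, w, hw, haw⟩ := exists_algebraMap_eq_mul_of_isAlgebraic S.R1KF1.toSubring
    (fun a : A => hA a.2) hv' (fun h => hv0 (congrArg Subtype.val h)) halg
  replace haw : (a : S.F1) = v' * w := haw
  have ha : (a : S.F1) ∈ Submodule.span S.Kbar (Set.range S.γF1) := by
    have h := a.2
    change (a : S.F1) ∈ Subalgebra.toSubmodule A at h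
    rwa [Algebra.adjoin_eq_span,
      show Set.range S.γF1 = (MonoidHom.mrange S.γF1 : Set S.F1) from rfl,
      Submonoid.closure_eq] at h
  obtain ⟨c, hc'⟩ := (Finsupp.mem_span_range_iff_exists_finsupp
    (v := fun t : S.P => S.γF1 (.ofAdd t))).1 ha
  refine ⟨c, ?_, ?_⟩
  · rw [hc']
    exact fun h => ha0 (Subtype.ext h)
  · rw [hc']
    have h2 : v' * f = ⟨u, S.R1K_le_F1 hu⟩ := Subtype.ext (by
      change v * (f : S.Fa) = u
      rw [huv, mul_div_cancel₀ _ hv0])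
    rw [haw, mul_right_comm, h2]
    exact mul_mem (S := Subalgebra S.Kbar S.F1) hu hw

variable {S} in
/-- If every homomorphism `P → ℤ` vanishing at `λ` takes the same value at `s` and `t`, then
`γ(s)` and `γ(t)` differ by a constant. -/
theorem Coords.exists_γF1_eq (X : S.Coords) {s t : S.P} (h : ∀ i, X.κ i s = X.κ i t) :
    ∃ x : S.Kbar, S.γF1 (.ofAdd s) = x • S.γF1 (.ofAdd t) := by
  have : IsAlgClosed S.Kbar := IsAlgClosure.isAlgClosed S.K
  obtain ⟨y, hy⟩ := X.spec s
  obtain ⟨y', hy'⟩ := X.spec t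
  have hm : 0 < X.m := by
    refine Nat.pos_of_ne_zero fun h => ?_
    have := X.coprime
    rw [h, Nat.coprime_zero_left] at this
    exact hp.out.ne_one this
  let γu : Multiplicative S.P →* S.F1ˣ :=
    { toFun := fun t => Units.mk0 (S.γF1 t) (S.γF1_ne_zero t)
      map_one' := Units.ext (map_one _)
      map_mul' := fun _ _ => Units.ext (map_mul _ _ _) }
  let γgp : S.Pgp →+ Additive S.F1ˣ := Algebra.GrothendieckAddGroup.lift γu.toAdditiveRight
  have hγgp (t : S.P) : γgp (Algebra.GrothendieckAddGroup.of t) = .ofMul (γu (.ofAdd t)) :=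
    DFunLike.congr_fun (Algebra.GrothendieckAddGroup.lift.symm_apply_apply _) t
  have h1 : X.m • (γgp (Algebra.GrothendieckAddGroup.of s) -
      γgp (Algebra.GrothendieckAddGroup.of t)) =
        (y - y') • γgp (Algebra.GrothendieckAddGroup.of S.l) := by
    rw [← map_sub, ← map_nsmul, ← map_zsmul, sub_smul, ← hy, ← hy', ← smul_sub]
    simp only [h, sub_sub_sub_cancel_right]
  rw [hγgp, hγgp, hγgp] at h1
  have h2 : (S.γF1 (.ofAdd s) / S.γF1 (.ofAdd t)) ^ X.m = S.γF1 (.ofAdd S.l) ^ (y - y') := by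
    have h3 : (γu (.ofAdd s) / γu (.ofAdd t)) ^ X.m = γu (.ofAdd S.l) ^ (y - y') := h1
    have h4 := congrArg (Units.val) h3
    simpa [γu] using h4
  rw [S.γF1_l, ← map_zpow₀] at h2
  have hint : IsIntegral S.Kbar (S.γF1 (.ofAdd s) / S.γF1 (.ofAdd t)) :=
    IsIntegral.of_pow hm (by rw [h2]; exact isIntegral_algebraMap)
  obtain ⟨x, hx⟩ := minpoly.mem_range_of_degree_eq_one S.Kbar _
    (IsAlgClosed.degree_eq_one_of_irreducible _ (minpoly.irreducible hint))
  exact ⟨x, by rw [Algebra.smul_def, hx, div_mul_cancel₀ _ (S.γF1_ne_zero _)]⟩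

variable {S} in
/-- A `K̄`-subspace of `F_1` stable under the logarithmic derivations and containing a nonzero linear
combination of elements of `P` contains an element of `P`: shorten the combination until all its
terms have the same logarithmic derivatives, hence are proportional. -/
theorem Coords.exists_γF1_mem (X : S.Coords) (J : Submodule S.Kbar S.F1)
    (hJ : ∀ i, ∃ D : Derivation S.𝒪K S.F1 S.F1,
      (∀ x : S.Kbar, D (algebraMap S.Kbar S.F1 x) = 0) ∧
      (∀ t : S.P, D (S.γF1 (.ofAdd t)) = X.κ i t • S.γF1 (.ofAdd t)) ∧ ∀ x ∈ J, D x ∈ J)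
    (c : S.P →₀ S.Kbar) (hc0 : (c.sum fun t x => x • S.γF1 (.ofAdd t)) ≠ 0)
    (hc : (c.sum fun t x => x • S.γF1 (.ofAdd t)) ∈ J) : ∃ t, S.γF1 (.ofAdd t) ∈ J := by
  induction hn : c.support.card using Nat.strong_induction_on generalizing c with
  | _ n ih =>
  set a := c.sum fun t x => x • S.γF1 (.ofAdd t) with ha
  by_cases h : ∃ s ∈ c.support, ∃ s' ∈ c.support, ∃ i, X.κ i s ≠ X.κ i s'
  · obtain ⟨s, hs, s', hs', i, hi⟩ := h
    obtain ⟨D, hD1, hD2, hD3⟩ := hJ i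
    -- `D - κ(s)` removes the monomial `s`
    have key (s : S.P) (hs : s ∈ c.support) (hne : D a - X.κ i s • a ≠ 0) :
        ∃ t, S.γF1 (.ofAdd t) ∈ J := by
      let c'' : S.P →₀ S.Kbar := Finsupp.onFinset c.support
        (fun u => ((X.κ i u - X.κ i s : ℤ) : S.Kbar) * c u) fun u hu => by
          rw [Finsupp.mem_support_iff]
          exact right_ne_zero_of_mul hu
      have hsum : (c''.sum fun t x => x • S.γF1 (.ofAdd t)) = D a - X.κ i s • a := by
        rw [Finsupp.onFinset_sum (g := fun t x => x • S.γF1 (.ofAdd t)) _ fun _ => zero_smul _ _,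
          ha, Finsupp.sum, map_sum, Finset.smul_sum, ← Finset.sum_sub_distrib]
        refine Finset.sum_congr rfl fun u _ => ?_
        rw [Algebra.smul_def (c u), derivation_mul hD1, hD2, Algebra.smul_def]
        simp only [zsmul_eq_mul, map_mul, map_intCast]
        push_cast
        ring
      refine ih _ ?_ c'' (by rwa [hsum]) ?_ rfl
      · rw [← hn]
        refine Finset.card_lt_card (Finset.ssubset_iff_subset_ne.2 ⟨fun u hu => ?_, fun h => ?_⟩)
        · exact Finsupp.support_onFinset_subset hu
        · rw [← h, Finsupp.mem_support_iff] at hs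
          simp [c''] at hs
      · rw [hsum]
        refine sub_mem (hD3 _ hc) ?_
        rw [← Int.cast_smul_eq_zsmul S.Kbar]
        exact J.smul_mem _ hc
    by_cases h1 : D a - X.κ i s • a = 0
    · refine key s' hs' fun h2 => hi ?_
      have h3 : (X.κ i s - X.κ i s') • a = 0 := by rw [sub_smul, ← sub_sub_sub_cancel_left,
        h1, h2, sub_zero]
      rcases smul_eq_zero.1 h3 with h3 | h3
      · exact sub_eq_zero.1 h3
      · exact absurd h3 hc0
    · exact key s hs h1
  · push Not at h
    have hne : c.support.Nonempty := by
      rw [Finset.nonempty_iff_ne_empty, Ne, Finsupp.support_eq_empty]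
      rintro rfl
      exact hc0 Finsupp.sum_zero_index
    obtain ⟨t, ht⟩ := hne
    have h1 : ∃ x : S.Kbar, a = x • S.γF1 (.ofAdd t) := by
      have h2 (s : S.P) : ∃ x : S.Kbar, s ∈ c.support →
          S.γF1 (.ofAdd s) = x • S.γF1 (.ofAdd t) := by
        by_cases hs : s ∈ c.support
        · obtain ⟨x, hx⟩ := X.exists_γF1_eq fun i => h s hs t ht i
          exact ⟨x, fun _ => hx⟩
        · exact ⟨0, fun h => absurd h hs⟩
      choose x hx using h2
      refine ⟨∑ s ∈ c.support, c s * x s, ?_⟩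
      rw [ha, Finsupp.sum, Finset.sum_smul]
      exact Finset.sum_congr rfl fun s hs => by rw [hx s hs, mul_smul]
    obtain ⟨x, hx⟩ := h1
    have hx0 : x ≠ 0 := by
      rintro rfl
      exact hc0 (by rw [hx, zero_smul])
    refine ⟨t, ?_⟩
    have := J.smul_mem x⁻¹ hc
    rwa [hx, inv_smul_smul₀ hx0] at this

variable {S} in
/-- Kummer theory: if `γ(t)/γ(s)` is a `p`-th power `f^p` in `F_1`, then the homomorphisms `P → ℤ`
vanishing at `λ` agree modulo `p` at `s` and `t`. By the logarithmic derivation `D` attached to `κ`,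
`p D(f) = (κ(t) - κ(s)) f`; if the factor is prime to `p`, a multiple of `f` in `R_1` is divisible by
`p` infinitely often. -/
theorem Coords.dvd_of_pow_mul_eq (X : S.Coords) {s t : S.P} {f : S.F1}
    (hf : f ^ p * S.γF1 (.ofAdd s) = S.γF1 (.ofAdd t)) (i : Fin X.n) :
    (p : ℤ) ∣ X.κ i t - X.κ i s := by
  have hp0 : (p : S.F1) ≠ 0 := by
    have : CharZero S.F1 := charZero_of_injective_algebraMap (algebraMap S.Kbar S.F1).injective
    exact Nat.cast_ne_zero.2 hp.out.ne_zero
  have hf0 : f ≠ 0 := by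
    rintro rfl
    rw [zero_pow hp.out.ne_zero, zero_mul] at hf
    exact S.γF1_ne_zero _ hf.symm
  choose D hD1 hD2 hD3 using fun i => S.exists_derivation_F1 (X.κ i) (X.κ_l i)
  have hD3' (i) (t : S.P) : D i (S.γF1 (.ofAdd t)) = X.κ i t • S.γF1 (.ofAdd t) := hD3 i t
  have hDf (i) : (p : S.F1) * D i f = ((X.κ i t : S.F1) - X.κ i s) * f := by
    have h1 := congrArg (D i) hf
    rw [(D i).leibniz, (D i).leibniz_pow, hD3', hD3', ← hf] at h1
    simp only [smul_eq_mul, nsmul_eq_mul, zsmul_eq_mul] at h1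
    have h2 : f ^ p = f ^ (p - 1) * f := (pow_sub_one_mul hp.out.ne_zero f).symm
    rw [h2] at h1
    refine mul_left_cancel₀ (mul_ne_zero (pow_ne_zero (p - 1) hf0) (S.γF1_ne_zero (.ofAdd s))) ?_
    linear_combination h1
  -- the elements `x` such that `x` and `xf` are in `R_1[1/p]` are stable under the derivations, and
  -- include a nonzero combination of elements of `P`; so they include an element of `P`
  obtain ⟨u, hu⟩ : ∃ u, S.γF1 (.ofAdd u) * f ∈ S.R1KF1 := by
    let J : Submodule S.Kbar S.F1 :=
      Subalgebra.toSubmodule S.R1KF1 ⊓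
        (Subalgebra.toSubmodule S.R1KF1).comap (LinearMap.mulRight S.Kbar f)
    obtain ⟨c, hc0, hc⟩ := S.exists_mul_mem_R1KF1 f
    have hJ (i) (x : S.F1) (hx : x ∈ J) : D i x ∈ J := by
      refine ⟨derivation_mem_R1KF1 (hD1 i) (hD2 i) hx.1, ?_⟩
      change D i x * f ∈ S.R1KF1
      have h1 : D i (x * f) ∈ S.R1KF1 := derivation_mem_R1KF1 (hD1 i) (hD2 i) hx.2
      have h2 : x * f ∈ S.R1KF1 := hx.2
      have h3 : D i x * f = D i (x * f) -
          algebraMap S.Kbar S.F1 (((X.κ i t : S.Kbar) - X.κ i s) / p) * (x * f) := by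
        rw [(D i).leibniz, map_div₀, map_sub, map_intCast, map_intCast, map_natCast]
        simp only [smul_eq_mul]
        field_simp
        linear_combination (-x) * hDf i
      rw [h3]
      exact sub_mem h1 (mul_mem (Subalgebra.algebraMap_mem _ _) h2)
    obtain ⟨u, hu⟩ := X.exists_γF1_mem J (fun i => ⟨D i, hD1 i, hD3' i, hJ i⟩) c hc0
      ⟨Submodule.sum_mem _ fun u _ => Submodule.smul_mem _ _ (S.γF1_mem _), hc⟩
    exact ⟨u, hu.2⟩
  obtain ⟨N, hN⟩ := S.exists_p_pow_mul_mem_R1 hu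
  -- if `p` does not divide `κ t - κ s`, this element of `R_1` is divisible by all powers of `p`
  by_contra hdvd
  let f' : S.F1 := p ^ N * (S.γF1 (.ofAdd u) * f)
  let a : ℤ := X.κ i t - X.κ i s + p * X.κ i u
  have ha : IsCoprime (p : ℤ) a := by
    rw [(Nat.prime_iff_prime_int.1 hp.out).coprime_iff_not_dvd]
    rwa [dvd_add_left (dvd_mul_right _ _)]
  obtain ⟨v, w, hvw⟩ := ha
  have hDf' : (p : S.F1) * D i f' = a * f' := by
    have h1 : f' = algebraMap S.Kbar S.F1 (p ^ N) * (S.γF1 (.ofAdd u) * f) := by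
      simp [f']
    rw [h1, derivation_mul (hD1 i), (D i).leibniz, hD3', map_pow, map_natCast]
    simp only [a, smul_eq_mul, zsmul_eq_mul]
    push_cast
    linear_combination (p : S.F1) ^ N * S.γF1 (.ofAdd u) * hDf i
  have hdiv (n : ℕ) : ((f' / p ^ n : S.F1) : S.Fa) ∈ S.R1 := by
    induction n with
    | zero =>
      rw [pow_zero, div_one]
      exact hN
    | succ n ih =>
      have h1 : D i (f' / p ^ n) = a * f' / p ^ (n + 1) := by
        have h2 : f' / p ^ n = algebraMap S.Kbar S.F1 ((p ^ n)⁻¹) * f' := by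
          simp [div_eq_inv_mul]
        rw [h2, derivation_mul (hD1 i), map_inv₀, map_pow, map_natCast]
        field_simp
        linear_combination (p : S.F1) ^ n * hDf'
      have h3 : f' / p ^ (n + 1) = w * D i (f' / p ^ n) + v * (f' / p ^ n) := by
        have h4 : (v : S.F1) * p + w * a = 1 := by exact_mod_cast congrArg (Int.cast) hvw
        rw [h1]
        field_simp
        linear_combination (-f' * p ^ n) * h4
      have h5 := derivation_mem_R1 (hD1 i) (hD2 i) ih
      rw [h3]
      exact add_mem (mul_mem (intCast_mem _ w) h5) (mul_mem (intCast_mem _ v) ih)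
  have h0 : (f' : S.Fa) = 0 := S.eq_zero_of_forall_mem_R1 fun n => by
    simpa using hdiv n
  have h0' : f' = 0 := Subtype.ext h0
  exact mul_ne_zero (pow_ne_zero _ hp0) (mul_ne_zero (S.γF1_ne_zero _) hf0) h0'

end Setting

namespace Setting
variable {p : ℕ} [hp : Fact p.Prime] (S : Setting.{u} p)

/-! ### The Galois group `Δ_∞` -/

theorem root_pow (n : ℕ) (hn : 0 < n) (t : Multiplicative S.P) :
    S.root n t ^ n = algebraMap S.R S.Fa (S.γ t) := by
  rw [← S.root_one, ← S.root_mul n 1 hn one_pos, mul_one]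

theorem rootFinf_pow (n : ℕ) (hn : 0 < n) (t : Multiplicative S.P) :
    S.rootFinf n hn t ^ n = algebraMap S.F1 S.Finf (S.γF1 t) :=
  Subtype.ext (S.root_pow n hn t)

theorem isIntegral_root (n : ℕ) (hn : 0 < n) (t : Multiplicative S.P) :
    IsIntegral S.F1 (S.root n t) :=
  IsIntegral.of_pow hn (by
    rw [S.root_pow n hn]
    exact isIntegral_algebraMap (R := S.F1) (x := S.γF1 t))

instance : IsGalois S.F1 S.Finf := by
  have hint : ∀ x ∈ {x | ∃ n : ℕ, 0 < n ∧ ∃ t, x = S.root n t}, IsIntegral S.F1 x := by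
    rintro _ ⟨n, hn, t, rfl⟩
    exact S.isIntegral_root n hn t
  have halg : Algebra.IsAlgebraic S.F1 S.Finf := IntermediateField.isAlgebraic_adjoin hint
  have : IsAlgClosed S.Kbar := IsAlgClosure.isAlgClosed S.K
  have : CharZero S.F1 := charZero_of_injective_algebraMap (algebraMap S.Kbar S.F1).injective
  have hsplit : ∀ x ∈ {x | ∃ n : ℕ, 0 < n ∧ ∃ t, x = S.root n t},
      IsIntegral S.F1 x ∧ ((minpoly S.F1 x).map (algebraMap S.F1 S.Finf)).Splits := by
    rintro _ ⟨n, hn, t, rfl⟩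
    refine ⟨S.isIntegral_root n hn t, ?_⟩
    have : NeZero (n : S.Kbar) := ⟨Nat.cast_ne_zero.2 hn.ne'⟩
    obtain ⟨ζ, hζ⟩ := HasEnoughRootsOfUnity.exists_primitiveRoot S.Kbar n
    have h1 := X_pow_sub_C_splits_of_isPrimitiveRoot
      (hζ.map_of_injective (algebraMap S.Kbar S.Finf).injective) (S.rootFinf_pow n hn t)
    refine h1.of_dvd (Polynomial.X_pow_sub_C_ne_zero hn _) ?_
    have h2 : minpoly S.F1 (S.root n t) ∣ Polynomial.X ^ n - Polynomial.C (S.γF1 t) := by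
      apply minpoly.dvd
      simp [S.root_pow n hn, γF1]
      exact sub_self _
    simpa using Polynomial.map_dvd (algebraMap S.F1 S.Finf) h2
  have : Normal S.F1 S.Finf := ⟨fun x => by
    have h1 := IntermediateField.splits_of_mem_adjoin S.F1 S.Fa hsplit x.2
    rwa [← minpoly.algHom_eq S.Finf.val Subtype.val_injective x]⟩
  exact {}

/-- An element of `Δ_∞` is determined by its action on the roots of the elements of `P`. -/
theorem Delta_ext {g g' : S.Delta}
    (h : ∀ (n : ℕ) (hn : 0 < n) (t : Multiplicative S.P),
      S.pairing g n hn t = S.pairing g' n hn t) : g = g' := by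
  have h1 : (g : S.Finf →ₐ[S.F1] S.Finf) = g' := by
    refine IntermediateField.algHom_ext_of_eq_adjoin S.F1 rfl ?_
    rintro _ ⟨n, hn, t, rfl⟩
    refine Subtype.ext ((S.pairing_spec g n hn t).trans ?_)
    rw [h]
    exact (S.pairing_spec g' n hn t).symm
  exact AlgEquiv.ext fun x => DFunLike.congr_fun h1 x

theorem Delta_mul_comm (g g' : S.Delta) : g * g' = g' * g :=
  S.Delta_ext fun n hn t => by rw [pairing_mul_left, pairing_mul_left, mul_comm]

/-- The pairing with the `n`-th root of `t`, as a homomorphism. -/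
def pairingHom (n : ℕ) (hn : 0 < n) (t : Multiplicative S.P) : S.Delta →* S.OKbarˣ :=
  MonoidHom.mk' (fun g => S.pairing g n hn t) fun g g' => S.pairing_mul_left g g' n hn t

theorem pairing_pow_left (g : S.Delta) (m n : ℕ) (hn : 0 < n) (t : Multiplicative S.P) :
    S.pairing (g ^ m) n hn t = S.pairing g n hn t ^ m := map_pow (S.pairingHom n hn t) g m

theorem isLocallyConstant_pairing (n : ℕ) (hn : 0 < n) (t : Multiplicative S.P) :
    IsLocallyConstant fun g : S.Delta => S.pairing g n hn t := by
  rw [IsLocallyConstant.iff_exists_open]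
  intro g
  refine ⟨(fun h => g⁻¹ * h) ⁻¹' (MulAction.stabilizer S.Delta (S.rootFinf n hn t) : Set S.Delta),
    (stabilizer_isOpen_of_isIntegral _).preimage (continuous_const_mul g⁻¹), ?_, fun h hh => ?_⟩
  · simp [one_mem]
  · apply S.pairing_unique
    rw [← S.pairing_spec]
    have h1 : (g⁻¹ * h) (S.rootFinf n hn t) = S.rootFinf n hn t := hh
    have h2 := congrArg g h1
    rw [← AlgEquiv.mul_apply, mul_inv_cancel_left] at h2
    rw [h2]

/-- Compactness of `Δ_∞`. -/
theorem exists_forall_mem_of_isClosed (C : ℕ → Set S.Delta) (hC : ∀ i, C (i + 1) ⊆ C i)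
    (hne : ∀ i, (C i).Nonempty) (hcl : ∀ i, IsClosed (C i)) : ∃ g, ∀ i, g ∈ C i := by
  obtain ⟨g, hg⟩ := IsCompact.nonempty_iInter_of_sequence_nonempty_isCompact_isClosed C hC hne
    (hcl 0).isCompact hcl
  exact ⟨g, fun i => Set.mem_iInter.1 hg i⟩

/-! ### The module `ℤ_p(1)` -/

variable {S} in
theorem Zp1_ext {z w : S.Zp1} (h : ∀ n, (z : ℕ → S.OKbarˣ) n = (w : ℕ → S.OKbarˣ) n) : z = w :=
  Subtype.ext (funext h)

variable {S} in
theorem Zp1_apply_pow (z : S.Zp1) (n k : ℕ) :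
    (z : ℕ → S.OKbarˣ) (n + k) ^ p ^ k = (z : ℕ → S.OKbarˣ) n := by
  induction k with
  | zero => simp
  | succ k ih => rw [pow_succ', pow_mul, ← add_assoc, z.2.2, ih]

variable {S} in
/-- An element of `ℤ_p(1)` with trivial component of index `k` is a `p^k`-th power. -/
theorem exists_Zp1_pow_eq {w : S.Zp1} {k : ℕ} (h : (w : ℕ → S.OKbarˣ) k = 1) :
    ∃ u : S.Zp1, (∀ n, (u : ℕ → S.OKbarˣ) n = (w : ℕ → S.OKbarˣ) (n + k)) ∧ u ^ p ^ k = w := by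
  refine ⟨⟨fun n => (w : ℕ → S.OKbarˣ) (n + k), by simpa using h, fun n => ?_⟩, fun _ => rfl,
    Zp1_ext fun n => Zp1_apply_pow w n k⟩
  have h1 := w.2.2 (n + k)
  rwa [add_right_comm] at h1

variable {S} in
theorem Zp1_eq_one_of_pow_eq_one {w : S.Zp1} {m : ℕ} (hm : m.Coprime p) (h : w ^ m = 1) :
    w = 1 := by
  refine Zp1_ext fun n => ?_
  have h1 : (w : ℕ → S.OKbarˣ) n ^ m = 1 := congrFun (congrArg Subtype.val h) n
  have h2 := pow_gcd_eq_one.2 ⟨h1, S.Zp1_pow w n⟩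
  rwa [(hm.pow_right n).gcd_eq_one, pow_one] at h2

variable {S} in
/-- An element of `ℤ_p(1)` with nontrivial component of index `1` generates `ℤ_p(1)` modulo `p^k`.
-/
theorem exists_Zp1_eq_pow_mul {z : S.Zp1} (hz : (z : ℕ → S.OKbarˣ) 1 ≠ 1) (w : S.Zp1) (k : ℕ) :
    ∃ (a : ℕ) (u : S.Zp1), w = z ^ a * u ^ p ^ k := by
  obtain ⟨a, ha⟩ : ∃ a : ℕ, (z : ℕ → S.OKbarˣ) k ^ a = (w : ℕ → S.OKbarˣ) k := by
    cases k with
    | zero => exact ⟨0, by rw [w.2.1, pow_zero]⟩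
    | succ k =>
      have : NeZero (p ^ (k + 1)) := ⟨pow_ne_zero _ hp.out.ne_zero⟩
      obtain ⟨a, -, ha⟩ := (isPrimitiveRoot_Zp1 hz k).eq_pow_of_pow_eq_one
        (ξ := (((w : ℕ → S.OKbarˣ) (k + 1) : S.OKbarˣ) : S.OKbar)) (by
          rw [← Units.val_pow_eq_pow_val, S.Zp1_pow, Units.val_one])
      exact ⟨a, Units.ext (by rw [Units.val_pow_eq_pow_val, ha])⟩
  obtain ⟨u, -, hu⟩ := exists_Zp1_pow_eq (w := w / z ^ a) (k := k) (by
    change (w : ℕ → S.OKbarˣ) k / (z : ℕ → S.OKbarˣ) k ^ a = 1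
    rw [ha, div_self'])
  exact ⟨a, u, by rw [hu, mul_div_cancel]⟩

/-! ### The `p`-primary part of `Δ_∞` -/

namespace Coords
variable {S} (X : S.Coords)

/-- The character `χ_{a_i} / χ_{c_i}` of `Δ_∞` -/
def chi (i : Fin X.n) : S.Delta →* S.Zp1 := S.chi (.ofAdd (X.a i)) / S.chi (.ofAdd (X.c i))

/-- The characters `χ_{a_i} / χ_{c_i}` control all the `χ_t`, because `χ_λ = 1` and the order of
the torsion of `P^gp/ℤλ` is prime to `p`. -/
theorem chi_eq_one {g : S.Delta} (h : ∀ i, X.chi i g = 1) (t : S.P) :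
    S.chi (.ofAdd t) g = 1 := by
  let ψ : S.Pgp →+ Additive S.Zp1 := Algebra.GrothendieckAddGroup.lift
    ((MonoidHom.eval g).comp S.chi).toAdditiveRight
  have hψ (t : S.P) : ψ (Algebra.GrothendieckAddGroup.of t) = .ofMul (S.chi (.ofAdd t) g) :=
    DFunLike.congr_fun (Algebra.GrothendieckAddGroup.lift.symm_apply_apply _) t
  obtain ⟨y, hy⟩ := X.spec t
  have h1 := congrArg ψ hy
  have h2 (i) : ψ (Algebra.GrothendieckAddGroup.of (X.a i)) -
      ψ (Algebra.GrothendieckAddGroup.of (X.c i)) = 0 := by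
    rw [hψ, hψ]
    exact h i
  have h3 : ψ (Algebra.GrothendieckAddGroup.of S.l) = 0 := by
    rw [hψ, S.chi_l]
    rfl
  rw [map_nsmul, map_sub, map_sum, map_zsmul, h3, smul_zero] at h1
  simp only [map_zsmul, map_sub, h2, smul_zero, Finset.sum_const_zero, sub_zero] at h1
  rw [hψ] at h1
  exact Zp1_eq_one_of_pow_eq_one X.coprime h1

/-- Surjectivity of `Δ_∞ → μ_p^n`: a linear form on `𝔽_p^n` vanishing on the image gives an element of
`P^gp` with a `p`-th root fixed by `Δ_∞`, hence in `F_1`. -/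
theorem exists_chi_one_eq (v : Fin X.n → S.Zp1) :
    ∃ g : S.Delta, ∀ i, (X.chi i g : ℕ → S.OKbarˣ) 1 = (v i : ℕ → S.OKbarˣ) 1 := by
  obtain ⟨z, hz⟩ := S.exists_Zp1_ne_one
  set ζ : S.OKbarˣ := (z : ℕ → S.OKbarˣ) 1 with hζdef
  have hζ : IsPrimitiveRoot ζ p := by
    have h1 := isPrimitiveRoot_Zp1 hz 0
    rw [zero_add, pow_one] at h1
    exact IsPrimitiveRoot.coe_units_iff.1 h1
  have hpow (w : S.Zp1) : ∃ x : ZMod p, (w : ℕ → S.OKbarˣ) 1 = ζ ^ x.val := by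
    have : NeZero p := ⟨hp.out.ne_zero⟩
    obtain ⟨a, u, h⟩ := exists_Zp1_eq_pow_mul hz w 1
    refine ⟨a, ?_⟩
    have h1 := congrArg (fun w : S.Zp1 => (w : ℕ → S.OKbarˣ) 1) h
    have h2 : (w : ℕ → S.OKbarˣ) 1 = ζ ^ a * (u : ℕ → S.OKbarˣ) 1 ^ p ^ 1 := h1
    rw [h2, S.Zp1_pow, mul_one, ZMod.val_natCast, ← pow_eq_pow_mod _ hζ.pow_eq_one]
  have hcast (b : ℕ) : ζ ^ (b : ZMod p).val = ζ ^ b := by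
    rw [ZMod.val_natCast, ← pow_eq_pow_mod _ hζ.pow_eq_one]
  have hadd (x y : ZMod p) : ζ ^ (x + y).val = ζ ^ x.val * ζ ^ y.val := by
    have : NeZero p := ⟨hp.out.ne_zero⟩
    rw [ZMod.val_add, ← pow_eq_pow_mod _ hζ.pow_eq_one, pow_add]
  let W : AddSubgroup (Fin X.n → ZMod p) :=
    { carrier := {x | ∃ g : S.Delta, ∀ i, (X.chi i g : ℕ → S.OKbarˣ) 1 = ζ ^ (x i).val}
      zero_mem' := ⟨1, fun i => by
        rw [map_one, Pi.zero_apply, ZMod.val_zero, pow_zero]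
        rfl⟩
      add_mem' := by
        rintro x y ⟨g, hg⟩ ⟨h, hh⟩
        refine ⟨g * h, fun i => ?_⟩
        rw [map_mul, Pi.add_apply, hadd, ← hg, ← hh]
        rfl
      neg_mem' := by
        rintro x ⟨g, hg⟩
        refine ⟨g⁻¹, fun i => ?_⟩
        have h1 := hadd (x i) (-x i)
        rw [add_neg_cancel, ZMod.val_zero, pow_zero] at h1
        rw [map_inv, Pi.neg_apply, ← inv_eq_of_mul_eq_one_right h1.symm, ← hg]
        rfl }
  suffices hW : AddSubgroup.toZModSubmodule p W = ⊤ by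
    choose x hx using fun i => hpow (v i)
    have : x ∈ AddSubgroup.toZModSubmodule p W := hW ▸ Submodule.mem_top
    obtain ⟨g, hg⟩ := this
    exact ⟨g, fun i => by rw [hg, hx]⟩
  by_contra hW
  obtain ⟨f, hf0, hf⟩ := Submodule.exists_le_ker_of_lt_top _ (lt_top_iff_ne_top.2 hW)
  let b (i : Fin X.n) : ℕ := (f fun j => if i = j then 1 else 0).val
  have hb (i : Fin X.n) : ((b i : ℕ) : ZMod p) = f fun j => if i = j then 1 else 0 :=
    ZMod.natCast_zmod_val _
  let t : S.P := ∑ i, b i • X.a i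
  let s : S.P := ∑ i, b i • X.c i
  -- the `p`-th root of `γ(t)/γ(s)` is fixed by `Δ_∞`
  have hts (g : S.Delta) : S.pairing g (p ^ 1) (pow_pos hp.out.pos 1) (.ofAdd t) =
      S.pairing g (p ^ 1) (pow_pos hp.out.pos 1) (.ofAdd s) := by
    have h1 : S.chi (.ofAdd t) g / S.chi (.ofAdd s) g = ∏ i, X.chi i g ^ b i := by
      simp only [t, s, chi, ofAdd_sum, ofAdd_nsmul, map_prod, map_pow, MonoidHom.finsetProd_apply,
        MonoidHom.pow_apply, MonoidHom.div_apply, div_pow, Finset.prod_div_distrib]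
    choose x hx using fun i => hpow (X.chi i g)
    have h2 : f x = 0 := hf ⟨g, hx⟩
    rw [LinearMap.pi_apply_eq_sum_univ] at h2
    have h3 : ζ ^ (∑ i, (x i).val * b i) = 1 := by
      rw [hζ.pow_eq_one_iff_dvd, ← CharP.cast_eq_zero_iff (ZMod p)]
      push_cast
      rw [← h2]
      exact Finset.sum_congr rfl fun i _ => by rw [hb, ZMod.natCast_zmod_val, smul_eq_mul]
    have h4 : ((∏ i, X.chi i g ^ b i : S.Zp1) : ℕ → S.OKbarˣ) 1 = 1 := by
      rw [← h3, Subgroup.val_finsetProd, Finset.prod_apply, ← Finset.prod_pow_eq_pow_sum]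
      refine Finset.prod_congr rfl fun i _ => ?_
      rw [pow_mul, ← hx]
      rfl
    rw [← h1] at h4
    exact div_eq_one.1 h4
  have hs0 : S.rootFinf (p ^ 1) (pow_pos hp.out.pos 1) (.ofAdd s) ≠ 0 := fun h =>
    S.root_ne_zero (p ^ 1) (pow_pos hp.out.pos 1) (.ofAdd s) (congrArg Subtype.val h)
  obtain ⟨y, hy⟩ := (InfiniteGalois.mem_range_algebraMap_iff_fixed (k := S.F1)
    (S.rootFinf (p ^ 1) (pow_pos hp.out.pos 1) (.ofAdd t) /
      S.rootFinf (p ^ 1) (pow_pos hp.out.pos 1) (.ofAdd s))).2 fun g => by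
    have h1 (t : S.P) : g (S.rootFinf (p ^ 1) (pow_pos hp.out.pos 1) (.ofAdd t)) =
        algebraMap S.Kbar S.Finf
          (S.pairing g (p ^ 1) (pow_pos hp.out.pos 1) (.ofAdd t) : S.OKbar) *
          S.rootFinf (p ^ 1) (pow_pos hp.out.pos 1) (.ofAdd t) :=
      Subtype.ext (S.pairing_spec g _ _ _)
    rw [map_div₀, h1, h1, hts]
    refine mul_div_mul_left _ _ ?_
    rw [Ne, map_eq_zero]
    intro h
    have h2 := (S.pairing g (p ^ 1) (pow_pos hp.out.pos 1) (.ofAdd s)).ne_zero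
    exact h2 (Subtype.ext h)
  have hy' : y ^ p * S.γF1 (.ofAdd s) = S.γF1 (.ofAdd t) := by
    apply (algebraMap S.F1 S.Finf).injective
    rw [map_mul, map_pow, hy, ← S.rootFinf_pow (p ^ 1) (pow_pos hp.out.pos 1),
      ← S.rootFinf_pow (p ^ 1) (pow_pos hp.out.pos 1)]
    conv_lhs =>
      enter [1, 2]
      rw [← pow_one p]
    rw [div_pow, div_mul_cancel₀ _ (pow_ne_zero _ hs0)]
  -- by Kummer theory the coefficients of `f` vanish
  refine hf0 (LinearMap.pi_ext' fun j => LinearMap.ext_ring ?_)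
  have h1 := X.dvd_of_pow_mul_eq hy' j
  have h2 : X.κ j t - X.κ j s = b j := by
    simp only [t, s, map_sum, map_nsmul, ← Finset.sum_sub_distrib, ← smul_sub, X.κ_sub]
    simp
  rw [h2, Int.natCast_dvd_natCast, ← CharP.cast_eq_zero_iff (ZMod p), hb] at h1
  rw [LinearMap.zero_comp, LinearMap.zero_apply, LinearMap.comp_apply, ← h1]
  refine congrArg f (funext fun i => ?_)
  simp [Pi.single_apply, eq_comm]

/-- Surjectivity of `Δ_∞ → ℤ_p(1)^n`, by successive approximation. -/
theorem exists_chi_eq (v : Fin X.n → S.Zp1) : ∃ g : S.Delta, ∀ i, X.chi i g = v i := by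
  have key (k : ℕ) : ∀ v : Fin X.n → S.Zp1, ∃ g : S.Delta, ∀ i,
      (X.chi i g : ℕ → S.OKbarˣ) k = (v i : ℕ → S.OKbarˣ) k := by
    induction k with
    | zero => exact fun v => ⟨1, fun i => by rw [(X.chi i 1).2.1, (v i).2.1]⟩
    | succ k ih =>
      intro v
      obtain ⟨g, hg⟩ := X.exists_chi_one_eq v
      have h1 (i) : ∃ u : S.Zp1, (∀ n, (u : ℕ → S.OKbarˣ) n =
          ((v i / X.chi i g : S.Zp1) : ℕ → S.OKbarˣ) (n + 1)) ∧ u ^ p ^ 1 = v i / X.chi i g :=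
        exists_Zp1_pow_eq (by
          change (v i : ℕ → S.OKbarˣ) 1 / (X.chi i g : ℕ → S.OKbarˣ) 1 = 1
          rw [hg, div_self'])
      choose u hu hu' using h1
      obtain ⟨h, hh⟩ := ih u
      refine ⟨g * h ^ p, fun i => ?_⟩
      rw [map_mul, map_pow]
      change (X.chi i g : ℕ → S.OKbarˣ) (k + 1) * (X.chi i h : ℕ → S.OKbarˣ) (k + 1) ^ p = _
      rw [(X.chi i h).2.2, hh, hu]
      exact mul_div_cancel _ _
  obtain ⟨g, hg⟩ := S.exists_forall_mem_of_isClosed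
    (fun k => {g | ∀ i, (X.chi i g : ℕ → S.OKbarˣ) k = (v i : ℕ → S.OKbarˣ) k})
    (fun k g hg i => by rw [← (X.chi i g).2.2, ← (v i).2.2, hg i]) (fun k => key k v) fun k => by
      rw [Set.ofPred_forall]
      refine isClosed_iInter fun i => ?_
      exact ((S.isLocallyConstant_pairing _ _ _).div
        (S.isLocallyConstant_pairing _ _ _)).isClosed_fiber _
  exact ⟨g, fun i => Zp1_ext fun k => hg k i⟩

/-- The kernel of `Δ_∞ → ℤ_p(1)^n` is `p`-divisible: its elements act on all the `N`-th roots by roots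
of unity of order prime to `p`. -/
theorem exists_pow_eq {g : S.Delta} (hg : ∀ i, X.chi i g = 1) (k : ℕ) :
    ∃ h : S.Delta, h ^ p ^ k = g := by
  have key (N : ℕ) (hN : 0 < N) : ∃ h : S.Delta, ∀ t,
      S.pairing (h ^ p ^ k) N hN t = S.pairing g N hN t := by
    obtain ⟨e, N', hN', hNe⟩ := Nat.exists_eq_pow_mul_and_not_dvd hN.ne' p hp.out.ne_one
    have hN'0 : 0 < N' := Nat.pos_of_ne_zero fun h => hN' (h ▸ dvd_zero p)
    rw [mul_comm] at hNe
    subst hNe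
    have hN1 (t) : S.pairing g (N' * p ^ e) hN t ^ N' = 1 := by
      rw [S.pairing_pow g N' (p ^ e) hN'0 (pow_pos hp.out.pos e)]
      exact congrArg (fun w : S.Zp1 => (w : ℕ → S.OKbarˣ) e) (X.chi_eq_one hg t.toAdd)
    obtain ⟨j, hj⟩ : ∃ j, p ^ k * j ≡ 1 [MOD N'] := by
      rcases (Nat.one_le_iff_ne_zero.2 hN'0.ne').eq_or_lt with h | h
      · exact ⟨0, h ▸ Nat.modEq_one⟩
      · obtain ⟨j, -, hj⟩ := Nat.exists_mul_mod_eq_one_of_coprime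
          (((Nat.Prime.coprime_iff_not_dvd hp.out).2 hN').pow_left k) h
        exact ⟨j, by rw [Nat.ModEq, hj, Nat.mod_eq_of_lt h]⟩
    refine ⟨g ^ j, fun t => ?_⟩
    rw [← pow_mul, pairing_pow_left, mul_comm j, pow_eq_pow_mod _ (hN1 t), hj,
      ← pow_eq_pow_mod _ (hN1 t), pow_one]
  obtain ⟨h, hh⟩ := S.exists_forall_mem_of_isClosed
    (fun i => {h | ∀ t, S.pairing (h ^ p ^ k) i.factorial i.factorial_pos t =
      S.pairing g i.factorial i.factorial_pos t})
    (fun i h hh t => by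
      have h1 := fun g => S.pairing_pow g (i + 1) i.factorial i.succ_pos i.factorial_pos t
      rw [← h1, ← h1]
      exact congrArg (· ^ (i + 1)) (hh t))
    (fun i => key _ _) fun i => by
      rw [Set.ofPred_forall]
      refine isClosed_iInter fun t => ?_
      exact ((S.isLocallyConstant_pairing _ _ _).isClosed_fiber _).preimage
        (continuous_pow (p ^ k))
  refine ⟨h, S.Delta_ext fun n hn t => ?_⟩
  obtain ⟨m, hm⟩ := Nat.dvd_factorial hn le_rfl
  have hm0 : 0 < m := Nat.pos_of_ne_zero fun h => by
    rw [h, mul_zero] at hm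
    exact n.factorial_ne_zero hm
  have h1 (g) : S.pairing g n hn t = S.pairing g n.factorial n.factorial_pos t ^ m := by
    rw [← S.pairing_pow g m n hm0 hn]
    congr 2
    rw [hm, mul_comm]
  rw [h1, h1, hh n]

/-- `Δ_∞` is topologically generated by lifts of generators of `ℤ_p(1)^n` and a `p`-divisible
subgroup. -/
theorem exists_eq_mul_pow {z : S.Zp1} (hz : (z : ℕ → S.OKbarˣ) 1 ≠ 1) (σ : Fin X.n → S.Delta)
    (hσ : ∀ i j : Fin X.n, X.chi i (σ j) = if i = j then z else 1) (g : S.Delta) (k : ℕ) :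
    ∃ h ∈ Subgroup.closure (Set.range σ), ∃ h', g = h * h' ^ p ^ k := by
  choose a u hau using fun i => exists_Zp1_eq_pow_mul hz (X.chi i g) k
  obtain ⟨h₁, hh₁⟩ := X.exists_chi_eq u
  have h2 (s : Finset (Fin X.n)) : ∃ h ∈ Subgroup.closure (Set.range σ), ∀ i,
      X.chi i h = if i ∈ s then z ^ a i else 1 := by
    induction s using Finset.induction_on with
    | empty => exact ⟨1, one_mem _, fun i => by simp⟩
    | insert j s hj ih =>
      obtain ⟨h, hh, hh'⟩ := ih
      refine ⟨σ j ^ a j * h,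
        mul_mem (pow_mem (Subgroup.subset_closure (Set.mem_range_self j)) _) hh,
        fun i => ?_⟩
      rw [map_mul, map_pow, hσ, hh']
      by_cases hij : i = j
      · subst hij
        simp [hj]
      · simp [hij]
  obtain ⟨h, hh, hh'⟩ := h2 Finset.univ
  obtain ⟨h₂, hh₂⟩ := X.exists_pow_eq (g := (h * h₁ ^ p ^ k)⁻¹ * g) (fun i => by
    rw [map_mul, map_inv, map_mul, map_pow, hh', hh₁, hau i, if_pos (Finset.mem_univ i),
      inv_mul_cancel]) k
  refine ⟨h, hh, h₁ * h₂, ?_⟩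
  have hcomm : Commute h₁ h₂ := S.Delta_mul_comm h₁ h₂
  rw [hcomm.mul_pow, hh₂]
  group

end Coords

end Setting

/-! ### Contraction of Higgs fields -/

section Contract
variable {A : Type u} [CommRing A] {E : Type u} [AddCommMonoid E] [Module A E]
  {M : Type u} [AddCommGroup M] [Module A M]

/-- The contraction of `θ : M → M ⊗ E` with a linear form on `E`. -/
def contr (f : E →ₗ[A] A) (θ : M →ₗ[A] M ⊗[A] E) : Module.End A M :=
  (TensorProduct.rid A M).toLinearMap ∘ₗ f.lTensor M ∘ₗ θ

theorem contr_apply (f : E →ₗ[A] A) (θ : M →ₗ[A] M ⊗[A] E) (x : M) :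
    contr f θ x = TensorProduct.rid A M (f.lTensor M (θ x)) := rfl

theorem contr_smul_left (c : A) (f : E →ₗ[A] A) (θ : M →ₗ[A] M ⊗[A] E) :
    contr (c • f) θ = c • contr f θ := by
  ext x
  simp [contr_apply, LinearMap.lTensor_smul]

theorem contr_smul_right (c : A) (f : E →ₗ[A] A) (θ : M →ₗ[A] M ⊗[A] E) :
    contr f (c • θ) = c • contr f θ := by
  ext x
  simp [contr_apply]

/-- Contraction is natural. -/
theorem contr_comm {N : Type u} [AddCommGroup N] [Module A N] (f : E →ₗ[A] A)
    {θ : M →ₗ[A] M ⊗[A] E} {θ' : N →ₗ[A] N ⊗[A] E} {u : M →ₗ[A] N}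
    (h : u.rTensor E ∘ₗ θ = θ' ∘ₗ u) : u ∘ₗ contr f θ = contr f θ' ∘ₗ u := by
  have key (y : M ⊗[A] E) : u (TensorProduct.rid A M (f.lTensor M y)) =
      TensorProduct.rid A N (f.lTensor N (u.rTensor E y)) := by
    induction y with
    | zero => simp
    | tmul m v => simp
    | add y y' hy hy' => simp only [map_add, hy, hy']
  ext x
  have h1 := LinearMap.congr_fun h x
  change u (TensorProduct.rid A M (f.lTensor M (θ x))) =
    TensorProduct.rid A N (f.lTensor N (θ' (u x)))
  rw [key]
  exact congrArg (fun y => TensorProduct.rid A N (f.lTensor N y)) h1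

variable {ι : Type} [Fintype ι]

/-- The map `M → M ⊗ E` with coordinates `w i` with respect to the family `e`. -/
def ofCoord (e : ι → E) (w : ι → Module.End A M) : M →ₗ[A] M ⊗[A] E :=
  ∑ i, (TensorProduct.mk A M E).flip (e i) ∘ₗ w i

theorem ofCoord_apply (e : ι → E) (w : ι → Module.End A M) (x : M) :
    ofCoord e w x = ∑ i, w i x ⊗ₜ e i := by
  simp [ofCoord]

theorem contr_ofCoord (f : E →ₗ[A] A) (e : ι → E) (w : ι → Module.End A M) :
    contr f (ofCoord e w) = ∑ i, f (e i) • w i := by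
  ext x
  simp [contr_apply, ofCoord_apply]

theorem ofCoord_contr_coord (e : Module.Basis ι A E) (θ : M →ₗ[A] M ⊗[A] E) :
    ofCoord e (fun i => contr (e.coord i) θ) = θ := by
  have key (y : M ⊗[A] E) :
      ∑ i, TensorProduct.rid A M ((e.coord i).lTensor M y) ⊗ₜ[A] e i = y := by
    induction y with
    | zero => simp
    | tmul m v =>
      conv_rhs => rw [← e.sum_repr v, TensorProduct.tmul_sum]
      simp [TensorProduct.smul_tmul]
    | add y y' hy hy' =>
      simp only [map_add, TensorProduct.add_tmul, Finset.sum_add_distrib, hy, hy']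
  ext x
  rw [ofCoord_apply]
  exact key (θ x)

theorem contr_eq_sum (e : Module.Basis ι A E) (f : E →ₗ[A] A) (θ : M →ₗ[A] M ⊗[A] E) :
    contr f θ = ∑ i, f (e i) • contr (e.coord i) θ := by
  conv_lhs => rw [← ofCoord_contr_coord e θ, contr_ofCoord]

end Contract

section Wedge
variable {A : Type u} [CommRing A] {E : Type u} [AddCommGroup E] [Module A E]
  {M : Type u} [AddCommGroup M] [Module A M]

theorem wedgeSq_ofCoord {ι : Type} [Fintype ι] (e : ι → E) (w : ι → Module.End A M) (x : M) :
    wedgeSq (ofCoord e w) x =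
      ∑ j, ∑ i, w i (w j x) ⊗ₜ exteriorPower.ιMulti A 2 ![e i, e j] := by
  change (wedgeMap A E).lTensor M ((TensorProduct.assoc A M E E)
    ((ofCoord e w).rTensor E (ofCoord e w x))) = _
  rw [ofCoord_apply]
  simp only [map_sum, LinearMap.rTensor_tmul, ofCoord_apply, TensorProduct.sum_tmul,
    TensorProduct.assoc_tmul, LinearMap.lTensor_tmul]
  rfl

theorem wedgeSq_ofCoord_eq_zero {ι : Type} [Fintype ι] (e : ι → E) (w : ι → Module.End A M)
    (hw : ∀ i j, Commute (w i) (w j)) : wedgeSq (ofCoord e w) = 0 := by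
  classical
  ext x
  rw [wedgeSq_ofCoord, ← Finset.sum_product', LinearMap.zero_apply]
  have hself (v : E) : exteriorPower.ιMulti A 2 ![v, v] = 0 :=
    (exteriorPower.ιMulti A (M := E) 2).map_eq_zero_of_eq ![v, v] (i := 0) (j := 1) rfl (by decide)
  refine Finset.sum_involution (fun a _ => (a.2, a.1)) (fun a _ => ?_) (fun a _ ha h => ha ?_)
    (fun _ _ => by simp) (fun _ _ => rfl)
  · have h1 : w a.2 (w a.1 x) = w a.1 (w a.2 x) := LinearMap.congr_fun (hw a.2 a.1).eq x
    have h2 : exteriorPower.ιMulti A 2 ![e a.1, e a.2] =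
        - exteriorPower.ιMulti A 2 ![e a.2, e a.1] := by
      have h3 := (exteriorPower.ιMulti A (M := E) 2).map_swap ![e a.2, e a.1] (i := 0) (j := 1)
        (by decide)
      rw [← h3]
      congr 1
      ext i
      fin_cases i <;> rfl
    rw [h1, h2, TensorProduct.tmul_neg, add_neg_cancel]
  · have h1 : a.2 = a.1 := congrArg Prod.fst h
    rw [h1, hself, TensorProduct.tmul_zero]

/-- The contractions of a Higgs field commute. -/
theorem commute_contr {θ : M →ₗ[A] M ⊗[A] E} (h : wedgeSq θ = 0) (f f' : E →ₗ[A] A) :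
    Commute (contr f θ) (contr f' θ) := by
  let F : E [⋀^Fin 2]→ₗ[A] A :=
    (Matrix.detRowAlternating (n := Fin 2) (R := A)).compLinearMap (LinearMap.pi ![f, f'])
  let G : ⋀[A]^2 E →ₗ[A] A := exteriorPower.alternatingMapLinearEquiv F
  have hG (u v : E) : G (wedgeMap A E (u ⊗ₜ v)) = f u * f' v - f v * f' u := by
    change exteriorPower.alternatingMapLinearEquiv F (exteriorPower.ιMulti A 2 ![u, v]) = _
    rw [exteriorPower.alternatingMapLinearEquiv_apply_ιMulti]
    refine (Matrix.det_fin_two (R := A) _).trans ?_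
    change f u * f' v - f' u * f v = _
    rw [mul_comm (f' u)]
  have key (y : M ⊗[A] E) : TensorProduct.rid A M (G.lTensor M ((wedgeMap A E).lTensor M
      (TensorProduct.assoc A M E E (θ.rTensor E y)))) =
      contr f θ (TensorProduct.rid A M (f'.lTensor M y)) -
        contr f' θ (TensorProduct.rid A M (f.lTensor M y)) := by
    induction y with
    | zero => simp
    | tmul m v =>
      simp only [LinearMap.rTensor_tmul, LinearMap.lTensor_tmul, TensorProduct.rid_tmul, map_smul,
        contr_apply]
      induction θ m with
      | zero => simp
      | tmul a b =>
        simp only [TensorProduct.assoc_tmul, LinearMap.lTensor_tmul, hG, TensorProduct.rid_tmul,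
          smul_smul, sub_smul]
        rw [mul_comm (f' v)]
      | add y y' hy hy' =>
        simp only [TensorProduct.add_tmul, map_add, smul_add, hy, hy']
        abel
    | add y y' hy hy' =>
      simp only [map_add, hy, hy']
      abel
  refine LinearMap.ext fun x => ?_
  have h1 := key (θ x)
  have h2 : (wedgeMap A E).lTensor M (TensorProduct.assoc A M E E (θ.rTensor E (θ x))) = 0 :=
    LinearMap.congr_fun h x
  rw [h2, map_zero, map_zero] at h1
  exact (sub_eq_zero.1 h1.symm)

end Wedge

namespace Setting
variable {p : ℕ} [hp : Fact p.Prime] (S : Setting.{u} p)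

/-! ### The isomorphism `Ψ_M` -/

/-- A basis of `ξ⁻¹Ω̃ ⊗ R̂_1`, with elements of `Δ_∞` that are dual to it up to the factor `ζ - 1`,
`ζ` being a primitive `p`-th root of unity, and which generate `Δ_∞` modulo any power of `p`. -/
structure Frame where
  n : ℕ
  e : Module.Basis (Fin n) S.R1hat S.E
  σ : Fin n → S.Delta
  ε : S.OKbar
  associated : Associated ε S.tau
  contract_σ : ∀ i j, S.contract (.ofMul (σ j)) (e i) =
    if i = j then algebraMap S.OKbar S.R1hat ε else 0
  exists_eq_mul_pow : ∀ (g : S.Delta) (k : ℕ),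
    ∃ h ∈ Subgroup.closure (Set.range σ), ∃ h', g = h * h' ^ p ^ k

theorem Coords.contract_basis (X : S.Coords) (μ : S.XiInv) (i : Fin X.n) (g : S.Delta) :
    S.contract (.ofMul g) ((1 ⊗ₜ[S.R] (S.dlog (Algebra.GrothendieckAddGroup.of (X.a i)) -
      S.dlog (Algebra.GrothendieckAddGroup.of (X.c i)))) ⊗ₜ[S.OC] μ) =
      algebraMap S.OC S.R1hat (μ (S.tateLog (.ofMul (X.chi i g)))) := by
  rw [TensorProduct.tmul_sub, TensorProduct.sub_tmul, map_sub, contract_tmul, contract_tmul,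
    ← map_sub, ← map_sub, ← map_sub]
  rfl

/-- The contraction is divisible by `c` if the logarithms of the `χ_{a_i} / χ_{c_i}` are. -/
theorem exists_contract_eq (X : S.Coords) (c : S.OKbar) (g : S.Delta)
    (hc : ∀ i, ∃ d : S.XiInv → S.OC, ∀ μ : S.XiInv,
      μ (S.tateLog (.ofMul (X.chi i g))) = algebraMap S.OKbar S.OC c * d μ) :
    ∃ f, S.contract (.ofMul g) = algebraMap S.OKbar S.R1hat c • f := by
  obtain ⟨z, hz⟩ := S.exists_Zp1_ne_one
  obtain ⟨μ, e, hμ, he⟩ := Coords.exists_basis_E X hz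
  choose d hd using hc
  refine ⟨e.constr S.R1hat fun i => algebraMap S.OC S.R1hat (d i μ), e.ext fun i => ?_⟩
  rw [LinearMap.smul_apply, e.constr_basis, he, X.contract_basis, hd, map_mul, smul_eq_mul]
  rfl

/-- The contraction is divisible by `p^(1/(p-1))`. -/
theorem exists_contract_eq_tau (g : S.Delta) :
    ∃ f, S.contract (.ofMul g) = algebraMap S.OKbar S.R1hat S.tau • f := by
  obtain ⟨X⟩ := S.nonempty_coords
  exact S.exists_contract_eq X S.tau g fun i => exists_apply_tateLog_eq _

/-- The contraction is continuous in `g`, at the identity. -/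
theorem exists_contract_eq_pow (k : ℕ) : ∃ U : Set S.Delta, IsOpen U ∧ 1 ∈ U ∧ ∀ g ∈ U,
    ∃ f, S.contract (.ofMul g) = (p : S.R1hat) ^ k • f := by
  obtain ⟨X⟩ := S.nonempty_coords
  refine ⟨{g | ∀ i, (X.chi i g : ℕ → S.OKbarˣ) k = 1}, ?_, fun i => by rw [map_one]; rfl,
    fun g hg => ?_⟩
  · rw [Set.ofPred_forall]
    refine isOpen_iInter_of_finite fun i => ?_
    exact ((S.isLocallyConstant_pairing _ _ _).div
      (S.isLocallyConstant_pairing _ _ _)).isOpen_fiber _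
  · have := S.exists_contract_eq X (p ^ k) g fun i => by
      obtain ⟨u, -, hu⟩ := exists_Zp1_pow_eq (hg i)
      refine ⟨fun μ => μ (S.tateLog (.ofMul u)), fun μ => ?_⟩
      have h1 : S.tateLog (.ofMul (X.chi i g)) = p ^ k • S.tateLog (.ofMul u) := by
        rw [← hu, ofMul_pow, map_nsmul]
      rw [h1, map_nsmul, map_pow, map_natCast, nsmul_eq_mul, Nat.cast_pow]
    rwa [map_pow, map_natCast] at this

theorem nonempty_frame : Nonempty S.Frame := by
  obtain ⟨X⟩ := S.nonempty_coords
  obtain ⟨z, hz⟩ := S.exists_Zp1_ne_one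
  obtain ⟨μ, e, hμ, he⟩ := Coords.exists_basis_E X hz
  choose σ hσ using fun j => X.exists_chi_eq fun i => if i = j then z else 1
  refine ⟨⟨X.n, e, σ, ((z : ℕ → S.OKbarˣ) 1 : S.OKbar) - 1, associated_sub_one_tau hz,
    fun i j => ?_, X.exists_eq_mul_pow hz σ fun i j => hσ j i⟩⟩
  rw [he, X.contract_basis, hσ]
  split_ifs
  · rw [apply_tateLog hz, hμ, mul_one]
    rfl
  · rw [ofMul_one, map_zero, map_zero, map_zero]

section Psi
variable {S} {M : Type u} [AddCommGroup M] [Module S.R1hat M]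

theorem psiInv_apply (θ : M →ₗ[S.R1hat] M ⊗[S.R1hat] S.E) (g : Additive S.Delta) :
    S.psiInv M θ g = contr (S.contract g) θ := rfl

/-- On `O_C`-flat modules, endomorphisms have no `O_K̄`-torsion. -/
theorem IsOCFlat.eq_zero_of_smul_eq_zero (hM : S.IsOCFlat M) {c : S.OKbar} (hc : c ≠ 0)
    {w : Module.End S.R1hat M} (h : algebraMap S.OKbar S.R1hat c • w = 0) : w = 0 :=
  LinearMap.ext fun x => S.isOCFlat_iff.1 hM c (w x) hc (LinearMap.congr_fun h x)

theorem Frame.ε_ne_zero (F : S.Frame) : F.ε ≠ 0 := by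
  rw [F.associated.ne_zero_iff]
  exact S.rpow_ne_zero _

/-- Contraction with `σ_j` gives the `j`-th coordinate of `θ`, up to the factor `ε`. -/
theorem Frame.psiInv_σ (F : S.Frame) (θ : M →ₗ[S.R1hat] M ⊗[S.R1hat] S.E) (j : Fin F.n) :
    S.psiInv M θ (.ofMul (F.σ j)) =
      algebraMap S.OKbar S.R1hat F.ε • contr (F.e.coord j) θ := by
  rw [psiInv_apply, contr_eq_sum F.e]
  simp [F.contract_σ]

/-- `θ ∧ θ = 0` as soon as the endomorphisms obtained by contraction commute. -/
theorem wedgeSq_eq_zero_of_commute (hM : S.IsOCFlat M) {θ : M →ₗ[S.R1hat] M ⊗[S.R1hat] S.E}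
    (h : ∀ g g', Commute (S.psiInv M θ g) (S.psiInv M θ g')) :
    wedgeSq (A := S.R1hat) (E := S.E) θ = 0 := by
  obtain ⟨F⟩ := S.nonempty_frame
  rw [← ofCoord_contr_coord F.e θ]
  refine wedgeSq_ofCoord_eq_zero _ _ fun i j => ?_
  have h1 := (h (.ofMul (F.σ i)) (.ofMul (F.σ j))).eq
  rw [F.psiInv_σ, F.psiInv_σ, smul_mul_smul_comm, smul_mul_smul_comm, ← sub_eq_zero, ← smul_sub,
    ← map_mul] at h1
  exact sub_eq_zero.1 (hM.eq_zero_of_smul_eq_zero (mul_ne_zero F.ε_ne_zero F.ε_ne_zero) h1)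

/-- A field `θ` is determined by its contractions with the elements of `Δ_∞`. -/
theorem psiInv_injective (hM : S.IsOCFlat M) : Function.Injective (S.psiInv M) := by
  intro θ θ' h
  obtain ⟨F⟩ := S.nonempty_frame
  rw [← ofCoord_contr_coord F.e θ, ← ofCoord_contr_coord F.e θ']
  congr 1
  funext j
  have h1 := DFunLike.congr_fun h (.ofMul (F.σ j))
  rw [F.psiInv_σ, F.psiInv_σ, ← sub_eq_zero, ← smul_sub] at h1
  exact sub_eq_zero.1 (hM.eq_zero_of_smul_eq_zero F.ε_ne_zero h1)

/-- A homomorphism from `Δ_∞` to a `p`-adically separated module is determined by its values on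
the elements of a frame. -/
theorem Frame.eq_zero_of_forall_σ (F : S.Frame) {N : Type u} [AddCommGroup N] [Module S.R1hat N]
    [IsHausdorff (Ideal.span {(p : S.R1hat)}) N] {ℓ : Additive S.Delta →+ N}
    (h : ∀ j, ℓ (.ofMul (F.σ j)) = 0) : ℓ = 0 := by
  refine AddMonoidHom.ext fun g => ?_
  refine eq_zero_of_forall_pDvd S.R1hat (p := p) (M := N) fun k => ?_
  obtain ⟨h₁, hh₁, h₂, hg⟩ := F.exists_eq_mul_pow g.toMul k
  have h3 : ℓ (.ofMul h₁) = 0 := by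
    have hle : Subgroup.closure (Set.range F.σ) ≤ (AddMonoidHom.toMultiplicativeRight ℓ).ker := by
      rw [Subgroup.closure_le]
      rintro _ ⟨j, rfl⟩
      exact h j
    exact hle hh₁
  refine ⟨ℓ (.ofMul h₂), ?_⟩
  have h4 : g = .ofMul h₁ + p ^ k • .ofMul h₂ := hg
  rw [h4, map_add, h3, zero_add, map_nsmul]

/-- The contractions of a multiple of `p^β` are multiples of `p^α`. -/
theorem exists_psiInv_eq {α β : ℚ} (hβ0 : 0 ≤ β) (hβ : β = α - 1 / ((p : ℚ) - 1))
    {θ : M →ₗ[S.R1hat] M ⊗[S.R1hat] S.E} (hθ : ∃ θ', θ = S.pPow β • θ') (g : Additive S.Delta) :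
    ∃ w, S.psiInv M θ g = S.pPow α • w := by
  obtain ⟨θ', rfl⟩ := hθ
  obtain ⟨f, hf⟩ := S.exists_contract_eq_tau g.toMul
  have hf' : S.contract g = algebraMap S.OKbar S.R1hat S.tau • f := hf
  refine ⟨contr f θ', ?_⟩
  rw [psiInv_apply, hf', contr_smul_left, contr_smul_right, smul_smul,
    S.pPow_eq_mul_tau hβ0 hβ, mul_comm]

/-- Contraction with `Δ_∞` gives the isomorphism of which `Ψ_M` is the inverse. -/
theorem bijOn_psiInv [Module.Finite S.R1hat M] (hM : S.IsOCFlat M) {α β : ℚ} (hβ0 : 0 ≤ β)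
    (hβ : β = α - 1 / ((p : ℚ) - 1)) :
    Set.BijOn (S.psiInv M) {θ | ∃ θ', θ = S.pPow β • θ'} {ℓ | ∀ g, ∃ w, ℓ g = S.pPow α • w} := by
  refine ⟨fun θ hθ => exists_psiInv_eq hβ0 hβ hθ, (psiInv_injective hM).injOn, ?_⟩
  · intro ℓ hℓ
    obtain ⟨F⟩ := S.nonempty_frame
    choose w hw using hℓ
    obtain ⟨v, hv⟩ := F.associated
    -- prescribe the coordinates of `θ`; the factor `v` comes from `ε v = p^(1/(p-1))`
    refine ⟨ofCoord F.e fun j =>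
      S.pPow β • algebraMap S.OKbar S.R1hat v • w (.ofMul (F.σ j)), ⟨ofCoord F.e fun j =>
      algebraMap S.OKbar S.R1hat v • w (.ofMul (F.σ j)), ?_⟩, ?_⟩
    · ext x
      simp [ofCoord_apply, TensorProduct.smul_tmul', Finset.smul_sum]
    · have := S.isAdicComplete_of_isOCFlat hM
      have := isAdicComplete_end (M := M) (p : S.R1hat)
      rw [← sub_eq_zero, ← neg_eq_zero, neg_sub]
      refine F.eq_zero_of_forall_σ fun j => ?_
      rw [AddMonoidHom.sub_apply, F.psiInv_σ, contr_ofCoord, hw, sub_eq_zero]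
      simp only [Module.Basis.coord_apply, Module.Basis.repr_self, Finsupp.single_apply, ite_smul,
        one_smul, zero_smul, Finset.sum_ite_eq', Finset.mem_univ, if_true]
      rw [smul_smul, smul_smul, S.pPow_eq_mul_tau hβ0 hβ, ← hv, map_mul]
      congr 1
      ring

end Psi

end Setting

/-! ### The `p`-adic topology of a module -/

theorem hasBasis_nhds_adicModuleTopology {A M : Type*} [CommRing A] [AddCommGroup M] [Module A M]
    (c : A) (x : M) : (@nhds M ((Ideal.span {c}).adicModuleTopology M) x).HasBasis
      (fun _ : ℕ => True) fun n => {y | ∃ z, y - x = c ^ n • z} := by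
  let _ := (Ideal.span {c}).adic_basis.topology
  let B := (Ideal.span {c}).ringFilterBasis.moduleFilterBasis ((Ideal.span {c}).adic_module_basis M)
  refine (B.toAddGroupFilterBasis.nhds_hasBasis x).to_hasBasis ?_ ?_
  · rintro _ ⟨n, rfl⟩
    refine ⟨n, trivial, ?_⟩
    rintro y ⟨z, hz⟩
    refine ⟨y - x, ?_, add_sub_cancel x y⟩
    rw [hz]
    exact Submodule.smul_mem_smul (Ideal.pow_mem_pow (Ideal.mem_span_singleton_self c) n)
      Submodule.mem_top
  · intro n _
    refine ⟨_, ⟨n, rfl⟩, ?_⟩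
    rintro _ ⟨y, hy, rfl⟩
    have hy' : y ∈ (Ideal.span {c}) ^ n • (⊤ : Submodule A M) := hy
    rw [Ideal.span_singleton_pow, Submodule.ideal_span_singleton_smul] at hy'
    obtain ⟨z, -, rfl⟩ := hy'
    exact ⟨z, add_sub_cancel_left x _⟩

/-- A linear action is continuous for the `c`-adic topology if it is so at the identity. -/
theorem continuous_action_of_forall {A M G : Type*} [CommRing A] [AddCommGroup M] [Module A M]
    [Group G] [TopologicalSpace G] [IsTopologicalGroup G] (c : A) (ρ : G →* Module.End A M)
    (h : ∀ n : ℕ, ∃ U : Set G, IsOpen U ∧ 1 ∈ U ∧ ∀ g ∈ U, ∀ x, ∃ z, ρ g x - x = c ^ n • z) :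
    letI := (Ideal.span {c}).adicModuleTopology M
    Continuous fun x : G × M => ρ x.1 x.2 := by
  let _ := (Ideal.span {c}).adicModuleTopology M
  rw [continuous_iff_continuousAt]
  rintro ⟨g, x⟩
  rw [ContinuousAt, (hasBasis_nhds_adicModuleTopology c (ρ g x)).tendsto_right_iff]
  intro n _
  obtain ⟨U, hU, h1, h2⟩ := h n
  have hU' : (fun g' => g⁻¹ * g') ⁻¹' U ∈ nhds g :=
    (hU.preimage (continuous_const_mul g⁻¹)).mem_nhds (by simpa using h1)
  rw [nhds_prod_eq]
  filter_upwards [Filter.prod_mem_prod hU'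
    ((hasBasis_nhds_adicModuleTopology c x).mem_of_mem (i := n) trivial)]
  rintro ⟨g', x'⟩ ⟨hg', z, hz⟩
  obtain ⟨y, hy⟩ := h2 _ hg' x'
  refine ⟨ρ g (y + z), ?_⟩
  have h3 : ρ g' x' = ρ g (ρ (g⁻¹ * g') x') := by
    rw [← Module.End.mul_apply, ← map_mul, mul_inv_cancel_left]
  change ρ g' x' - ρ g x = _
  rw [h3, ← map_sub, ← map_smul, smul_add, ← hy, ← hz]
  congr 1
  abel

/-! ### Estimates for exponentials and endomorphisms -/

section
variable {p : ℕ} {A : Type*} [CommRing A] {E : Type*} [Ring E] [Algebra A E]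
  [IsAdicComplete (Ideal.span {(p : A)}) E] (D : ExpDatum p A)

theorem ExpDatum.pDvd_exp_sub_one {k : ℕ} {w : E} (hw : PDvd p k w) :
    PDvd p k (D.exp w - 1) := by
  have h : IsPadicLim p (fun n => D.expSum w n - 1) (D.exp w - 1) := by
    intro k
    obtain ⟨n₀, hn⟩ := D.exp_spec w k
    exact ⟨n₀, fun n h => by rw [sub_sub_sub_cancel_right]; exact hn n h⟩
  refine h.pDvd (n₁ := 1) fun n hn => ?_
  obtain ⟨m, rfl⟩ := Nat.exists_eq_add_of_le' hn
  rw [ExpDatum.expSum, Finset.sum_range_succ', pow_zero, ExpDatum.e, one_smul, add_sub_cancel_right]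
  have h1 (i : ℕ) : PDvd p k (w ^ (i + 1)) := by
    rw [pow_succ]
    exact hw.mul_left _
  exact PDvd.sum fun i _ => (h1 i).smul (D.e (i + 1))

end

/-- An endomorphism with values in `cM` is a multiple of `c`, if `M` has no `c`-torsion. -/
theorem exists_eq_smul_of_forall {A M : Type*} [CommRing A] [AddCommGroup M] [Module A M] {c : A}
    (hc : ∀ x : M, c • x = 0 → x = 0) {u : Module.End A M} (hu : ∀ x, ∃ y, u x = c • y) :
    ∃ w : Module.End A M, u = c • w := by
  choose w hw using hu
  have hinj {x y : M} (h : c • x = c • y) : x = y := by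
    rw [← sub_eq_zero, ← smul_sub] at h
    exact sub_eq_zero.1 (hc _ h)
  refine ⟨⟨⟨w, fun x y => hinj ?_⟩, fun a x => hinj ?_⟩, LinearMap.ext hw⟩
  · rw [smul_add, ← hw, ← hw, ← hw, map_add]
  · rw [RingHom.id_apply, ← hw, map_smul, hw, smul_comm]

namespace Setting
variable {p : ℕ} [hp : Fact p.Prime] {S : Setting.{u} p}

/-! ### Logarithms of quasi-small representations -/

section Basic
variable {M : Type u} [AddCommGroup M] [Module S.R1hat M]

theorem IsOCFlat.nsmul_eq_zero (hM : S.IsOCFlat M) (n : ℕ) (x : M) (hn : n ≠ 0) (h : n • x = 0) :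
    x = 0 := by
  refine S.isOCFlat_iff.1 hM n x ?_ ?_
  · have : (n : S.OKbar) = algebraMap S.𝒪K S.OKbar n := by simp
    rw [this, Ne, ← map_zero (algebraMap S.𝒪K S.OKbar), S.injective_OKbar.eq_iff]
    exact Nat.cast_ne_zero.2 hn
  · rwa [map_natCast, Nat.cast_smul_eq_nsmul]

theorem IsOCFlat.nsmul_end_eq_zero (hM : S.IsOCFlat M) (n : ℕ) (w : Module.End S.R1hat M)
    (hn : n ≠ 0) (h : n • w = 0) : w = 0 :=
  LinearMap.ext fun x => hM.nsmul_eq_zero n (w x) hn (LinearMap.congr_fun h x)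

theorem natCast_mul_R1hat (n : ℕ) (x : S.R1hat) (hn : n ≠ 0) (h : (n : S.R1hat) * x = 0) :
    x = 0 :=
  (S.isOCFlat_of_free (M := S.R1hat)).nsmul_eq_zero n x hn (by rwa [nsmul_eq_mul])

theorem IsOCFlat.pPow_smul_eq_zero (hM : S.IsOCFlat M) (ε : ℚ) (x : M) (h : S.pPow ε • x = 0) :
    x = 0 :=
  S.isOCFlat_iff.1 hM _ x (S.rpow_ne_zero ε) h

theorem IsOCFlat.pPow_smul_end_eq_zero (hM : S.IsOCFlat M) (ε : ℚ) (w : Module.End S.R1hat M)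
    (h : S.pPow ε • w = 0) : w = 0 :=
  LinearMap.ext fun x => hM.pPow_smul_eq_zero ε (w x) (LinearMap.congr_fun h x)

theorem IsOCFlat.commute_of_smul (hM : S.IsOCFlat M) (ε : ℚ) {w w' : Module.End S.R1hat M}
    (h : Commute (S.pPow ε • w) (S.pPow ε • w')) : Commute w w' := by
  have h1 := h.eq
  rw [smul_mul_smul_comm, smul_mul_smul_comm, ← sub_eq_zero, ← smul_sub, ← smul_smul] at h1
  exact sub_eq_zero.1 (hM.pPow_smul_end_eq_zero ε _ (hM.pPow_smul_end_eq_zero ε _ h1))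

theorem q_expDatum {α β : ℚ} (hβ0 : 0 < β) (hβ : β = α - 1 / ((p : ℚ) - 1)) :
    (S.expDatum β hβ0).q = S.pPow α := (S.pPow_eq_mul_tau hβ0.le hβ).symm

/-- A linear map compatible with the contractions of two fields is compatible with the fields. -/
theorem comm_of_psiInv {N : Type u} [AddCommGroup N] [Module S.R1hat N] (hN : S.IsOCFlat N)
    {θ : M →ₗ[S.R1hat] M ⊗[S.R1hat] S.E} {θ' : N →ₗ[S.R1hat] N ⊗[S.R1hat] S.E}
    {u : M →ₗ[S.R1hat] N} (h : ∀ g, u ∘ₗ S.psiInv M θ g = S.psiInv N θ' g ∘ₗ u) :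
    u.rTensor S.E ∘ₗ θ = θ' ∘ₗ u := by
  obtain ⟨F⟩ := S.nonempty_frame
  have h1 (j) (x : M) : u (contr (F.e.coord j) θ x) = contr (F.e.coord j) θ' (u x) := by
    have h2 := LinearMap.congr_fun (h (.ofMul (F.σ j))) x
    rw [F.psiInv_σ, F.psiInv_σ] at h2
    simp only [LinearMap.comp_apply, LinearMap.smul_apply, map_smul] at h2
    rw [← sub_eq_zero, ← smul_sub] at h2
    exact sub_eq_zero.1 (S.isOCFlat_iff.1 hN _ _ F.ε_ne_zero h2)
  rw [← ofCoord_contr_coord F.e θ, ← ofCoord_contr_coord F.e θ']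
  ext x
  simp only [LinearMap.comp_apply, ofCoord_apply, map_sum, LinearMap.rTensor_tmul, h1]

end Basic

section Log
variable {α β : ℚ} {M : Rep.{u} S.R1hat S.Delta}

theorem RepQuasiSmall.finite (hM : S.RepQuasiSmall α M) : Module.Finite S.R1hat M.V := by
  obtain ⟨-, -, ⟨s, hs, -⟩, -⟩ := hM
  exact ⟨s, hs⟩

/-- `Δ_∞` acts trivially modulo `p^α`, since it does on generators. -/
theorem RepQuasiSmall.exists_eq (hM : S.RepQuasiSmall α M) (g : S.Delta) :
    ∃ w, M.ρ g = 1 + S.pPow α • w := by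
  obtain ⟨-, -, ⟨s, hs, hinv⟩, hflat⟩ := hM
  obtain ⟨w, hw⟩ := exists_eq_smul_of_forall (hflat.pPow_smul_eq_zero α) (u := M.ρ g - 1)
      fun x => by
    have hx : x ∈ Submodule.span S.R1hat (s : Set M.V) := hs ▸ Submodule.mem_top
    induction hx using Submodule.span_induction with
    | mem x hx => exact hinv x hx g
    | zero => exact ⟨0, by simp⟩
    | add x y _ _ hx hy =>
      obtain ⟨a, ha⟩ := hx
      obtain ⟨b, hb⟩ := hy
      exact ⟨a + b, by rw [map_add, ha, hb, smul_add]⟩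
    | smul c x _ hx =>
      obtain ⟨a, ha⟩ := hx
      exact ⟨c • a, by rw [map_smul, ha, smul_comm]⟩
  exact ⟨w, by rw [← hw, add_sub_cancel]⟩

variable (hβ0 : 0 < β) (hβ : β = α - 1 / ((p : ℚ) - 1))
include hβ0 hβ

theorem logEnd_eq {M : Type u} [AddCommGroup M] [Module S.R1hat M] (hflat : S.IsOCFlat M)
    [IsAdicComplete (Ideal.span {(p : S.R1hat)}) M]
    [IsAdicComplete (Ideal.span {(p : S.R1hat)}) (Module.End S.R1hat M)]
    (w : Module.End S.R1hat M) :
    IsLog p (1 + S.pPow α • w) ((S.expDatum β hβ0).log w) ∧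
      logEnd p (1 + S.pPow α • w) = (S.expDatum β hβ0).log w := by
  have h := (S.expDatum β hβ0).isLog_log w
  rw [q_expDatum hβ0 hβ] at h
  exact ⟨h, h.logEnd_eq hflat.nsmul_eq_zero⟩

theorem expEnd_eq {M : Type u} [AddCommGroup M] [Module S.R1hat M] (hflat : S.IsOCFlat M)
    [IsAdicComplete (Ideal.span {(p : S.R1hat)}) M]
    [IsAdicComplete (Ideal.span {(p : S.R1hat)}) (Module.End S.R1hat M)]
    (w : Module.End S.R1hat M) :
    IsExp p (S.pPow α • w) ((S.expDatum β hβ0).exp w) ∧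
      expEnd p (S.pPow α • w) = (S.expDatum β hβ0).exp w := by
  have h := (S.expDatum β hβ0).isExp_exp w
  rw [q_expDatum hβ0 hβ] at h
  exact ⟨h, h.expEnd_eq hflat.nsmul_eq_zero⟩

theorem RepQuasiSmall.isLog (hM : S.RepQuasiSmall α M) (g : S.Delta) :
    IsLog p (M.ρ g) (logEnd p (M.ρ g)) := by
  have hc := hM.2.1
  have := isAdicComplete_end (M := M.V) (p : S.R1hat)
  obtain ⟨w, hw⟩ := hM.exists_eq g
  obtain ⟨h1, h2⟩ := logEnd_eq hβ0 hβ hM.2.2.2 w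
  rw [hw, h2]
  exact h1

omit hβ0 hβ in
theorem RepQuasiSmall.commute_rho (hM : S.RepQuasiSmall α M) {g g' : S.Delta}
    {w w' : Module.End S.R1hat M.V} (hw : M.ρ g = 1 + S.pPow α • w)
    (hw' : M.ρ g' = 1 + S.pPow α • w') : Commute w w' := by
  refine hM.2.2.2.commute_of_smul α ?_
  have h1 : S.pPow α • w = M.ρ g - 1 := by rw [hw, add_sub_cancel_left]
  have h2 : S.pPow α • w' = M.ρ g' - 1 := by rw [hw', add_sub_cancel_left]
  rw [h1, h2]
  have h3 : Commute (M.ρ g) (M.ρ g') := by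
    rw [commute_iff_eq, ← map_mul, S.Delta_mul_comm, map_mul]
  exact (h3.sub_left (Commute.one_left _)).sub_right (Commute.one_right _)

theorem RepQuasiSmall.log_mul (hM : S.RepQuasiSmall α M) (g g' : S.Delta) :
    logEnd p (M.ρ (g * g')) = logEnd p (M.ρ g) + logEnd p (M.ρ g') := by
  have hc := hM.2.1
  have := isAdicComplete_end (M := M.V) (p : S.R1hat)
  obtain ⟨w, hw⟩ := hM.exists_eq g
  obtain ⟨w', hw'⟩ := hM.exists_eq g'
  obtain ⟨w'', hw''⟩ := hM.exists_eq (g * g')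
  have h := map_mul M.ρ g g'
  rw [hw, hw', hw''] at h ⊢
  rw [(logEnd_eq hβ0 hβ hM.2.2.2 w).2, (logEnd_eq hβ0 hβ hM.2.2.2 w').2,
    (logEnd_eq hβ0 hβ hM.2.2.2 w'').2]
  refine (S.expDatum β hβ0).log_mul hM.2.2.2.nsmul_end_eq_zero
    (hM.commute_rho hw hw') ?_
  rw [q_expDatum hβ0 hβ]
  exact h

/-- `log φ(g) = p^α w'`, and `w'` commutes with all that commutes with `(φ(g) - 1) / p^α`. -/
theorem RepQuasiSmall.exists_log_eq (hM : S.RepQuasiSmall α M) (g : S.Delta) :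
    ∃ w', logEnd p (M.ρ g) = S.pPow α • w' ∧ ∀ w, M.ρ g = 1 + S.pPow α • w →
      ∀ z, Commute w z → Commute w' z := by
  have hc := hM.2.1
  have := isAdicComplete_end (M := M.V) (p : S.R1hat)
  obtain ⟨w, hw⟩ := hM.exists_eq g
  obtain ⟨w', h1, h2⟩ := (S.expDatum β hβ0).exists_log_eq w
  rw [q_expDatum hβ0 hβ] at h1
  refine ⟨w', by rw [hw, (logEnd_eq hβ0 hβ hM.2.2.2 w).2, h1], fun v hv z hz => h2 z ?_⟩
  have : w = v := by
    rw [hw, add_right_inj, ← sub_eq_zero, ← smul_sub] at hv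
    exact sub_eq_zero.1 (hM.2.2.2.pPow_smul_end_eq_zero α _ hv)
  rwa [this]

/-- `Ψ_M` has values in the multiples of `p^β` and is a right inverse of the contraction. -/
theorem psi_spec {M : Type u} [AddCommGroup M] [Module S.R1hat M] [Module.Finite S.R1hat M]
    (hM : S.IsOCFlat M) {ℓ : Additive S.Delta →+ Module.End S.R1hat M}
    (hℓ : ∀ g, ∃ w, ℓ g = S.pPow α • w) :
    (∃ θ', S.psi M β ℓ = S.pPow β • θ') ∧ S.psiInv M (S.psi M β ℓ) = ℓ := by
  have h : ∃ θ ∈ {θ | ∃ θ', θ = S.pPow β • θ'}, S.psiInv M θ = ℓ :=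
    (bijOn_psiInv hM hβ0.le hβ).surjOn hℓ
  exact ⟨Function.invFunOn_mem h, Function.invFunOn_eq h⟩

theorem RepQuasiSmall.psi_spec (hM : S.RepQuasiSmall α M) :
    (∃ θ', S.psi M.V β (S.logHom M (hM.log_mul hβ0 hβ)) = S.pPow β • θ') ∧
      ∀ g : S.Delta, S.psiInv M.V (S.psi M.V β (S.logHom M (hM.log_mul hβ0 hβ))) (.ofMul g) =
        logEnd p (M.ρ g) := by
  have := hM.finite
  obtain ⟨h1, h2⟩ := Setting.psi_spec (M := M.V) hβ0 hβ hM.2.2.2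
    (ℓ := S.logHom M (hM.log_mul hβ0 hβ)) fun g => by
      obtain ⟨w, hw, -⟩ := hM.exists_log_eq hβ0 hβ g.toMul
      exact ⟨w, hw⟩
  refine ⟨h1, fun g => ?_⟩
  rw [h2]
  rfl

theorem logWellDefined : S.LogWellDefined α β where
  isLog M hM g := RepQuasiSmall.isLog hβ0 hβ hM g
  mul M hM g g' := RepQuasiSmall.log_mul hβ0 hβ hM g g'
  mem M hM g := by
    obtain ⟨w, hw, -⟩ := RepQuasiSmall.exists_log_eq hβ0 hβ hM g
    exact ⟨w, hw⟩
  wedge M hM := by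
    refine wedgeSq_eq_zero_of_commute hM.2.2.2 fun g g' => ?_
    obtain ⟨w, hw⟩ := RepQuasiSmall.exists_eq hM g.toMul
    obtain ⟨w', hw'⟩ := RepQuasiSmall.exists_eq hM g'.toMul
    obtain ⟨v, hv, hvc⟩ := RepQuasiSmall.exists_log_eq hβ0 hβ hM g.toMul
    obtain ⟨v', hv', hvc'⟩ := RepQuasiSmall.exists_log_eq hβ0 hβ hM g'.toMul
    have h1 := (RepQuasiSmall.psi_spec hβ0 hβ hM).2 g.toMul
    have h2 := (RepQuasiSmall.psi_spec hβ0 hβ hM).2 g'.toMul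
    rw [hv] at h1
    rw [hv'] at h2
    have hcomm : Commute v v' := hvc w hw _ (hvc' w' hw' _
      (RepQuasiSmall.commute_rho hM hw hw').symm).symm
    have h3 := (hcomm.smul_left (S.pPow α)).smul_right (S.pPow α)
    rw [← h1, ← h2] at h3
    exact h3
  quasiSmall M hM :=
    ⟨RepQuasiSmall.finite hM, (RepQuasiSmall.psi_spec hβ0 hβ hM).1, hM.2.2.2⟩
  comm M hM N hN f := by
    refine comm_of_psiInv hN.2.2.2 fun g => ?_
    have h1 := (RepQuasiSmall.psi_spec hβ0 hβ hM).2 g.toMul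
    have h2 := (RepQuasiSmall.psi_spec hβ0 hβ hN).2 g.toMul
    have hc := hN.2.1
    have h3 := (RepQuasiSmall.isLog hβ0 hβ hM g.toMul).comm hN.2.2.2.nsmul_eq_zero
      (RepQuasiSmall.isLog hβ0 hβ hN g.toMul) (f := f.hom.toLinearMap)
      (LinearMap.ext fun x => Rep.hom_comm_apply f g.toMul x)
    rw [← h1, ← h2] at h3
    exact h3

end Log

end Setting

namespace Setting
variable {p : ℕ} [hp : Fact p.Prime] {S : Setting.{u} p}

/-! ### Exponentials of quasi-small Higgs fields -/

section Exp
variable {α β : ℚ} {M : Type u} [AddCommGroup M] [Module S.R1hat M]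

/-- The contraction of a `β`-quasi-small Higgs field is divisible by `p^(α + k)` near the identity:
it is divisible by `p^(β + k + 1)`, and `p` is a multiple of `p^(1/(p-1))`. -/
theorem exists_psiInv_eq_pow (hβ0 : 0 ≤ β) (hβ : β = α - 1 / ((p : ℚ) - 1))
    {θ : M →ₗ[S.R1hat] M ⊗[S.R1hat] S.E} (hθ : ∃ θ', θ = S.pPow β • θ') (k : ℕ) :
    ∃ U : Set S.Delta, IsOpen U ∧ 1 ∈ U ∧
      ∀ g ∈ U, ∃ w, S.psiInv M θ (.ofMul g) = S.pPow α • ((p : S.R1hat) ^ k • w) := by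
  obtain ⟨θ', rfl⟩ := hθ
  obtain ⟨U, hU, h1, h⟩ := S.exists_contract_eq_pow (k + 1)
  refine ⟨U, hU, h1, fun g hg => ?_⟩
  obtain ⟨f, hf⟩ := h g hg
  refine ⟨algebraMap S.OKbar S.R1hat (S.tau ^ (p - 2)) • contr f θ', ?_⟩
  have h2 : (p : S.R1hat) = algebraMap S.OKbar S.R1hat S.tau *
      algebraMap S.OKbar S.R1hat (S.tau ^ (p - 2)) := by
    have h3 : p - 1 = p - 2 + 1 := by have := hp.out.two_le; omega
    rw [← map_mul, ← pow_succ', ← h3, S.tau_pow, map_natCast]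
  rw [psiInv_apply, hf, contr_smul_left, contr_smul_right, smul_smul, smul_smul, smul_smul,
    S.pPow_eq_mul_tau hβ0 hβ]
  congr 1
  rw [pow_succ]
  nth_rw 2 [h2]
  ring

variable (hβ0 : 0 < β) (hβ : β = α - 1 / ((p : ℚ) - 1)) [Module.Finite S.R1hat M]
  (hM : S.IsOCFlat M) {θ : M →ₗ[S.R1hat] M ⊗[S.R1hat] S.E} (hθ : ∃ θ', θ = S.pPow β • θ')
include hβ0 hβ hM

omit [Module.Finite S.R1hat M] in
theorem exists_expEnd_eq [IsAdicComplete (Ideal.span {(p : S.R1hat)}) M] {k : ℕ}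
    {v w : Module.End S.R1hat M} (h : v = S.pPow α • ((p : S.R1hat) ^ k • w)) :
    ∃ w', expEnd p v = 1 + (p : S.R1hat) ^ k • w' := by
  have := isAdicComplete_end (M := M) (p : S.R1hat)
  obtain ⟨z, hz⟩ := (S.expDatum β hβ0).pDvd_exp_sub_one (A := S.R1hat) (p := p) (k := k)
    (w := (p : S.R1hat) ^ k • w) ⟨w, by rw [← Nat.cast_pow, Nat.cast_smul_eq_nsmul]⟩
  refine ⟨z, ?_⟩
  rw [h, (expEnd_eq hβ0 hβ hM _).2, ← sub_eq_iff_eq_add', hz, ← Nat.cast_pow,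
    Nat.cast_smul_eq_nsmul]

theorem expEnd_zero : expEnd p (0 : Module.End S.R1hat M) = 1 := by
  have := S.isAdicComplete_of_isOCFlat hM
  have := isAdicComplete_end (M := M) (p : S.R1hat)
  have h := (expEnd_eq hβ0 hβ hM 0).2
  rwa [smul_zero, ExpDatum.exp_zero] at h

include hθ

theorem isExp_psiInv (g : Additive S.Delta) :
    IsExp p (S.psiInv M θ g) (expEnd p (S.psiInv M θ g)) := by
  have := S.isAdicComplete_of_isOCFlat hM
  have := isAdicComplete_end (M := M) (p : S.R1hat)
  obtain ⟨w, hw⟩ := exists_psiInv_eq hβ0.le hβ hθ g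
  obtain ⟨h1, h2⟩ := expEnd_eq hβ0 hβ hM w
  rw [hw, h2]
  exact h1

theorem expEnd_psiInv_add (hw : wedgeSq (A := S.R1hat) (E := S.E) θ = 0) (g g' : Additive S.Delta) :
    expEnd p (S.psiInv M θ (g + g')) =
      expEnd p (S.psiInv M θ g) * expEnd p (S.psiInv M θ g') := by
  have := S.isAdicComplete_of_isOCFlat hM
  have := isAdicComplete_end (M := M) (p : S.R1hat)
  obtain ⟨w, hw1⟩ := exists_psiInv_eq hβ0.le hβ hθ g
  obtain ⟨w', hw2⟩ := exists_psiInv_eq hβ0.le hβ hθ g'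
  have hc : Commute w w' := by
    refine hM.commute_of_smul α ?_
    rw [← hw1, ← hw2]
    exact commute_contr hw _ _
  rw [map_add, hw1, hw2, ← smul_add, (expEnd_eq hβ0 hβ hM _).2, (expEnd_eq hβ0 hβ hM _).2,
    (expEnd_eq hβ0 hβ hM _).2]
  exact (S.expDatum β hβ0).exp_add natCast_mul_R1hat hc

theorem exists_expEnd_psiInv_eq (g : Additive S.Delta) :
    ∃ w', expEnd p (S.psiInv M θ g) = 1 + S.pPow α • w' := by
  have := S.isAdicComplete_of_isOCFlat hM
  have := isAdicComplete_end (M := M) (p : S.R1hat)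
  obtain ⟨w, hw⟩ := exists_psiInv_eq hβ0.le hβ hθ g
  obtain ⟨w', h1, -⟩ := (S.expDatum β hβ0).exists_exp_eq w
  rw [q_expDatum hβ0 hβ] at h1
  exact ⟨w', by rw [hw, (expEnd_eq hβ0 hβ hM _).2, h1]⟩

theorem logEnd_expEnd_psiInv (g : Additive S.Delta) :
    logEnd p (expEnd p (S.psiInv M θ g)) = S.psiInv M θ g := by
  have := S.isAdicComplete_of_isOCFlat hM
  have := isAdicComplete_end (M := M) (p : S.R1hat)
  obtain ⟨w, hw⟩ := exists_psiInv_eq hβ0.le hβ hθ g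
  obtain ⟨w', h1, -⟩ := (S.expDatum β hβ0).exists_exp_eq w
  have h2 := (S.expDatum β hβ0).log_exp natCast_mul_R1hat hM.nsmul_end_eq_zero h1
  rw [q_expDatum hβ0 hβ] at h1 h2
  rw [hw, (expEnd_eq hβ0 hβ hM _).2, h1, (logEnd_eq hβ0 hβ hM _).2, h2]

omit hθ in
theorem expEnd_logEnd {u : Module.End S.R1hat M} (hu : ∃ w, u = 1 + S.pPow α • w) :
    expEnd p (logEnd p u) = u := by
  have := S.isAdicComplete_of_isOCFlat hM
  have := isAdicComplete_end (M := M) (p : S.R1hat)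
  obtain ⟨w, rfl⟩ := hu
  obtain ⟨w', h1, -⟩ := (S.expDatum β hβ0).exists_log_eq w
  have h2 := (S.expDatum β hβ0).exp_log natCast_mul_R1hat hM.nsmul_end_eq_zero
    (fun x h => hM.pPow_smul_end_eq_zero α x (by rwa [q_expDatum hβ0 hβ] at h)) h1
  rw [q_expDatum hβ0 hβ] at h1 h2
  rw [(logEnd_eq hβ0 hβ hM _).2, h1, (expEnd_eq hβ0 hβ hM _).2, h2]

end Exp

section WellDefined
variable {α β : ℚ} (hβ0 : 0 < β) (hβ : β = α - 1 / ((p : ℚ) - 1))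
include hβ0 hβ

theorem isCont_of {M : Type u} [AddCommGroup M] [Module S.R1hat M] [Module.Finite S.R1hat M]
    (hM : S.IsOCFlat M) {θ : M →ₗ[S.R1hat] M ⊗[S.R1hat] S.E} (hθ : ∃ θ', θ = S.pPow β • θ')
    (ρ : Representation S.R1hat S.Delta M)
    (hρ : ∀ g, ρ g = expEnd p (S.psiInv M θ (.ofMul g))) : S.IsCont (Rep.of ρ) := by
  refine continuous_action_of_forall (p : S.R1hat) ρ fun k => ?_
  have := S.isAdicComplete_of_isOCFlat hM
  obtain ⟨U, hU, h1, h⟩ := exists_psiInv_eq_pow hβ0.le hβ hθ k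
  refine ⟨U, hU, h1, fun g hg x => ?_⟩
  obtain ⟨w, hw⟩ := h g hg
  obtain ⟨w', hw'⟩ := exists_expEnd_eq hβ0 hβ hM hw
  refine ⟨w' x, ?_⟩
  rw [hρ, hw', LinearMap.add_apply, Module.End.one_apply, add_sub_cancel_left,
    LinearMap.smul_apply]

theorem repQuasiSmall_of {M : Type u} [AddCommGroup M] [Module S.R1hat M]
    [hfin : Module.Finite S.R1hat M]
    (hM : S.IsOCFlat M) {θ : M →ₗ[S.R1hat] M ⊗[S.R1hat] S.E} (hθ : ∃ θ', θ = S.pPow β • θ')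
    (ρ : Representation S.R1hat S.Delta M)
    (hρ : ∀ g, ρ g = expEnd p (S.psiInv M θ (.ofMul g))) :
    S.RepQuasiSmall α (Rep.of ρ) ∧ ∀ x, S.IsInvariantMod α (Rep.of ρ) x := by
  have hinv : ∀ x, S.IsInvariantMod α (Rep.of ρ) x := fun x g => by
    obtain ⟨w', hw'⟩ := exists_expEnd_psiInv_eq hβ0 hβ hM hθ (.ofMul g)
    refine ⟨w' x, ?_⟩
    change ρ g x - x = _
    rw [hρ, hw', LinearMap.add_apply, Module.End.one_apply, add_sub_cancel_left,
      LinearMap.smul_apply]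
  obtain ⟨s, hs⟩ := hfin.fg_top
  exact ⟨⟨isCont_of hβ0 hβ hM hθ ρ hρ, S.isAdicComplete_of_isOCFlat hM,
    ⟨s, hs, fun x _ => hinv x⟩, hM⟩, hinv⟩

theorem expWellDefined : S.ExpWellDefined α β where
  isExp N hN g := by
    have := hN.1
    exact isExp_psiInv hβ0 hβ hN.2.2 hN.2.1 g
  one N hN := by
    have := hN.1
    rw [map_zero, expEnd_zero hβ0 hβ hN.2.2]
  mul N hN g g' := by
    have := hN.1
    exact expEnd_psiInv_add hβ0 hβ hN.2.2 hN.2.1 N.wedge g g'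
  quasiSmall N hN := by
    have := hN.1
    exact (repQuasiSmall_of hβ0 hβ hN.2.2 hN.2.1 _ fun g => rfl).1
  comm N hN N' hN' f g := by
    have := hN.1
    have := hN'.1
    have := S.isAdicComplete_of_isOCFlat hN'.2.2
    exact (isExp_psiInv hβ0 hβ hN.2.2 hN.2.1 (.ofMul g)).comm hN'.2.2.nsmul_eq_zero
      (isExp_psiInv hβ0 hβ hN'.2.2 hN'.2.1 (.ofMul g)) (contr_comm _ f.comm)

end WellDefined

end Setting

/-! ### The equivalences of categories -/

/-- An equivalence between full subcategories restricts to smaller full subcategories that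
correspond to each other. -/
theorem exists_equivalence_restrict {C D : Type*} [Category C] [Category D]
    {P P' : ObjectProperty C} {Q Q' : ObjectProperty D} (hP : P ≤ P') (hQ : Q ≤ Q')
    (e : P'.FullSubcategory ≌ Q'.FullSubcategory)
    (h : ∀ X (hX : P X), Q (e.functor.obj ⟨X, hP X hX⟩).obj)
    (h' : ∀ Y (hY : Q Y), P (e.inverse.obj ⟨Y, hQ Y hY⟩).obj) :
    ∃ e' : P.FullSubcategory ≌ Q.FullSubcategory,
      e'.functor ⋙ ObjectProperty.ιOfLE hQ = ObjectProperty.ιOfLE hP ⋙ e.functor ∧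
      e'.inverse ⋙ ObjectProperty.ιOfLE hP = ObjectProperty.ιOfLE hQ ⋙ e.inverse := by
  let F : P.FullSubcategory ⥤ Q.FullSubcategory :=
    Q.lift (ObjectProperty.ιOfLE hP ⋙ e.functor ⋙ Q'.ι) fun X => h X.obj X.property
  let G : Q.FullSubcategory ⥤ P.FullSubcategory :=
    P.lift (ObjectProperty.ιOfLE hQ ⋙ e.inverse ⋙ P'.ι) fun Y => h' Y.obj Y.property
  let η : 𝟭 P.FullSubcategory ≅ F ⋙ G :=
    NatIso.ofComponents
      (fun X => P.isoMk (P'.ι.mapIso (e.unitIso.app ((ObjectProperty.ιOfLE hP).obj X))))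
      fun {X Y} f => by
        ext
        exact congrArg (fun g => g.hom)
          (e.unitIso.hom.naturality ((ObjectProperty.ιOfLE hP).map f))
  let ε : G ⋙ F ≅ 𝟭 Q.FullSubcategory :=
    NatIso.ofComponents
      (fun Y => Q.isoMk (Q'.ι.mapIso (e.counitIso.app ((ObjectProperty.ιOfLE hQ).obj Y))))
      fun {X Y} f => by
        ext
        exact congrArg (fun g => g.hom)
          (e.counitIso.hom.naturality ((ObjectProperty.ιOfLE hQ).map f))
  exact ⟨CategoryTheory.Equivalence.mk F G η ε, rfl, rfl⟩

/-- Higgs fields that agree define isomorphic Higgs modules. -/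
def HiggsMod.isoOfEq {A E : Type u} [CommRing A] [AddCommGroup E] [Module A E] {M : Type u}
    [AddCommGroup M] [Module A M] {θ θ' : M →ₗ[A] M ⊗[A] E} (h : wedgeSq θ = 0)
    (h' : wedgeSq θ' = 0) (hθ : θ = θ') :
    (⟨M, θ, h⟩ : HiggsMod A E) ≅ ⟨M, θ', h'⟩ where
  hom := ⟨LinearMap.id, by
    rw [LinearMap.rTensor_id, LinearMap.id_comp, LinearMap.comp_id]
    exact hθ⟩
  inv := ⟨LinearMap.id, by
    rw [LinearMap.rTensor_id, LinearMap.id_comp, LinearMap.comp_id]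
    exact hθ.symm⟩
  hom_inv_id := rfl
  inv_hom_id := rfl

/-- Actions that agree define isomorphic representations. -/
def repIsoOfEq {A G M : Type u} [CommRing A] [Monoid G] [AddCommGroup M] [Module A M]
    {ρ ρ' : Representation A G M} (h : ∀ g, ρ g = ρ' g) : Rep.of ρ ≅ Rep.of ρ' where
  hom := Rep.ofHom ⟨LinearMap.id, fun g => by rw [LinearMap.id_comp, LinearMap.comp_id, h]⟩
  inv := Rep.ofHom ⟨LinearMap.id, fun g => by rw [LinearMap.id_comp, LinearMap.comp_id, h]⟩
  hom_inv_id := rfl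
  inv_hom_id := rfl

namespace Setting
variable {p : ℕ} [hp : Fact p.Prime] {S : Setting.{u} p} {α β : ℚ}

/-- The functors are quasi-inverse equivalences: their composites do not change the actions and the
Higgs fields. -/
theorem exists_equivalence (hβ0 : 0 < β) (hβ : β = α - 1 / ((p : ℚ) - 1))
    (hlog : S.LogWellDefined α β) (hexp : S.ExpWellDefined α β) :
    ∃ e : (S.RepQuasiSmall α).FullSubcategory ≌ (S.HiggsQuasiSmall β).FullSubcategory,
      e.functor = logFunctor hlog ∧ e.inverse = expFunctor hexp := by
  have h1 (M : (S.RepQuasiSmall α).FullSubcategory) (g : S.Delta) :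
      M.obj.ρ g = ((logFunctor hlog ⋙ expFunctor hexp).obj M).obj.ρ g := by
    have := RepQuasiSmall.finite M.property
    have h := (RepQuasiSmall.psi_spec hβ0 hβ M.property).2 g
    have h' := expEnd_logEnd hβ0 hβ M.property.2.2.2 (RepQuasiSmall.exists_eq M.property g)
    rw [← h] at h'
    exact h'.symm
  have h2 (N : (S.HiggsQuasiSmall β).FullSubcategory) :
      ((expFunctor hexp ⋙ logFunctor hlog).obj N).obj.θ = N.obj.θ := by
    have := N.property.1
    refine psiInv_injective (M := N.obj.carrier) N.property.2.2 (AddMonoidHom.ext fun g => ?_)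
    have h := (RepQuasiSmall.psi_spec hβ0 hβ ((expFunctor hexp).obj N).property).2 g.toMul
    refine h.trans ?_
    exact logEnd_expEnd_psiInv hβ0 hβ N.property.2.2 N.property.2.1 g
  let η : 𝟭 _ ≅ logFunctor hlog ⋙ expFunctor hexp :=
    NatIso.ofComponents (fun M => (S.RepQuasiSmall α).isoMk (repIsoOfEq (h1 M)))
      fun {M N} f => rfl
  let ε : expFunctor hexp ⋙ logFunctor hlog ≅ 𝟭 _ :=
    NatIso.ofComponents (fun N => (S.HiggsQuasiSmall β).isoMk
      (HiggsMod.isoOfEq ((expFunctor hexp ⋙ logFunctor hlog).obj N).obj.wedge N.obj.wedge (h2 N)))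
      fun {M N} f => rfl
  exact ⟨CategoryTheory.Equivalence.mk _ _ η ε, rfl, rfl⟩

theorem repSmall_le : S.RepSmall α ≤ S.RepQuasiSmall α := by
  rintro M ⟨hc, n, b, hb⟩
  have := Module.Free.of_basis b
  have := Module.Finite.of_basis b
  have hflat := S.isOCFlat_of_free (M := M.V)
  classical
  refine ⟨hc, S.isAdicComplete_of_isOCFlat hflat, ⟨Finset.univ.image b, ?_, ?_⟩, hflat⟩
  · rw [Finset.coe_image, Finset.coe_univ, Set.image_univ, b.span_eq]
  · intro x hx
    obtain ⟨i, -, rfl⟩ := Finset.mem_image.1 hx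
    exact hb i

theorem higgsSmall_le : S.HiggsSmall β ≤ S.HiggsQuasiSmall β := by
  rintro N ⟨hf, hθ, hfree⟩
  exact ⟨hf, hθ, S.isOCFlat_of_free⟩

theorem higgsSmall_logFunctor (hlog : S.LogWellDefined α β) (M : Rep.{u} S.R1hat S.Delta)
    (hM : S.RepSmall α M) :
    S.HiggsSmall β ((logFunctor hlog).obj ⟨M, repSmall_le M hM⟩).obj := by
  have h := ((logFunctor hlog).obj ⟨M, repSmall_le M hM⟩).property
  obtain ⟨n, b, -⟩ := hM.2
  exact ⟨h.1, h.2.1, Module.Free.of_basis b⟩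

/-- All the elements of the representation attached to a Higgs module are invariant modulo `p^α`,
in particular those of a basis. -/
theorem repSmall_expFunctor (hβ0 : 0 < β) (hβ : β = α - 1 / ((p : ℚ) - 1))
    (hexp : S.ExpWellDefined α β) (N : S.MH) (hN : S.HiggsSmall β N) :
    S.RepSmall α ((expFunctor hexp).obj ⟨N, higgsSmall_le N hN⟩).obj := by
  have hN' := higgsSmall_le N hN
  obtain ⟨hf, hθ, hfree⟩ := hN
  obtain ⟨h1, h2⟩ := repQuasiSmall_of hβ0 hβ hN'.2.2 hθ
    (S.expRep N (hexp.one N hN') (hexp.mul N hN')) fun g => rfl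
  exact ⟨h1.1, _, (Module.Free.chooseBasis S.R1hat N.carrier).reindex (Fintype.equivFin _),
    fun i => h2 _⟩

end Setting
end
end FaltingsHiggs

theorem proposition11p7 {p : ℕ} [Fact p.Prime] (S : FaltingsHiggs.Setting.{u} p) (α β : ℚ)
    (hα : 1 / ((p : ℚ) - 1) < α) (hβ : β = α - 1 / ((p : ℚ) - 1)) :
    (∀ (M : Type u) [AddCommGroup M] [Module S.R1hat M],
      Module.Finite S.R1hat M → S.IsOCFlat M →
      Set.BijOn (S.psiInv M) {θ | ∃ θ', θ = S.pPow β • θ'}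
        {ℓ | ∀ g, ∃ w, ℓ g = S.pPow α • w}) ∧
    ∃ (hlog : S.LogWellDefined α β) (hexp : S.ExpWellDefined α β),
      (∃ e : (S.RepQuasiSmall α).FullSubcategory ≌ (S.HiggsQuasiSmall β).FullSubcategory,
        e.functor = FaltingsHiggs.Setting.logFunctor hlog ∧
          e.inverse = FaltingsHiggs.Setting.expFunctor hexp) ∧
      ∃ (hR : S.RepSmall α ≤ S.RepQuasiSmall α) (hH : S.HiggsSmall β ≤ S.HiggsQuasiSmall β)
        (e : (S.RepSmall α).FullSubcategory ≌ (S.HiggsSmall β).FullSubcategory),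
        e.functor ⋙ ObjectProperty.ιOfLE hH =
          ObjectProperty.ιOfLE hR ⋙ FaltingsHiggs.Setting.logFunctor hlog ∧
        e.inverse ⋙ ObjectProperty.ιOfLE hR =
          ObjectProperty.ιOfLE hH ⋙ FaltingsHiggs.Setting.expFunctor hexp := by
  have hβ0 : 0 < β := by rw [hβ]; exact sub_pos.2 hα
  refine ⟨fun M _ _ _ hM => FaltingsHiggs.Setting.bijOn_psiInv hM hβ0.le hβ,
    FaltingsHiggs.Setting.logWellDefined hβ0 hβ, FaltingsHiggs.Setting.expWellDefined hβ0 hβ, ?_⟩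
  obtain ⟨e, h1, h2⟩ := FaltingsHiggs.Setting.exists_equivalence hβ0 hβ
    (FaltingsHiggs.Setting.logWellDefined hβ0 hβ) (FaltingsHiggs.Setting.expWellDefined hβ0 hβ)
  refine ⟨⟨e, h1, h2⟩, FaltingsHiggs.Setting.repSmall_le, FaltingsHiggs.Setting.higgsSmall_le, ?_⟩
  rw [← h1, ← h2]
  refine FaltingsHiggs.exists_equivalence_restrict _ _ e (fun M hM => ?_) fun N hN => ?_
  · rw [h1]
    exact FaltingsHiggs.Setting.higgsSmall_logFunctor _ M hM
  · rw [h2]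
    exact FaltingsHiggs.Setting.repSmall_expFunctor hβ0 hβ _ N hN
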